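/- Let $\mathbb{F}_q$ be a finite field of odd characteristic, $K=\mathbb{F}_q(t)$, $\gamma\in\mathbb{F}_q^\times$, $a\ge 1$ an integer, and let $E_{a,\gamma}/K$ be the elliptic curve $$y^2 = x\,(x+16\gamma)\,\bigl(x+(t^{q^a}-t)^2\bigr).$$ Its $L$-function is the power series $$L(E_{a,\gamma},T)=\prod_{v\text{ good}}\bigl(1-a_vT^{\deg v}+q^{\deg v}T^{2\deg v}\bigr)^{-1}\prod_{v\text{ bad}}\bigl(1-a_vT^{\deg v}\bigr)^{-1}\in\mathbb{Z}[[T]],$$ the products running over all places $v$ of $K$ (including $\infty$); here $a_v=q^{\deg v}+1-|\widetilde E_v(\mathbb{F}_v)|$ at a place of good reduction ($\widetilde E_v$ being the reduction of a minimal model at $v$ and $\mathbb{F}_v$ the residue field), and $a_v=1,-1,0$ at a place of split multiplicative, nonsplit multiplicative, additive reduction, respectively. Let $P_q(a)$ be the (finite) set of places $v\ne 0,\infty$ of $K$ whose degree divides $a$. Fix a nontrivial additive character $\psi:\mathbb{F}_q\to\mathbb{C}^\times$. For a place $v\neq 0,\infty$, with residue field $\mathbb{F}_v$, let $\beta_v\in\mathbb{F}_v^\times$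 be the class of $t$, and put $$\mathrm{Kl}_\gamma(v)=-\sum_{x\in\mathbb{F}_v^\times}\psi\Bigl(\mathrm{Tr}_{\mathbb{F}_v/\mathbb{F}_q}\Bigl(x+\frac{\gamma\beta_v^2}{x}\Bigr)\Bigr).$$ Then $L(E_{a,\gamma},T)$ is a polynomial with integer coefficients. Let $\rho$ be the multiplicity of $T=q^{-1}$ as a root of it (the analytic rank of $E_{a,\gamma}$), and let $L^\ast(E_{a,\gamma},1)$ be the value of $L(E_{a,\gamma},T)/(1-qT)^{\rho}$ at $T=q^{-1}$ (the special value). Then $$\rho=|P_q(a)|\qquad\text{and}\qquad L^\ast(E_{a,\gamma},1)=\prod_{v\in P_q(a)}4\deg v\cdot\prod_{v\in P_q(a)}\Bigl(1-\frac{\mathrm{Kl}_\gamma(v)^2}{4q^{\deg v}}\Bigr).$$ Moreover, for every $v\in P_q(a)$ the number $\mathrm{Kl}_\gamma(v)$ is real and there is a unique angle $\theta_\gamma(v)\in[0,\pi]$ with $\mathrm{Kl}_\gamma(v)=2q^{\deg v/2}\cos\theta_\gamma(v)$, and $$L^\ast(E_{a,\gamma},1)=\prod_{v\in P_q(a)}4\deg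 v\cdot\prod_{v\in P_q(a)}\sin^2\theta_\gamma(v).$$ -/

import Mathlib

open Polynomial

namespace ArtinSchreierCurve

noncomputable section

variable (F : Type*) [Field F]

/-- A finite place of `F(t)`, given by a monic irreducible polynomial of `F[t]`. -/
@[ext]
structure FinitePlace where
  poly : F[X]
  monic : poly.Monic
  irreducible : Irreducible poly

/-- A place of `F(t)`: a finite place, or the place at infinity. -/
inductive Place where
  | finite (v : FinitePlace F)
  | infinity

variable {F}

/-- The prime ideal `(B)` of `F[t]` attached to a monic irreducible polynomial `B`. -/
def FinitePlace.prime (v : FinitePlace F) : IsDedekindDomain.HeightOneSpectrum F[X] :=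
  ⟨Ideal.span {v.poly},
    (Ideal.span_singleton_prime v.irreducible.ne_zero).2 v.irreducible.prime,
    by simpa using v.irreducible.ne_zero⟩

/-- The degree of a finite place, i.e. the degree of its residue field over `F`. -/
def FinitePlace.degree (v : FinitePlace F) : ℕ := v.poly.natDegree

/-- The degree of a place. -/
def Place.degree : Place F → ℕ
  | .finite v => v.degree
  | .infinity => 1

open Classical in
/-- The normalised (multiplicative) valuation of `F(t)` at a place. -/
def Place.valuation : Place F → Valuation (RatFunc F) (WithZero (Multiplicative ℤ))
  | .finite v => v.prime.valuation (RatFunc F)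
  | .infinity => RatFunc.inftyValuation F

/-- The valuation ring of `F(t)` at a place. -/
abbrev Place.ring (v : Place F) : ValuationSubring (RatFunc F) := v.valuation.valuationSubring

instance Place.valuation_isNontrivial (v : Place F) : v.valuation.IsNontrivial := by
  classical
  cases v with
  | finite v =>
    obtain ⟨π, hπ⟩ := v.prime.valuation_exists_uniformizer (RatFunc F)
    exact ⟨π, by simp [Place.valuation, hπ]⟩
  | infinity => exact inferInstanceAs (RatFunc.inftyValuation F).IsNontrivial

instance Place.ring_isDiscreteValuationRing (v : Place F) : IsDiscreteValuationRing v.ring := by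
  infer_instance

/-- The Euler factor at `v` of the `L`-function of a Weierstrass curve `W` over `F(t)`, namely
the power series `P_v(T ^ deg v)⁻¹` where `P_v` is the local polynomial of `W`: it is
`1 - a_v T + |F_v| T ^ 2` at a place of good reduction, `1 - T` (resp. `1 + T`) at a place of split
(resp. nonsplit) multiplicative reduction, and `1` at a place of additive reduction. -/
def eulerFactor (W : WeierstrassCurve (RatFunc F)) (v : Place F) : PowerSeries ℤ :=
  PowerSeries.invOfUnit
    ((expand ℤ v.degree (W.localPolynomial v.ring) : ℤ[X]) : PowerSeries ℤ) 1

open scoped PowerSeries.WithPiTopology in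
/-- The power series `L` is the `L`-function of `W`: it is the product of the Euler factors of `W`
over all places of `F(t)`, for coefficientwise convergence. -/
def IsLFunction (W : WeierstrassCurve (RatFunc F)) (L : PowerSeries ℤ) : Prop :=
  HasProd (eulerFactor W) L

/-- The multiplicity of `T = q⁻¹` as a root of `L`. -/
def analyticRank (q : ℕ) (L : ℤ[X]) : ℕ :=
  (L.map (Int.castRingHom ℚ)).rootMultiplicity (q : ℚ)⁻¹

/-- The value at `T = q⁻¹` of the polynomial `L / (1 - q T) ^ ρ`, where `ρ` is the multiplicity
of `q⁻¹` as a root of `L` (so that the division is exact). -/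
def specialValue (q : ℕ) (L : ℤ[X]) : ℚ :=
  (L.map (Int.castRingHom ℚ) / (1 - C (q : ℚ) * X) ^ analyticRank q L).eval (q : ℚ)⁻¹

section Finite

variable [Fintype F]

/-- `t ^ (q ^ a) - t` as an element of `F(t)`, where `q` is the cardinality of `F`. -/
def wp (F : Type*) [Field F] [Fintype F] (a : ℕ) : RatFunc F :=
  RatFunc.X ^ Fintype.card F ^ a - RatFunc.X

/-- The Weierstrass curve `y ^ 2 = x (x + 16 γ) (x + (t ^ (q ^ a) - t) ^ 2)` over `F(t)`. -/
def curve (a : ℕ) (γ : F) : WeierstrassCurve (RatFunc F) where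
  a₁ := 0
  a₂ := 16 * RatFunc.C γ + wp F a ^ 2
  a₃ := 0
  a₄ := 16 * RatFunc.C γ * wp F a ^ 2
  a₆ := 0

theorem finite_setOf_degree_dvd {a : ℕ} (ha : 1 ≤ a) :
    {v : FinitePlace F | v.poly ≠ X ∧ v.degree ∣ a}.Finite := by
  have h : (Polynomial.degreeLT F (a + 1) : Set F[X]).Finite := by
    have : Finite (Polynomial.degreeLT F (a + 1)) :=
      Finite.of_equiv _ (Polynomial.degreeLTEquiv F (a + 1)).symm.toEquiv
    exact Set.toFinite _
  refine Set.Finite.of_finite_image (f := FinitePlace.poly) (h.subset ?_)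
    (fun v _ w _ hvw => FinitePlace.ext hvw)
  rintro _ ⟨v, ⟨-, hv⟩, rfl⟩
  have hle : v.poly.natDegree ≤ a := Nat.le_of_dvd ha hv
  exact Polynomial.mem_degreeLT.2 (Polynomial.degree_le_natDegree.trans_lt
    (by exact_mod_cast Nat.lt_succ_of_le hle))

/-- The set of places of `F(t)` other than `0` and `∞` whose degree divides `a`. -/
def placesDividing (F : Type*) [Field F] [Fintype F] (a : ℕ) (ha : 1 ≤ a) :
    Finset (FinitePlace F) :=
  (finite_setOf_degree_dvd (F := F) ha).toFinset

/-- The Kloosterman sum `- ∑_{x ≠ 0} ψ (x + α / x)` over a finite field `k`. -/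
def kloostermanSum {k : Type*} [Field k] [Finite k] (ψ : AddChar k ℂ) (α : k) : ℂ :=
  letI : Fintype kˣ := Fintype.ofFinite kˣ;
  -∑ x : kˣ, ψ (x + α / x)

/-- The residue field `F[t] / (B)` of a finite place. -/
abbrev FinitePlace.residueField (v : FinitePlace F) : Type _ := AdjoinRoot v.poly

instance (v : FinitePlace F) : Fact (Irreducible v.poly) := ⟨v.irreducible⟩

instance (v : FinitePlace F) : Finite v.residueField :=
  have : Module.Finite F (AdjoinRoot v.poly) := v.monic.finite_adjoinRoot
  Module.finite_of_finite F

/-- The Kloosterman sum `Kl_γ(v)`, i.e. the Kloosterman sum over the residue field `F_v` with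
character `ψ ∘ Tr_{F_v / F}` and parameter `γ β ^ 2`, where `β` is the class of `t`
(a root of the polynomial of `v` in `F_v`). -/
def kl (ψ : AddChar F ℂ) (γ : F) (v : FinitePlace F) : ℂ :=
  kloostermanSum
    (ψ.compAddMonoidHom (Algebra.trace F v.residueField).toAddMonoidHom)
    (algebraMap F v.residueField γ * AdjoinRoot.root v.poly ^ 2)

/-- The angle in `[0, π]` whose cosine is `Kl_γ(v) / (2 q ^ (deg v / 2))`. -/
def angle (ψ : AddChar F ℂ) (γ : F) (v : FinitePlace F) : ℝ :=
  Real.arccos ((kl ψ γ v).re / (2 * √((Fintype.card F : ℝ) ^ v.degree)))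

end Finite

end

end ArtinSchreierCurve

open ArtinSchreierCurve

/-! Write `q` for the cardinality of `F`. The proof computes, for every finite extension `K` of `F`,
the sum over `τ ∈ K` of the Frobenius traces of the fibres at `t = τ`, and reads the L-function off
these sums. The fibre at `τ` depends only on `z = τ ^ (q ^ a) - τ`, so Fourier analysis on `K`
(`sum_algEquiv_sub`) rewrites the sum as one over those `β ∈ K` with `β ^ (q ^ a) = β`, the term at
`β` being the Fourier coefficient of the trace of `y² = x (x + 16γ) (x + z²)`, as a function of `z`.
At `β = 0` it is `-1` (`sum_ellTrace_sq`); at `β ≠ 0` an explicit substitution gives `|K| -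
Kl(γβ²)²` (`sum_ellTrace_mul_addChar`).

Let `α', β'` be the Frobenius eigenvalues of the Kloosterman sum at a place `v`, so that `α' β' = q
^ deg v` and `α' + β' = Kl_γ(v)`. Over an extension of degree `m` of the residue field, `|K| - Kl²`
equals `-((q ^ deg v) ^ m + α' ^ (2m) + β' ^ (2m))`. Grouping the `β ≠ 0` by minimal polynomial
leaves exactly the places of `P_q(a)`, and the `-1` cancels against the factor `1 / (1 - T)` at
infinity. Comparing logarithmic derivatives (`sum_eigenvalues`, `coeff_prod_eulerFactor`), the
L-function is the product over `v ∈ P_q(a)`, with `d = deg v`, of `(1 - q^d T^d) (1 - α'² T^d) (1 -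
β'² T^d)`.

At `T = 1/q` the first factor has a simple zero, with cofactor `d`, and the other two multiply to `4
(1 - Kl² / (4 q^d))` because `α' β' = q^d`. This is nonzero since `Kl ≡ 1` modulo a prime above `p`
while `4 q^d ≡ 0` (`kloostermanSum_sq_ne`). Hence the rank and the special value.

Three inputs carry this. The behaviour of both kinds of sum under extension of the field comes from
L-functions of completely multiplicative functions on monic polynomials whose sums vanish from
degree three on (`primeSum_eq_neg_pow_add_pow`). The local factors of the curve come from its
Legendre form (`localPolynomial_legendre`). Weil's bound `|Kl| ≤ 2 q^(d/2)`, needed only for the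
angles, is proved by Stepanov's method on the curve `x + b/x = y^q - y`
(`exists_auxiliary_function`, `re_kloostermanSum_sq_le`). -/

namespace ArtinSchreierCurve

noncomputable section

/-! ### Logarithmic derivatives of power series. -/

section LogDeriv

open scoped PowerSeries

variable {k : Type*} [Field k]

/-- `s` is the logarithmic derivative `T f' / f` of the power series `f`. -/
def IsLogDeriv (f s : k⟦X⟧) : Prop :=
  PowerSeries.X * PowerSeries.derivative k f = s * f

theorem IsLogDeriv.one : IsLogDeriv (1 : k⟦X⟧) 0 := by
  simp [IsLogDeriv]

theorem IsLogDeriv.mul {f g s t : k⟦X⟧} (hf : IsLogDeriv f s) (hg : IsLogDeriv g t) :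
    IsLogDeriv (f * g) (s + t) := by
  unfold IsLogDeriv at *
  rw [Derivation.leibniz, smul_eq_mul, smul_eq_mul]
  linear_combination f * hg + g * hf

theorem IsLogDeriv.prod {ι : Type*} (S : Finset ι) {f s : ι → k⟦X⟧}
    (h : ∀ i ∈ S, IsLogDeriv (f i) (s i)) : IsLogDeriv (∏ i ∈ S, f i) (∑ i ∈ S, s i) := by
  classical
  induction S using Finset.induction_on with
  | empty => simpa using IsLogDeriv.one
  | insert i S hi ih =>
    rw [Finset.prod_insert hi, Finset.sum_insert hi]
    exact (h i (Finset.mem_insert_self _ _)).mul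
      (ih fun j hj => h j (Finset.mem_insert_of_mem hj))

theorem IsLogDeriv.unique {f s t : k⟦X⟧} (hf : f ≠ 0) (hs : IsLogDeriv f s)
    (ht : IsLogDeriv f t) : s = t :=
  mul_right_cancel₀ hf (hs.symm.trans ht)

theorem IsLogDeriv.of_mul_eq_one {f g s : k⟦X⟧} (hfg : f * g = 1) (hf : IsLogDeriv f s) :
    IsLogDeriv g (-s) := by
  unfold IsLogDeriv at *
  have h : f * PowerSeries.derivative k g + g * PowerSeries.derivative k f = 0 := by
    have := congrArg (PowerSeries.derivative k) hfg
    rwa [Derivation.leibniz, smul_eq_mul, smul_eq_mul, PowerSeries.derivative_one] at this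
  have hf0 : f ≠ 0 := left_ne_zero_of_mul_eq_one hfg
  refine mul_left_cancel₀ hf0 ?_
  linear_combination PowerSeries.X * h - g * hf

theorem isLogDeriv_one_sub (α : k) {d : ℕ} (hd : 0 < d) :
    IsLogDeriv (1 - PowerSeries.C α * PowerSeries.X ^ d)
      (PowerSeries.mk fun n => if d ∣ n ∧ 0 < n then -(d * α ^ (n / d)) else 0) := by
  unfold IsLogDeriv
  have h1 : PowerSeries.X * PowerSeries.derivative k (1 - PowerSeries.C α * PowerSeries.X ^ d) =
      PowerSeries.C (-(d * α)) * PowerSeries.X ^ d := by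
    obtain ⟨e, rfl⟩ : ∃ e, d = e + 1 := ⟨d - 1, by omega⟩
    rw [map_sub, PowerSeries.derivative_one, Derivation.leibniz, PowerSeries.derivative_C,
      PowerSeries.derivative_pow, PowerSeries.derivative_X]
    simp only [smul_eq_mul, map_neg, map_mul, map_natCast, Nat.add_sub_cancel]
    ring
  rw [h1]
  ext n
  rw [mul_sub, mul_one, ← mul_assoc, map_sub, PowerSeries.coeff_mk, PowerSeries.coeff_C_mul,
    PowerSeries.coeff_X_pow, PowerSeries.coeff_mul_X_pow', PowerSeries.coeff_mul_C,
    PowerSeries.coeff_mk]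
  by_cases hdn : d ∣ n
  · obtain ⟨m, rfl⟩ := hdn
    rcases m with _ | m
    · have : ¬ d ≤ 0 := by omega
      simp [this, hd.ne]
    · have e1 : d * (m + 1) - d = d * m := by rw [mul_add, mul_one, Nat.add_sub_cancel]
      have e2 : d ≤ d * (m + 1) := Nat.le_mul_of_pos_right _ (Nat.succ_pos _)
      have e3 : 0 < d * (m + 1) := by positivity
      rw [e1, if_pos e2, if_pos (c := d ∣ d * (m + 1) ∧ _) ⟨dvd_mul_right _ _, e3⟩,
        Nat.mul_div_cancel_left _ hd, Nat.mul_div_cancel_left _ hd]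
      rcases m with _ | m
      · simp
      · have e4 : ¬ (d * (m + 1 + 1) = d) := by nlinarith
        have e5 : 0 < d * (m + 1) := by positivity
        rw [if_neg e4, if_pos (c := d ∣ d * (m + 1) ∧ _) ⟨dvd_mul_right _ _, e5⟩]
        ring
  · have e1 : n ≠ d := fun h => hdn (h ▸ dvd_rfl)
    rw [if_neg e1, if_neg (c := d ∣ n ∧ _) (fun h => hdn h.1)]
    split_ifs with h2 h3
    · exact absurd ((Nat.dvd_sub_iff_left h2 dvd_rfl).1 h3.1) hdn
    · simp
    · simp

/-- Comparing coefficients in `T f' = s f` gives Newton's recursion for `n f_n`, and in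
characteristic zero one can divide by `n`. The truncation at `N` allows a finite partial Euler
product to be compared with the full answer. -/
theorem IsLogDeriv.coeff_eq [CharZero k] {f g s t : k⟦X⟧} (hf : IsLogDeriv f s)
    (hg : IsLogDeriv g t) (hf0 : PowerSeries.coeff 0 f = 1) (hg0 : PowerSeries.coeff 0 g = 1)
    (N : ℕ) (h : ∀ n, 0 < n → n ≤ N → PowerSeries.coeff n s = PowerSeries.coeff n t) :
    ∀ n ≤ N, PowerSeries.coeff n f = PowerSeries.coeff n g := by
  have key : ∀ {f s : k⟦X⟧}, IsLogDeriv f s → PowerSeries.coeff 0 f = 1 → ∀ n,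
      ((n + 1 : ℕ) : k) * PowerSeries.coeff (n + 1) f =
        ∑ p ∈ Finset.HasAntidiagonal.antidiagonal n, PowerSeries.coeff (p.1 + 1) s * PowerSeries.coeff p.2 f := by
    intro f s hf hf0 n
    have h0 : PowerSeries.coeff 0 s = 0 := by
      have := congrArg (PowerSeries.coeff 0) hf
      simpa [PowerSeries.coeff_mul, hf0] using this.symm
    have := congrArg (PowerSeries.coeff (n + 1)) hf
    rw [PowerSeries.coeff_succ_X_mul, PowerSeries.coeff_derivative, PowerSeries.coeff_mul,
      Finset.Nat.antidiagonal_succ, Finset.sum_cons, h0, zero_mul, zero_add,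
      Finset.sum_map] at this
    rw [mul_comm]
    push_cast
    exact this
  intro n
  induction n using Nat.strong_induction_on with
  | _ n ih =>
    intro hn
    rcases n with _ | n
    · rw [hf0, hg0]
    · refine mul_left_cancel₀ (Nat.cast_ne_zero.2 n.succ_ne_zero : ((n + 1 : ℕ) : k) ≠ 0) ?_
      rw [key hf hf0, key hg hg0]
      refine Finset.sum_congr rfl fun p hp => ?_
      have hp' := Finset.HasAntidiagonal.mem_antidiagonal.1 hp
      rw [h _ (Nat.succ_pos _) (by omega), ih p.2 (by omega) (by omega)]

end LogDeriv

/-! ### Finiteness of places of bounded degree. -/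

section Places

variable {k : Type*} [Field k]

theorem FinitePlace.degree_pos (v : FinitePlace k) : 0 < v.degree :=
  v.irreducible.natDegree_pos

variable [Finite k]

theorem finite_setOf_degree_le (n : ℕ) : {v : FinitePlace k | v.degree ≤ n}.Finite := by
  have h : (Polynomial.degreeLT k (n + 1) : Set k[X]).Finite := by
    have : Finite (Polynomial.degreeLT k (n + 1)) :=
      Finite.of_equiv _ (Polynomial.degreeLTEquiv k (n + 1)).symm.toEquiv
    exact Set.toFinite _
  refine Set.Finite.of_finite_image (f := FinitePlace.poly) (h.subset ?_)
    (fun v _ w _ hvw => FinitePlace.ext hvw)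
  rintro _ ⟨v, hv, rfl⟩
  exact Polynomial.mem_degreeLT.2 (Polynomial.degree_le_natDegree.trans_lt
    (by exact_mod_cast Nat.lt_succ_of_le hv))

variable (k) in
/-- The finite places of degree at most `n`. -/
def placesLE (n : ℕ) : Finset (FinitePlace k) := (finite_setOf_degree_le n).toFinset

@[simp]
theorem mem_placesLE {n : ℕ} {v : FinitePlace k} : v ∈ placesLE k n ↔ v.degree ≤ n := by
  simp [placesLE]

theorem placesLE_zero : placesLE k 0 = ∅ := by
  ext v
  simp [v.degree_pos.ne']

/-- Sums over places whose degree divides `m` may be taken over any bound `n ≥ m`. -/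
theorem sum_placesLE_dvd {M : Type*} [AddCommMonoid M] {m n : ℕ} (hm : 0 < m) (h : m ≤ n)
    (f : FinitePlace k → M) :
    ∑ v ∈ placesLE k n, (if v.degree ∣ m then f v else 0) =
      ∑ v ∈ placesLE k m, (if v.degree ∣ m then f v else 0) := by
  symm
  refine Finset.sum_subset (fun v hv => ?_) fun v _ hv => ?_
  · rw [mem_placesLE] at *
    exact hv.trans h
  · rw [mem_placesLE] at hv
    exact if_neg fun hd => hv (Nat.le_of_dvd hm hd)

end Places

/-! ### Elements of a finite extension grouped by minimal polynomial. -/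

section Orbits

variable {k K : Type*} [Field k] [Field K] [Fintype K] [Algebra k K]

/-- The fibre is the root set of `v.poly`, which is separable. If its degree divides `[K : k]` it
divides `X ^ |K| - X` and so splits in `K`; otherwise it has no root there. -/
theorem card_minpoly_fiber (v : FinitePlace k) :
    Nat.card {x : K // minpoly k x = v.poly} =
      if v.degree ∣ Module.finrank k K then v.degree else 0 := by
  classical
  have hfin : Finite k := Finite.of_injective _ (algebraMap k K).injective
  have : Fintype k := Fintype.ofFinite k
  split_ifs with hd
  · rw [FinitePlace.degree, ← Polynomial.card_rootSet_eq_natDegree (F := k) (K := K)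
      (PerfectField.separable_of_irreducible v.irreducible), ← Nat.card_eq_fintype_card]
    · refine Nat.card_congr (Equiv.subtypeEquivRight fun x => ?_)
      rw [Polynomial.mem_rootSet]
      refine ⟨fun h => ⟨v.irreducible.ne_zero, h ▸ minpoly.aeval k x⟩, fun h => ?_⟩
      exact (minpoly.eq_of_irreducible_of_monic v.irreducible h.2 v.monic).symm
    · have h1 := v.irreducible.natDegree_dvd_iff_dvd_X_pow_card_pow_sub_X.1 hd
      have := FiniteField.isSplittingField_sub K k
      have h2 := Polynomial.IsSplittingField.splits K (X ^ Fintype.card K - X : k[X])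
      refine h2.of_dvd ?_ (Polynomial.map_dvd _ ?_)
      · rw [Polynomial.map_sub, Polynomial.map_pow, Polynomial.map_X]
        exact FiniteField.X_pow_card_sub_X_ne_zero K Fintype.one_lt_card
      · rwa [← Nat.card_eq_fintype_card, Module.natCard_eq_pow_finrank (K := k) (V := K)]
  · have : IsEmpty {x : K // minpoly k x = v.poly} := by
      refine ⟨fun x => hd ?_⟩
      rw [FinitePlace.degree, ← x.2]
      exact minpoly.degree_dvd (.of_finite k x.1)
    simp

/-- Sums over a finite extension, grouped by minimal polynomials. -/
theorem sum_minpoly [Finite k] {R : Type*} [CommRing R] (φ : k[X] → R) :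
    ∑ x : K, φ (minpoly k x) =
      ∑ v ∈ placesLE k (Module.finrank k K),
        if v.degree ∣ Module.finrank k K then (v.degree : R) * φ v.poly else 0 := by
  classical
  let pl : K → FinitePlace k := fun x =>
    ⟨minpoly k x, minpoly.monic (.of_finite k x), minpoly.irreducible (.of_finite k x)⟩
  have hpl : ∀ x ∈ Finset.univ, pl x ∈ placesLE k (Module.finrank k K) := fun x _ => by
    rw [mem_placesLE]
    exact minpoly.natDegree_le x
  rw [← Finset.sum_fiberwise_of_maps_to hpl]
  refine Finset.sum_congr rfl fun v _ => ?_
  rw [Finset.sum_congr rfl (g := fun _ => φ v.poly), Finset.sum_const, nsmul_eq_mul]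
  · have h : (Finset.univ.filter fun x => pl x = v).card =
        Nat.card {x : K // minpoly k x = v.poly} := by
      rw [Nat.card_eq_fintype_card, Fintype.card_subtype]
      congr 1
      ext x
      simp [pl, FinitePlace.ext_iff]
    rw [h, card_minpoly_fiber]
    split_ifs <;> simp
  · intro x hx
    rw [← (Finset.mem_filter.1 hx).2]

end Orbits

/-! ### Sums of completely multiplicative functions over monic polynomials. -/

section MonicSums

variable {k : Type*} [Field k]

/-- The monic polynomial of degree `n` with the given lower coefficients. -/
def monicPoly {n : ℕ} (c : Fin n → k) : k[X] := X ^ n + ∑ i : Fin n, C (c i) * X ^ (i : ℕ)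

theorem degree_sum_lt {n : ℕ} (c : Fin n → k) :
    (∑ i : Fin n, C (c i) * X ^ (i : ℕ)).degree < (n : WithBot ℕ) := by
  refine (Polynomial.degree_sum_le _ _).trans_lt ((Finset.sup_lt_iff (WithBot.bot_lt_coe n)).2 ?_)
  intro i _
  exact (Polynomial.degree_C_mul_X_pow_le _ _).trans_lt (Nat.cast_lt.2 i.2)

theorem monicPoly_monic {n : ℕ} (c : Fin n → k) : (monicPoly c).Monic :=
  Polynomial.monic_X_pow_add (degree_sum_lt c)

theorem natDegree_monicPoly {n : ℕ} (c : Fin n → k) : (monicPoly c).natDegree = n := by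
  rw [monicPoly, Polynomial.natDegree_eq_of_degree_eq_some]
  rw [Polynomial.degree_add_eq_left_of_degree_lt, Polynomial.degree_X_pow]
  rw [Polynomial.degree_X_pow]
  exact degree_sum_lt c

theorem coeff_monicPoly {n : ℕ} (c : Fin n → k) (i : Fin n) : (monicPoly c).coeff i = c i := by
  rw [monicPoly, Polynomial.coeff_add, Polynomial.coeff_X_pow, if_neg i.2.ne, zero_add,
    Polynomial.finsetSum_coeff, Finset.sum_eq_single i]
  · simp
  · intro j _ hj
    rw [Polynomial.coeff_C_mul_X_pow, if_neg]
    exact fun h => hj (Fin.ext h.symm)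
  · simp

theorem monicPoly_injective (n : ℕ) : Function.Injective (monicPoly (k := k) (n := n)) := by
  intro c d h
  ext i
  rw [← coeff_monicPoly c, h, coeff_monicPoly]

theorem monicPoly_coeff {f : k[X]} (hf : f.Monic) :
    monicPoly (fun i : Fin f.natDegree => f.coeff i) = f := by
  conv_rhs => rw [hf.as_sum]
  rw [monicPoly, Finset.sum_range fun i => C (f.coeff i) * X ^ i]

variable [Fintype k]

variable (k) in
/-- The monic polynomials of degree `n`. -/
def monics (n : ℕ) : Finset k[X] := Finset.univ.map ⟨monicPoly (n := n), monicPoly_injective n⟩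

@[simp]
theorem mem_monics {n : ℕ} {f : k[X]} : f ∈ monics k n ↔ f.Monic ∧ f.natDegree = n := by
  simp only [monics, Finset.mem_map, Finset.mem_univ, true_and, Function.Embedding.coeFn_mk]
  constructor
  · rintro ⟨c, rfl⟩
    exact ⟨monicPoly_monic c, natDegree_monicPoly c⟩
  · rintro ⟨hf, rfl⟩
    exact ⟨_, monicPoly_coeff hf⟩

variable {R : Type*} [CommRing R]

theorem sum_monics (n : ℕ) (f : k[X] → R) :
    ∑ g ∈ monics k n, f g = ∑ c : Fin n → k, f (monicPoly c) := by
  simp [monics]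

open UniqueFactorizationMonoid Classical in
/-- The degree of a monic polynomial is the sum of the degrees of its prime-power divisors. -/
theorem natDegree_eq_sum_dvd {n : ℕ} {g : k[X]} (hg : g ∈ monics k n) :
    n = ∑ v ∈ placesLE k n, ∑ i ∈ Finset.Icc 1 n,
      if v.degree ∣ i ∧ v.poly ^ (i / v.degree) ∣ g then v.degree else 0 := by
  obtain ⟨hm, hn⟩ := mem_monics.1 hg
  have hg0 : g ≠ 0 := hm.ne_zero
  have hmem : ∀ p ∈ normalizedFactors g, p.Monic ∧ Irreducible p := fun p hp => by
    have h1 := irreducible_of_normalized_factor p hp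
    exact ⟨normalize_normalized_factor p hp ▸ monic_normalize h1.ne_zero, h1⟩
  have hcount : ∀ (v : FinitePlace k) (j : ℕ),
      v.poly ^ j ∣ g ↔ j ≤ (normalizedFactors g).count v.poly := fun v j => by
    rw [Multiset.le_count_iff_replicate_le, dvd_iff_normalizedFactors_le_normalizedFactors
      (pow_ne_zero _ v.irreducible.ne_zero) hg0, normalizedFactors_pow,
      normalizedFactors_irreducible v.irreducible, v.monic.normalize_eq_self,
      Multiset.nsmul_singleton]
  have hdeg : n = ∑ v ∈ placesLE k n, (normalizedFactors g).count v.poly * v.degree := by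
    have h1 : (normalizedFactors g).prod = g := by
      rw [prod_normalizedFactors_eq hg0, hm.normalize_eq_self]
    have h2 := natDegree_multiset_prod_of_monic (normalizedFactors g) fun f hf => (hmem f hf).1
    rw [h1, hn, Finset.sum_multiset_map_count] at h2
    conv_lhs => rw [h2]
    have hinj : Set.InjOn FinitePlace.poly (placesLE k n : Set (FinitePlace k)) :=
      fun v _ w _ h => FinitePlace.ext h
    simp only [FinitePlace.degree]
    rw [← Finset.sum_image (f := fun p => (normalizedFactors g).count p * p.natDegree) hinj]
    refine Finset.sum_subset (fun p hp => ?_) fun p _ hp => ?_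
    · rw [Multiset.mem_toFinset] at hp
      refine Finset.mem_image.2 ⟨⟨p, (hmem p hp).1, (hmem p hp).2⟩, ?_, rfl⟩
      rw [mem_placesLE, ← hn]
      exact natDegree_le_of_dvd (dvd_of_mem_normalizedFactors hp) hg0
    · rw [Multiset.mem_toFinset] at hp
      rw [Multiset.count_eq_zero_of_notMem hp, zero_smul]
  conv_lhs => rw [hdeg]
  refine Finset.sum_congr rfl fun v hv => ?_
  rw [← Finset.sum_filter, Finset.sum_const, smul_eq_mul]
  congr 1
  have hle : (normalizedFactors g).count v.poly * v.degree ≤ n := by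
    conv_rhs => rw [hdeg]
    exact Finset.single_le_sum (f := fun v => (normalizedFactors g).count v.poly * v.degree)
      (fun _ _ => Nat.zero_le _) hv
  have himg : (Finset.Icc 1 n).filter
      (fun i => v.degree ∣ i ∧ v.poly ^ (i / v.degree) ∣ g) =
      (Finset.Icc 1 ((normalizedFactors g).count v.poly)).image (· * v.degree) := by
    ext i
    simp only [Finset.mem_filter, Finset.mem_Icc, Finset.mem_image, hcount]
    have hd := v.degree_pos
    constructor
    · rintro ⟨⟨h1, h2⟩, ⟨j, rfl⟩, h4⟩
      rw [Nat.mul_div_cancel_left _ hd] at h4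
      exact ⟨j, ⟨Nat.pos_of_mul_pos_left h1, h4⟩, mul_comm _ _⟩
    · rintro ⟨j, ⟨h1, h2⟩, rfl⟩
      rw [Nat.mul_div_cancel _ hd]
      exact ⟨⟨Nat.mul_pos h1 hd, (Nat.mul_le_mul_right _ h2).trans hle⟩, dvd_mul_left _ _, h2⟩
  rw [himg, Finset.card_image_of_injective _ fun a b h => Nat.eq_of_mul_eq_mul_right v.degree_pos h,
    Nat.card_Icc, Nat.add_sub_cancel]

/-- The sum of `lam` over monic polynomials of degree `n`. -/
def monicSum (lam : k[X] → R) (n : ℕ) : R := ∑ g ∈ monics k n, lam g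

/-- The power sums attached to `lam`: the sum of `deg P * lam P ^ (n / deg P)` over monic
irreducible polynomials `P` of degree dividing `n`. -/
def primeSum (lam : k[X] → R) (n : ℕ) : R :=
  ∑ v ∈ placesLE k n, if v.degree ∣ n then (v.degree : R) * lam v.poly ^ (n / v.degree) else 0

theorem sum_monics_dvd {lam : k[X] → R} (h1 : lam 1 = 1)
    (hmul : ∀ f g : k[X], f.Monic → g.Monic → lam (f * g) = lam f * lam g)
    (v : FinitePlace k) {j n : ℕ} (hj : j * v.degree ≤ n) [DecidablePred fun g => v.poly ^ j ∣ g] :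
    (∑ g ∈ monics k n, if v.poly ^ j ∣ g then lam g else 0) =
      lam v.poly ^ j * monicSum lam (n - j * v.degree) := by
  have hpow : ∀ j, lam (v.poly ^ j) = lam v.poly ^ j := fun j => by
    induction j with
    | zero => simp [h1]
    | succ j ih => rw [pow_succ, hmul _ _ (v.monic.pow j) v.monic, ih, pow_succ]
  have hm := v.monic.pow j
  have hdeg : (v.poly ^ j).natDegree = j * v.degree := v.monic.natDegree_pow j
  rw [← Finset.sum_filter, monicSum, Finset.mul_sum]
  symm
  refine Finset.sum_bij (fun h _ => v.poly ^ j * h) ?_ ?_ ?_ ?_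
  · intro h hh
    rw [mem_monics] at hh
    rw [Finset.mem_filter, mem_monics]
    refine ⟨⟨hm.mul hh.1, ?_⟩, dvd_mul_right _ _⟩
    rw [hm.natDegree_mul hh.1, hdeg, hh.2]
    omega
  · intro a _ b _ hab
    exact mul_left_cancel₀ hm.ne_zero hab
  · intro g hg
    rw [Finset.mem_filter, mem_monics] at hg
    obtain ⟨⟨hg1, hg2⟩, h, rfl⟩ := hg
    have hh : h.Monic := hm.of_mul_monic_left hg1
    refine ⟨h, mem_monics.2 ⟨hh, ?_⟩, rfl⟩
    rw [hm.natDegree_mul hh, hdeg] at hg2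
    omega
  · intro h hh
    rw [hmul _ _ hm (mem_monics.1 hh).1, hpow]

/-- This is Newton's identity, or the analogue of `log = Λ * 1`: weight each monic `g` of degree `n`
by `n = ∑ deg P` over the prime powers `P ^ j` dividing `g`, exchange sums, and factor out `P ^ j`.
The index `i` is the degree of `P ^ j`. -/
theorem natCast_mul_monicSum {lam : k[X] → R} (h1 : lam 1 = 1)
    (hmul : ∀ f g : k[X], f.Monic → g.Monic → lam (f * g) = lam f * lam g) (n : ℕ) :
    (n : R) * monicSum lam n =
      ∑ i ∈ Finset.Icc 1 n, primeSum lam i * monicSum lam (n - i) := by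
  classical
  have hstep : (n : R) * monicSum lam n = ∑ v ∈ placesLE k n, ∑ i ∈ Finset.Icc 1 n,
      if v.degree ∣ i then
        (v.degree : R) * (lam v.poly ^ (i / v.degree) * monicSum lam (n - i)) else 0 := by
    rw [monicSum, Finset.mul_sum]
    rw [Finset.sum_congr rfl (g := fun g => ∑ v ∈ placesLE k n, ∑ i ∈ Finset.Icc 1 n,
      if v.degree ∣ i then (v.degree : R) *
        (if v.poly ^ (i / v.degree) ∣ g then lam g else 0) else 0)]
    · rw [Finset.sum_comm]
      refine Finset.sum_congr rfl fun v _ => ?_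
      rw [Finset.sum_comm]
      refine Finset.sum_congr rfl fun i hi => ?_
      split_ifs with hd
      · have hi2 : i / v.degree * v.degree = i := Nat.div_mul_cancel hd
        rw [← Finset.mul_sum, sum_monics_dvd h1 hmul v (by rw [hi2]; exact (Finset.mem_Icc.1 hi).2),
          hi2]
      · simp
    · intro g hg
      conv_lhs => rw [natDegree_eq_sum_dvd hg]
      push_cast
      rw [Finset.sum_mul]
      refine Finset.sum_congr rfl fun v _ => ?_
      rw [Finset.sum_mul]
      refine Finset.sum_congr rfl fun i _ => ?_
      by_cases h : v.degree ∣ i <;> by_cases h' : v.poly ^ (i / v.degree) ∣ g <;> simp [h, h']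
  rw [hstep, Finset.sum_comm]
  refine Finset.sum_congr rfl fun i hi => ?_
  rw [Finset.mem_Icc] at hi
  rw [sum_placesLE_dvd hi.1 hi.2, primeSum, Finset.sum_mul]
  refine Finset.sum_congr rfl fun v _ => ?_
  split_ifs
  · ring
  · ring

end MonicSums

/-! ### The L-function of a completely multiplicative function. -/

section Field

variable {k K : Type*} [Field k] [Fintype k] [Field K] [Fintype K] [Algebra k K]

theorem sum_lam_minpoly {R : Type*} [CommRing R] (lam : k[X] → R) :
    ∑ x : K, lam (minpoly k x) ^ (Module.finrank k K / (minpoly k x).natDegree) =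
      primeSum lam (Module.finrank k K) :=
  sum_minpoly fun f => lam f ^ (Module.finrank k K / f.natDegree)

open scoped PowerSeries in
theorem isLogDeriv_monicSum {R : Type*} [Field R] {lam : k[X] → R} (h1 : lam 1 = 1)
    (hmul : ∀ f g : k[X], f.Monic → g.Monic → lam (f * g) = lam f * lam g) :
    IsLogDeriv (PowerSeries.mk (monicSum lam)) (PowerSeries.mk (primeSum lam)) := by
  have h0 : primeSum lam 0 = 0 := by simp [primeSum, placesLE_zero]
  unfold IsLogDeriv
  ext n
  have := natCast_mul_monicSum h1 hmul n
  rw [PowerSeries.coeff_mul (n := n) (φ := PowerSeries.mk (primeSum lam)),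
    Finset.Nat.sum_antidiagonal_eq_sum_range_succ_mk]
  simp only [PowerSeries.coeff_mk]
  rw [Finset.sum_range_succ', h0, zero_mul, add_zero]
  have e : ∑ i ∈ Finset.Icc 1 n, primeSum lam i * monicSum lam (n - i) =
      ∑ i ∈ Finset.range n, primeSum lam (i + 1) * monicSum lam (n - (i + 1)) := by
    rw [Finset.range_eq_Ico, Finset.sum_Ico_add' (fun i => primeSum lam i * monicSum lam (n - i))]
    rfl
  rw [← e, ← this]
  rcases n with _ | n
  · simp
  · rw [PowerSeries.coeff_succ_X_mul, PowerSeries.coeff_derivative, PowerSeries.coeff_mk]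
    push_cast
    ring

/-- If the sums of a completely multiplicative function over monic polynomials vanish from degree
three on, then its power sums are those of the two inverse roots of a quadratic polynomial. -/
theorem primeSum_eq_neg_pow_add_pow {R : Type*} [Field R] {lam : k[X] → R} (h1 : lam 1 = 1)
    (hmul : ∀ f g : k[X], f.Monic → g.Monic → lam (f * g) = lam f * lam g)
    (h3 : ∀ n, 3 ≤ n → monicSum lam n = 0) {α β : R} (hα : α + β = -monicSum lam 1)
    (hβ : α * β = monicSum lam 2) {n : ℕ} (hn : 0 < n) :
    primeSum lam n = -(α ^ n + β ^ n) := by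
  have hz : monicSum lam 0 = 1 := by
    have : monics k 0 = {1} := by
      ext f
      simp only [mem_monics, Finset.mem_singleton]
      exact ⟨fun h => h.1.natDegree_eq_zero.1 h.2, by rintro rfl; simp⟩
    simp [monicSum, this, h1]
  have hL := isLogDeriv_monicSum h1 hmul
  have hR := (isLogDeriv_one_sub α one_pos).mul (isLogDeriv_one_sub β one_pos)
  have he : (PowerSeries.mk (monicSum lam) : PowerSeries R) =
      (1 - PowerSeries.C α * PowerSeries.X ^ 1) * (1 - PowerSeries.C β * PowerSeries.X ^ 1) := by
    have e : (1 - PowerSeries.C α * PowerSeries.X ^ 1) * (1 - PowerSeries.C β * PowerSeries.X ^ 1) =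
        1 - PowerSeries.C (α + β) * PowerSeries.X + PowerSeries.C (α * β) * PowerSeries.X ^ 2 := by
      rw [map_add, map_mul]
      ring
    rw [e]
    ext m
    rw [PowerSeries.coeff_mk, map_add, map_sub, PowerSeries.coeff_C_mul, PowerSeries.coeff_C_mul,
      PowerSeries.coeff_X_pow, PowerSeries.coeff_X, PowerSeries.coeff_one, hα, hβ]
    rcases m with _ | _ | _ | m
    · simp [hz]
    · simp
    · simp
    · simp [h3 (m + 1 + 1 + 1) (by omega)]
  rw [he] at hL
  have hne : (1 - PowerSeries.C α * PowerSeries.X ^ 1) * (1 - PowerSeries.C β * PowerSeries.X ^ 1) ≠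
      (0 : PowerSeries R) := by
    intro h
    have := congrArg (PowerSeries.constantCoeff (R := R)) h
    simp at this
  have := congrArg (PowerSeries.coeff n) (hL.unique hne hR)
  rw [PowerSeries.coeff_mk] at this
  rw [this, map_add, PowerSeries.coeff_mk, PowerSeries.coeff_mk]
  simp [hn]
  ring

end Field

/-! ### Norms, traces and inverses in terms of minimal polynomials. -/

section Minpoly

open scoped IntermediateField

variable {k K : Type*} [Field k] [Field K] [Algebra k K] [FiniteDimensional k K]

theorem natDegree_minpoly_mul_finrank (x : K) :
    (minpoly k x).natDegree * Module.finrank k⟮x⟯ K = Module.finrank k K := by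
  rw [← IntermediateField.adjoin.finrank (.of_finite k x)]
  exact Module.finrank_mul_finrank k k⟮x⟯ K

theorem finrank_div_natDegree_minpoly (x : K) :
    Module.finrank k K / (minpoly k x).natDegree = Module.finrank k⟮x⟯ K := by
  rw [← natDegree_minpoly_mul_finrank (k := k) x,
    Nat.mul_div_cancel_left _ (minpoly.natDegree_pos (.of_finite k x))]

theorem norm_eq_minpoly_coeff_zero_pow (x : K) :
    Algebra.norm k x = ((-1) ^ (minpoly k x).natDegree * (minpoly k x).coeff 0) ^
      (Module.finrank k K / (minpoly k x).natDegree) := by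
  have h := Algebra.PowerBasis.norm_gen_eq_coeff_zero_minpoly
    (IntermediateField.adjoin.powerBasis (.of_finite k x))
  rw [IntermediateField.adjoin.powerBasis_gen, IntermediateField.adjoin.powerBasis_dim,
    IntermediateField.minpoly_gen] at h
  rw [Algebra.norm_eq_norm_adjoin, h, finrank_div_natDegree_minpoly]

theorem norm_sub_algebraMap (x : K) (e : k) :
    Algebra.norm k (x - algebraMap k K e) =
      ((-1) ^ (minpoly k x).natDegree * (minpoly k x).eval e) ^
        (Module.finrank k K / (minpoly k x).natDegree) := by
  rw [norm_eq_minpoly_coeff_zero_pow, minpoly.sub_algebraMap, natDegree_comp, natDegree_X_add_C,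
    mul_one, coeff_zero_eq_eval_zero, eval_comp]
  simp

theorem trace_eq_mul_nextCoeff (x : K) :
    Algebra.trace k K x = (Module.finrank k K / (minpoly k x).natDegree : ℕ) •
      -(minpoly k x).nextCoeff := by
  rw [trace_eq_finrank_mul_minpoly_nextCoeff, finrank_div_natDegree_minpoly, nsmul_eq_mul]

omit [FiniteDimensional k K] in
theorem minpoly_inv_dvd_reverse {x : K} (hx : x ≠ 0) :
    minpoly k x⁻¹ ∣ (minpoly k x).reverse := by
  let _ : Invertible x := invertibleOfNonzero hx
  refine minpoly.dvd k _ ?_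
  have := (eval₂_reverse_eq_zero_iff (algebraMap k K) x (minpoly k x)).2
    (minpoly.aeval k x)
  rwa [invOf_eq_inv] at this

theorem minpoly_coeff_zero_ne_zero {x : K} (hx : x ≠ 0) : (minpoly k x).coeff 0 ≠ 0 :=
  minpoly.coeff_zero_ne_zero (.of_finite k x) hx

theorem natDegree_reverse_minpoly {x : K} (hx : x ≠ 0) :
    (minpoly k x).reverse.natDegree = (minpoly k x).natDegree := by
  rw [reverse_natDegree, natTrailingDegree_eq_zero.2 (Or.inr (minpoly_coeff_zero_ne_zero hx)),
    Nat.sub_zero]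

theorem natDegree_minpoly_inv {x : K} (hx : x ≠ 0) :
    (minpoly k x⁻¹).natDegree = (minpoly k x).natDegree := by
  have key : ∀ {x : K}, x ≠ 0 → (minpoly k x⁻¹).natDegree ≤ (minpoly k x).natDegree := by
    intro x hx
    rw [← natDegree_reverse_minpoly hx]
    refine natDegree_le_of_dvd (minpoly_inv_dvd_reverse hx) ?_
    rw [Ne, reverse_eq_zero]
    exact minpoly.ne_zero (.of_finite k x)
  refine le_antisymm (key hx) ?_
  simpa using key (inv_ne_zero hx)

/-- The minimal polynomial of `x⁻¹` is the reverse of that of `x`, divided by the constant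
coefficient to make it monic. -/
theorem nextCoeff_minpoly_inv {x : K} (hx : x ≠ 0) :
    (minpoly k x⁻¹).nextCoeff = (minpoly k x).coeff 1 / (minpoly k x).coeff 0 := by
  set f := minpoly k x with hf
  have h0 : f.coeff 0 ≠ 0 := minpoly_coeff_zero_ne_zero hx
  have hd : 0 < f.natDegree := minpoly.natDegree_pos (.of_finite k x)
  have htr : f.natTrailingDegree = 0 := natTrailingDegree_eq_zero.2 (Or.inr h0)
  have hm : (C (f.coeff 0)⁻¹ * f.reverse).Monic := by
    rw [Monic, leadingCoeff_mul, leadingCoeff_C, reverse_leadingCoeff, trailingCoeff, htr,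
      inv_mul_cancel₀ h0]
  have hC : (C (f.coeff 0)⁻¹ : k[X]) ≠ 0 := C_ne_zero.2 (inv_ne_zero h0)
  have hdeg : (C (f.coeff 0)⁻¹ * f.reverse).natDegree = f.natDegree := by
    rw [natDegree_C_mul (inv_ne_zero h0), natDegree_reverse_minpoly hx]
  have h : C (f.coeff 0)⁻¹ * f.reverse = minpoly k x⁻¹ :=
    eq_of_monic_of_dvd_of_natDegree_le (minpoly.monic (.of_finite k _)) hm
      ((minpoly_inv_dvd_reverse hx).mul_left _) (by rw [hdeg, natDegree_minpoly_inv hx])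
  rw [← h, nextCoeff, hdeg, if_neg hd.ne', coeff_C_mul, coeff_reverse,
    revAt_le (Nat.sub_le _ _), Nat.sub_sub_self hd, inv_mul_eq_div]

end Minpoly

/-! ### Vanishing of sums over monic polynomials by shifting. -/

section Shift

variable {k : Type*} [Field k] [Fintype k] {R : Type*} [CommRing R]

theorem sum_monics_add {n : ℕ} (f : k[X] → R) {h : k[X]} (hh : h.degree < (n : WithBot ℕ)) :
    ∑ g ∈ monics k n, f (g + h) = ∑ g ∈ monics k n, f g := by
  have key : ∀ {h : k[X]}, h.degree < (n : WithBot ℕ) → ∀ g ∈ monics k n, g + h ∈ monics k n := by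
    intro h hh g hg
    rw [mem_monics] at hg ⊢
    have hlt : h.degree < g.degree := by
      rw [degree_eq_natDegree hg.1.ne_zero, hg.2]
      exact hh
    exact ⟨hg.1.add_of_left hlt, by rw [natDegree_add_eq_left_of_degree_lt hlt, hg.2]⟩
  refine Finset.sum_bij' (fun g _ => g + h) (fun g _ => g + -h) (key hh)
    (key (by rwa [degree_neg])) ?_ ?_ ?_ <;> simp

/-- A sum over monic polynomials vanishes if the average over the shifts by multiples of some
polynomial of smaller degree does. -/
theorem sum_monics_eq_zero [IsDomain R] [CharZero R] {n : ℕ} (f : k[X] → R) {h : k[X]}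
    (hh : h.degree < (n : WithBot ℕ)) (hz : ∀ g ∈ monics k n, ∑ t : k, f (g + C t * h) = 0) :
    ∑ g ∈ monics k n, f g = 0 := by
  have hcard : (Fintype.card k : R) ≠ 0 := Nat.cast_ne_zero.2 Fintype.card_ne_zero
  refine (mul_eq_zero.1 ?_).resolve_left hcard
  have h1 : ∀ t : k, ∑ g ∈ monics k n, f (g + C t * h) = ∑ g ∈ monics k n, f g := fun t => by
    refine sum_monics_add f ((degree_mul_le _ _).trans_lt ?_)
    refine lt_of_le_of_lt ?_ hh
    calc (C t).degree + h.degree ≤ 0 + h.degree := by gcongr; exact degree_C_le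
      _ = h.degree := zero_add _
  calc (Fintype.card k : R) * ∑ g ∈ monics k n, f g
      = ∑ t : k, ∑ g ∈ monics k n, f (g + C t * h) := by
        rw [Finset.sum_congr rfl fun t _ => h1 t, Finset.sum_const, Finset.card_univ,
          nsmul_eq_mul]
    _ = 0 := by rw [Finset.sum_comm, Finset.sum_eq_zero hz]

end Shift

/-! ### Kloosterman sums over extensions. -/

section Kloosterman

variable {k : Type*} [Field k]

theorem kloostermanSum_eq [Fintype k] [DecidableEq k] (ψ : AddChar k ℂ) (b : k) :
    kloostermanSum ψ b = -∑ x : k, if x = 0 then 0 else ψ (x + b / x) := by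
  rw [kloostermanSum]
  congr 1
  have h0 : ∑ x : k, (if x = 0 then 0 else ψ (x + b / x)) =
      ∑ x ∈ Finset.univ.filter (fun x : k => x ≠ 0), ψ (x + b / x) := by
    rw [Finset.sum_filter]
    exact Finset.sum_congr rfl fun x _ => by by_cases h : x = 0 <;> simp [h]
  rw [h0]
  symm
  refine Finset.sum_bij' (fun x hx => Units.mk0 x (Finset.mem_filter.1 hx).2)
    (fun u _ => (u : k)) ?_ ?_ ?_ ?_ ?_
  · exact fun _ _ => @Finset.mem_univ _ (_) _
  · intro u _
    simp
  · intro x hx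
    rfl
  · intro u _
    ext
    rfl
  · intro x hx
    rfl

open Classical in
/-- The completely multiplicative function on monic polynomials whose value at `∏ (X - xᵢ)` is
`ψ (∑ xᵢ + b / xᵢ)`, and zero if some `xᵢ` vanishes. -/
def kloostermanLam (ψ : AddChar k ℂ) (b : k) (g : k[X]) : ℂ :=
  if g.coeff 0 = 0 then 0 else ψ (-g.nextCoeff - b * (g.coeff 1 / g.coeff 0))

theorem kloostermanLam_one (ψ : AddChar k ℂ) (b : k) : kloostermanLam ψ b 1 = 1 := by
  simp [kloostermanLam, nextCoeff, coeff_one]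

theorem kloostermanLam_mul (ψ : AddChar k ℂ) (b : k) {f g : k[X]} (hf : f.Monic) (hg : g.Monic) :
    kloostermanLam ψ b (f * g) = kloostermanLam ψ b f * kloostermanLam ψ b g := by
  unfold kloostermanLam
  rw [mul_coeff_zero, mul_coeff_one, hf.nextCoeff_mul hg]
  by_cases h1 : f.coeff 0 = 0
  · simp [h1]
  by_cases h2 : g.coeff 0 = 0
  · simp [h2]
  rw [if_neg h1, if_neg h2, if_neg (mul_ne_zero h1 h2), ← AddChar.map_add_eq_mul]
  congr 1
  field_simp
  ring

variable {ψ : AddChar k ℂ} {b : k}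

/-- Raising the value at `minpoly k x` to the power `[K : k(x)]` multiplies the argument of `ψ` by
that degree, which turns `-nextCoeff` into the trace of `x`, and `-coeff 1 / coeff 0` into the trace
of `x⁻¹`. -/
theorem primeSum_kloostermanLam [Fintype k] {K : Type*} [Field K] [Fintype K] [Algebra k K] :
    primeSum (kloostermanLam ψ b) (Module.finrank k K) =
      -kloostermanSum (ψ.compAddMonoidHom (Algebra.trace k K).toAddMonoidHom)
        (algebraMap k K b) := by
  classical
  rw [kloostermanSum_eq, neg_neg, ← sum_lam_minpoly (K := K)]
  refine Finset.sum_congr rfl fun x _ => ?_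
  have hn : 0 < Module.finrank k K / (minpoly k x).natDegree := by
    rw [finrank_div_natDegree_minpoly]
    exact Module.finrank_pos
  split_ifs with hx
  · subst hx
    rw [minpoly.zero, kloostermanLam, if_pos (by simp), zero_pow]
    simpa [minpoly.zero] using hn.ne'
  · rw [kloostermanLam, if_neg (minpoly_coeff_zero_ne_zero hx), ← AddChar.map_nsmul_eq_pow,
      AddChar.compAddMonoidHom_apply]
    congr 1
    rw [LinearMap.toAddMonoidHom_coe, map_add, div_eq_mul_inv (algebraMap k K b), ← Algebra.smul_def, map_smul,
      trace_eq_mul_nextCoeff x, trace_eq_mul_nextCoeff x⁻¹, natDegree_minpoly_inv hx,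
      nextCoeff_minpoly_inv hx, smul_eq_mul, nsmul_eq_mul, nsmul_eq_mul, nsmul_eq_mul]
    ring

variable [Fintype k]

theorem monicSum_kloostermanLam_one : monicSum (kloostermanLam ψ b) 1 = -kloostermanSum ψ b := by
  classical
  rw [kloostermanSum_eq, neg_neg, monicSum, sum_monics,
    ← (Equiv.funUnique (Fin 1) k).symm.sum_comp, ← Equiv.sum_comp (Equiv.neg k)]
  refine Finset.sum_congr rfl fun x _ => ?_
  have h0 := coeff_monicPoly ((Equiv.funUnique (Fin 1) k).symm (Equiv.neg k x)) 0
  have h1 := (monicPoly_monic ((Equiv.funUnique (Fin 1) k).symm (Equiv.neg k x))).coeff_natDegree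
  have h2 := natDegree_monicPoly ((Equiv.funUnique (Fin 1) k).symm (Equiv.neg k x))
  rw [h2] at h1
  simp only [Equiv.neg_apply, Equiv.funUnique_symm_apply, uniqueElim_const, Fin.val_zero] at h0 h1 h2 ⊢
  rw [kloostermanLam, h0, h1, nextCoeff, h2]
  simp only [one_ne_zero, if_false, Nat.sub_self, h0, neg_eq_zero]
  split_ifs with hx
  · rfl
  · congr 1
    field_simp
    ring

/-- For `X² + yX + x` the coefficient `y` is both `nextCoeff` and `coeff 1`, so the argument of `ψ`
is linear in `y`, with slope `-(1 + b/x)`. Orthogonality leaves only `x = -b`. -/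
theorem monicSum_kloostermanLam_two (hψ : ψ ≠ 1) (hb : b ≠ 0) :
    monicSum (kloostermanLam ψ b) 2 = Fintype.card k := by
  classical
  rw [monicSum, sum_monics, ← (finTwoArrowEquiv k).symm.sum_comp, Fintype.sum_prod_type]
  have key : ∀ x y : k, kloostermanLam ψ b (monicPoly ((finTwoArrowEquiv k).symm (x, y))) =
      if x = 0 then 0 else ψ (y * -(1 + b / x)) := by
    intro x y
    have h0 := coeff_monicPoly ((finTwoArrowEquiv k).symm (x, y)) 0
    have h1 := coeff_monicPoly ((finTwoArrowEquiv k).symm (x, y)) 1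
    have h2 := natDegree_monicPoly ((finTwoArrowEquiv k).symm (x, y))
    simp only [finTwoArrowEquiv_symm_apply, Fin.val_zero, Fin.val_one, Matrix.cons_val_zero,
      Matrix.cons_val_one] at h0 h1 h2 ⊢
    rw [kloostermanLam, h0, h1, nextCoeff, h2]
    simp only [OfNat.ofNat_ne_zero, if_false, Nat.add_one_sub_one, h1]
    split_ifs with hx
    · rfl
    · congr 1
      ring
  simp only [key]
  rw [Finset.sum_eq_single (-b)]
  · rw [Finset.sum_congr rfl (g := fun _ => (1 : ℂ))]
    · simp
    · intro y _
      rw [if_neg (neg_ne_zero.2 hb), div_neg, div_self hb]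
      simp
  · intro x _ hx
    by_cases hx0 : x = 0
    · simp [hx0]
    · simp only [if_neg hx0]
      rw [AddChar.sum_mulShift _ (AddChar.IsPrimitive.of_ne_one hψ), if_neg, Nat.cast_zero]
      rw [neg_eq_zero]
      intro h
      apply hx
      field_simp at h
      linear_combination h
  · simp

/-- From degree three on, shifting by multiples of `X ^ (n - 1)` moves `nextCoeff` and leaves the
two lowest coefficients alone, so the average over the shifts is a full sum of a nontrivial
character. -/
theorem monicSum_kloostermanLam_of_three_le (hψ : ψ ≠ 1) {n : ℕ} (hn : 3 ≤ n) :
    monicSum (kloostermanLam ψ b) n = 0 := by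
  classical
  have hdeg : ((X : k[X]) ^ (n - 1)).degree < (n : WithBot ℕ) := by
    rw [degree_X_pow]
    exact Nat.cast_lt.2 (by omega)
  refine sum_monics_eq_zero _ hdeg fun g hg => ?_
  rw [mem_monics] at hg
  have key : ∀ t : k, kloostermanLam ψ b (g + C t * X ^ (n - 1)) =
      kloostermanLam ψ b g * ψ (t * -1) := by
    intro t
    have hdt : (C t * X ^ (n - 1)).degree < g.degree := by
      rw [degree_eq_natDegree hg.1.ne_zero, hg.2]
      exact (degree_C_mul_X_pow_le _ _).trans_lt (Nat.cast_lt.2 (by omega))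
    have h0 : (g + C t * X ^ (n - 1)).coeff 0 = g.coeff 0 := by
      rw [coeff_add, coeff_C_mul_X_pow, if_neg (by omega), add_zero]
    have h1 : (g + C t * X ^ (n - 1)).coeff 1 = g.coeff 1 := by
      rw [coeff_add, coeff_C_mul_X_pow, if_neg (by omega), add_zero]
    have h2 : (g + C t * X ^ (n - 1)).nextCoeff = g.nextCoeff + t := by
      rw [nextCoeff, nextCoeff, natDegree_add_eq_left_of_degree_lt hdt, hg.2,
        if_neg (by omega), if_neg (by omega), coeff_add, coeff_C_mul_X_pow, if_pos rfl]
    rw [kloostermanLam, kloostermanLam, h0, h1, h2]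
    split_ifs
    · simp
    · rw [← AddChar.map_add_eq_mul]
      congr 1
      ring
  rw [Finset.sum_congr rfl fun t _ => key t, ← Finset.mul_sum,
    AddChar.sum_mulShift _ (AddChar.IsPrimitive.of_ne_one hψ), if_neg (by simp), Nat.cast_zero,
    mul_zero]

/-- The Kloosterman sums over all extensions are the power sums of the two inverse roots
of `1 - Kl T + q T ^ 2`. -/
theorem kloostermanSum_extension (hψ : ψ ≠ 1) (hb : b ≠ 0) {α β : ℂ}
    (h1 : α + β = kloostermanSum ψ b) (h2 : α * β = Fintype.card k)
    (K : Type*) [Field K] [Fintype K] [Algebra k K] :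
    kloostermanSum (ψ.compAddMonoidHom (Algebra.trace k K).toAddMonoidHom) (algebraMap k K b) =
      α ^ Module.finrank k K + β ^ Module.finrank k K := by
  have := primeSum_eq_neg_pow_add_pow (kloostermanLam_one ψ b)
    (fun f g => kloostermanLam_mul ψ b) (fun n => monicSum_kloostermanLam_of_three_le hψ)
    (by rw [monicSum_kloostermanLam_one, neg_neg, h1])
    (by rw [monicSum_kloostermanLam_two hψ hb, h2]) (Module.finrank_pos (R := k) (M := K))
  rw [primeSum_kloostermanLam, neg_inj] at this
  exact this

theorem compAddMonoidHom_trace_ne_one (hψ : ψ ≠ 1) (K : Type*) [Field K] [Fintype K] [Algebra k K] :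
    ψ.compAddMonoidHom (Algebra.trace k K).toAddMonoidHom ≠ 1 := by
  obtain ⟨x, hx⟩ := AddChar.ne_one_iff.1 hψ
  obtain ⟨y, rfl⟩ := Algebra.trace_surjective k K x
  exact AddChar.ne_one_iff.2 ⟨y, hx⟩

end Kloosterman

/-! ### Quadratic character sums. -/

section QuadraticSums

variable {k : Type*} [Field k] [Fintype k] [DecidableEq k]

theorem sum_sq (hk : ringChar k ≠ 2) {R : Type*} [CommRing R] (f : k → R) :
    ∑ z : k, f (z ^ 2) = ∑ y : k, (1 + (quadraticChar k y : R)) * f y := by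
  rw [← Finset.sum_fiberwise_of_maps_to (g := fun z : k => z ^ 2)
    (fun _ _ => Finset.mem_univ _)]
  refine Finset.sum_congr rfl fun y _ => ?_
  rw [Finset.sum_congr rfl (g := fun _ => f y)
    (fun z hz => by rw [(Finset.mem_filter.1 hz).2]), Finset.sum_const, nsmul_eq_mul]
  congr 1
  have h := congrArg (Int.cast (R := R)) (quadraticChar_card_sqrts hk y)
  rw [Int.cast_natCast, Int.cast_add, Int.cast_one, add_comm] at h
  rw [← h]
  congr 2
  ext
  simp

/-- Dividing by the square `w²` and inverting `w` makes the argument affine, `1 + s w`; the whole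
sum then vanishes and only the missing term `w = 0` contributes. -/
theorem sum_quadraticChar_mul_add {s : k} (hk : ringChar k ≠ 2) (hs : s ≠ 0) :
    ∑ w : k, quadraticChar k (w * (w + s)) = -1 := by
  have h1 : ∀ w : k, quadraticChar k (w * (w + s)) =
      if w = 0 then 0 else quadraticChar k (1 + s * w⁻¹) := by
    intro w
    split_ifs with hw
    · simp [hw]
    · have : w * (w + s) = w ^ 2 * (1 + s * w⁻¹) := by field_simp
      rw [this, map_mul, quadraticChar_sq_one' hw, one_mul]
  have h2 : ∑ w : k, quadraticChar k (1 + s * w) = 0 := by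
    rw [← quadraticChar_sum_zero hk]
    exact Fintype.sum_bijective (fun w => 1 + s * w)
      ((Equiv.mulLeft₀ s hs).trans (Equiv.addLeft 1)).bijective _ _ fun _ => rfl
  have h3 : ∑ w : k, (if w = 0 then 0 else quadraticChar k (1 + s * w⁻¹)) =
      ∑ w : k, (if w = 0 then 0 else quadraticChar k (1 + s * w)) := by
    refine Fintype.sum_equiv (Equiv.inv k) _ _ fun w => ?_
    simp
  have h4 : ∑ w : k, (if w = 0 then 0 else quadraticChar k (1 + s * w)) =
      ∑ w : k, (quadraticChar k (1 + s * w) - if w = 0 then 1 else 0) := by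
    refine Finset.sum_congr rfl fun w _ => ?_
    split_ifs with hw <;> simp [hw]
  rw [Finset.sum_congr rfl fun w _ => h1 w, h3, h4, Finset.sum_sub_distrib, h2]
  simp

theorem sum_quadraticChar_mul_self :
    ∑ w : k, quadraticChar k (w * w) = (Fintype.card k : ℤ) - 1 := by
  have h : ∀ w : k, quadraticChar k (w * w) = 1 - if w = 0 then 1 else 0 := fun w => by
    split_ifs with hw
    · simp [hw]
    · rw [← sq, quadraticChar_sq_one' hw, sub_zero]
  rw [Finset.sum_congr rfl fun w _ => h w, Finset.sum_sub_distrib]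
  simp

theorem sum_sum_quadraticChar (hk : ringChar k ≠ 2) :
    ∑ u : k, ∑ w : k, quadraticChar k (u * w * (u + w - 1)) = Fintype.card k := by
  have h : ∀ u : k, ∑ w : k, quadraticChar k (u * w * (u + w - 1)) =
      -quadraticChar k u + if u = 1 then (Fintype.card k : ℤ) else 0 := by
    intro u
    have h1 : ∀ w : k, quadraticChar k (u * w * (u + w - 1)) =
        quadraticChar k u * quadraticChar k (w * (w + (u - 1))) := fun w => by
      rw [← map_mul]
      congr 1
      ring
    rw [Finset.sum_congr rfl fun w _ => h1 w, ← Finset.mul_sum]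
    split_ifs with hu
    · subst hu
      simp only [sub_self, add_zero]
      rw [sum_quadraticChar_mul_self, map_one]
      ring
    · rw [sum_quadraticChar_mul_add hk (sub_ne_zero.2 hu)]
      ring
  rw [Finset.sum_congr rfl fun u _ => h u, Finset.sum_add_distrib, Finset.sum_neg_distrib,
    quadraticChar_sum_zero hk]
  simp

/-- Both sides are given by Euler's criterion, since the norm is the power with exponent `(|K| - 1)
/ (|k| - 1)`. The values are compared in `K`, where `1 ≠ -1`. -/
theorem quadraticChar_norm {K : Type*} [Field K] [Fintype K] [DecidableEq K] [Algebra k K]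
    (hk : ringChar k ≠ 2) (x : K) :
    quadraticChar k (Algebra.norm k x) = quadraticChar K x := by
  have hK : ringChar K ≠ 2 := by
    rwa [← Algebra.ringChar_eq k K]
  by_cases hx : x = 0
  · simp [hx, Algebra.norm_zero]
  have hN : Algebra.norm k x ≠ 0 := Algebra.norm_ne_zero_iff.2 hx
  have h2 : Fintype.card k % 2 = 1 := FiniteField.odd_card_of_char_ne_two hk
  have h3 : Fintype.card K % 2 = 1 := FiniteField.odd_card_of_char_ne_two hK
  have hcard : Fintype.card K = Fintype.card k ^ Module.finrank k K := Module.card_eq_pow_finrank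
  have hq : 1 < Fintype.card k := Fintype.one_lt_card
  have he : (Fintype.card K - 1) / (Fintype.card k - 1) * (Fintype.card k / 2) =
      Fintype.card K / 2 := by
    obtain ⟨c, hc⟩ : Fintype.card k - 1 ∣ Fintype.card K - 1 := by
      rw [hcard]
      simpa using Nat.sub_dvd_pow_sub_pow (Fintype.card k) 1 (Module.finrank k K)
    rw [hc, Nat.mul_div_cancel_left _ (by omega)]
    obtain ⟨m, hm⟩ : ∃ m, Fintype.card k = 2 * m + 1 := ⟨Fintype.card k / 2, by omega⟩
    have e1 : Fintype.card k / 2 = m := by omega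
    have e2 : Fintype.card K = 2 * (c * m) + 1 := by
      have : Fintype.card K - 1 = 2 * (c * m) := by
        rw [hc, hm, Nat.add_sub_cancel]
        ring
      have : 0 < Fintype.card K := Fintype.card_pos
      omega
    rw [e1, e2]
    omega
  have key : ((quadraticChar k (Algebra.norm k x) : ℤ) : K) = (quadraticChar K x : ℤ) := by
    rw [quadraticChar_eq_pow_of_char_ne_two' hK, ← he, pow_mul, ← Nat.card_eq_fintype_card (α := K),
      ← Nat.card_eq_fintype_card (α := k), ← FiniteField.algebraMap_norm_eq_pow, ← map_pow,
      Nat.card_eq_fintype_card,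
      ← quadraticChar_eq_pow_of_char_ne_two' hk, map_intCast]
  have hne : (1 : K) ≠ -1 := (Ring.neg_one_ne_one_of_char_ne_two hK).symm
  rcases quadraticChar_dichotomy hN with h | h <;> rcases quadraticChar_dichotomy hx with h' | h'
    <;> rw [h, h'] <;> rw [h, h'] at key <;> push_cast at key
  · exact absurd key hne
  · exact absurd key.symm hne

end QuadraticSums

/-! ### Traces of Frobenius of Legendre curves over extensions. -/

section Elliptic

/-- The trace of Frobenius `-∑ x, χ (x (x + A) (x + B))` of the curve
`y ^ 2 = x (x + A) (x + B)`. -/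
def ellTrace (k : Type*) [Field k] [Fintype k] [DecidableEq k] (A B : k) : ℤ :=
  -∑ x : k, quadraticChar k (x * (x + A) * (x + B))

variable {k : Type*} [Field k] [Fintype k] [DecidableEq k]

/-- The completely multiplicative function on monic polynomials whose value at `∏ (X - xᵢ)` is
`∏ χ (xᵢ (xᵢ + A) (xᵢ + B))`. -/
def ellLam (A B : k) (g : k[X]) : ℂ :=
  (quadraticChar k (((-1) ^ g.natDegree * g.eval 0) * ((-1) ^ g.natDegree * g.eval (-A)) *
    ((-1) ^ g.natDegree * g.eval (-B))) : ℤ)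

theorem ellLam_one (A B : k) : ellLam A B 1 = 1 := by
  simp [ellLam]

theorem ellLam_mul (A B : k) {f g : k[X]} (hf : f.Monic) (hg : g.Monic) :
    ellLam A B (f * g) = ellLam A B f * ellLam A B g := by
  rw [ellLam, ellLam, ellLam, ← Int.cast_mul, ← map_mul, hf.natDegree_mul hg]
  congr 2
  simp only [eval_mul, pow_add]
  ring

variable {A B : k}

/-- The appropriate power of `± (minpoly k x).eval e` is the norm of `x - e`; taking `e = 0, -A,
-B`, the claim is the compatibility of the quadratic character with norms. -/
theorem primeSum_ellLam (hk : ringChar k ≠ 2) {K : Type*} [Field K] [Fintype K] [DecidableEq K]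
    [Algebra k K] :
    primeSum (ellLam A B) (Module.finrank k K) =
      -(ellTrace K (algebraMap k K A) (algebraMap k K B) : ℂ) := by
  rw [ellTrace, Int.cast_neg, neg_neg, ← sum_lam_minpoly (K := K), Int.cast_sum]
  refine Finset.sum_congr rfl fun x _ => ?_
  rw [ellLam, ← Int.cast_pow, ← map_pow, mul_pow, mul_pow, ← norm_sub_algebraMap,
    ← norm_sub_algebraMap, ← norm_sub_algebraMap, ← map_mul, ← map_mul, quadraticChar_norm hk]
  simp

theorem monicSum_ellLam_one : monicSum (ellLam A B) 1 = -(ellTrace k A B : ℂ) := by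
  rw [ellTrace, Int.cast_neg, neg_neg, monicSum, sum_monics,
    ← (Equiv.funUnique (Fin 1) k).symm.sum_comp, ← Equiv.sum_comp (Equiv.neg k), Int.cast_sum]
  refine Finset.sum_congr rfl fun x _ => ?_
  rw [ellLam, natDegree_monicPoly]
  congr 2
  simp [monicPoly]

/-- A monic quadratic `g` is determined by `g(0)` and `g(-A)`. In the coordinates `g(0) = ABu`,
`g(-A) = A(A - B)w` one finds `g(-B) = B(A - B)(u + w - 1)`, so up to a square the product is `u w
(u + w - 1)`. -/
theorem monicSum_ellLam_two (hk : ringChar k ≠ 2) (hA : A ≠ 0) (hB : B ≠ 0) (hAB : A ≠ B) :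
    monicSum (ellLam A B) 2 = Fintype.card k := by
  have hd : A - B ≠ 0 := sub_ne_zero.2 hAB
  rw [← Int.cast_natCast, ← sum_sum_quadraticChar hk, monicSum, sum_monics,
    ← (finTwoArrowEquiv k).symm.sum_comp, Fintype.sum_prod_type]
  push_cast
  rw [← Equiv.sum_comp (Equiv.mulLeft₀ (A * B) (mul_ne_zero hA hB))]
  refine Finset.sum_congr rfl fun u _ => ?_
  -- The linear coefficient of `g` is `A + Bu - (A - B)w`.
  refine (Fintype.sum_equiv ((Equiv.mulLeft₀ (A - B) hd).trans
    ((Equiv.neg k).trans (Equiv.addLeft (A + B * u)))) _ _ fun w => ?_).symm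
  rw [ellLam, natDegree_monicPoly]
  have h : (-1 : k) ^ 2 = 1 := by ring
  simp only [h, one_mul]
  have e : (monicPoly ((finTwoArrowEquiv k).symm ((Equiv.mulLeft₀ (A * B) (mul_ne_zero hA hB)) u,
      ((Equiv.mulLeft₀ (A - B) hd).trans
        ((Equiv.neg k).trans (Equiv.addLeft (A + B * u)))) w))).eval 0 *
      (monicPoly ((finTwoArrowEquiv k).symm ((Equiv.mulLeft₀ (A * B) (mul_ne_zero hA hB)) u,
      ((Equiv.mulLeft₀ (A - B) hd).trans
        ((Equiv.neg k).trans (Equiv.addLeft (A + B * u)))) w))).eval (-A) *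
      (monicPoly ((finTwoArrowEquiv k).symm ((Equiv.mulLeft₀ (A * B) (mul_ne_zero hA hB)) u,
      ((Equiv.mulLeft₀ (A - B) hd).trans
        ((Equiv.neg k).trans (Equiv.addLeft (A + B * u)))) w))).eval (-B) =
      (A * B * (A - B)) ^ 2 * (u * w * (u + w - 1)) := by
    simp [monicPoly]
    ring
  rw [e, map_mul _ ((A * B * (A - B)) ^ 2), quadraticChar_sq_one' (mul_ne_zero (mul_ne_zero hA hB) hd), one_mul]

/-- Shifting by multiples of `X (X + A)` fixes the values at `0` and `-A` and moves the value at
`-B` through the whole field, over which the quadratic character sums to zero. The shift has degree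
two, hence the bound on `n`. -/
theorem monicSum_ellLam_of_three_le (hk : ringChar k ≠ 2) (hB : B ≠ 0) (hAB : A ≠ B) {n : ℕ}
    (hn : 3 ≤ n) : monicSum (ellLam A B) n = 0 := by
  have hX : (X * (X + C A) : k[X]).degree = 2 := by
    rw [degree_mul, degree_X, degree_X_add_C]
    rfl
  have hdeg : (X * (X + C A) : k[X]).degree < (n : WithBot ℕ) := by
    rw [hX]
    exact Nat.cast_lt.2 (by omega : 2 < n)
  refine sum_monics_eq_zero _ hdeg fun g hg => ?_
  rw [mem_monics] at hg
  set r : k := -B * (-B + A) with hr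
  have hr0 : r ≠ 0 := mul_ne_zero (neg_ne_zero.2 hB) fun h => hAB (by linear_combination h)
  have key : ∀ t : k, ellLam A B (g + C t * (X * (X + C A))) =
      (quadraticChar k (((-1) ^ n * g.eval 0) * ((-1) ^ n * g.eval (-A)) * (-1) ^ n) : ℤ) *
        (quadraticChar k (g.eval (-B) + r * t) : ℤ) := by
    intro t
    have hdt : (C t * (X * (X + C A))).degree < g.degree := by
      rw [degree_eq_natDegree hg.1.ne_zero, hg.2]
      refine lt_of_le_of_lt ?_ hdeg
      calc (C t * (X * (X + C A))).degree ≤ (C t).degree + (X * (X + C A)).degree :=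
            degree_mul_le _ _
        _ ≤ 0 + (X * (X + C A)).degree := by gcongr; exact degree_C_le
        _ = _ := zero_add _
    rw [ellLam, natDegree_add_eq_left_of_degree_lt hdt, hg.2, ← Int.cast_mul, ← map_mul]
    congr 2
    simp
    ring
  rw [Finset.sum_congr rfl fun t _ => key t, ← Finset.mul_sum]
  have h0 : ∑ t : k, quadraticChar k (g.eval (-B) + r * t) = 0 := by
    rw [← quadraticChar_sum_zero hk]
    exact Fintype.sum_bijective (fun t => g.eval (-B) + r * t)
      ((Equiv.mulLeft₀ r hr0).trans (Equiv.addLeft _)).bijective _ _ fun _ => rfl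
  rw [← Int.cast_sum, h0, Int.cast_zero, mul_zero]

theorem ellTrace_extension (hk : ringChar k ≠ 2) (hA : A ≠ 0) (hB : B ≠ 0) (hAB : A ≠ B) {α β : ℂ}
    (h1 : α + β = ellTrace k A B) (h2 : α * β = Fintype.card k)
    (K : Type*) [Field K] [Fintype K] [DecidableEq K] [Algebra k K] :
    (ellTrace K (algebraMap k K A) (algebraMap k K B) : ℂ) =
      α ^ Module.finrank k K + β ^ Module.finrank k K := by
  have := primeSum_eq_neg_pow_add_pow (ellLam_one A B) (fun f g => ellLam_mul A B)
    (fun n => monicSum_ellLam_of_three_le hk hB hAB)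
    (by rw [monicSum_ellLam_one, neg_neg, h1])
    (by rw [monicSum_ellLam_two hk hA hB hAB, h2]) (Module.finrank_pos (R := k) (M := K))
  rw [primeSum_ellLam hk, neg_inj] at this
  exact this

theorem ellTrace_zero_right (hk : ringChar k ≠ 2) : ellTrace k A 0 = quadraticChar k A := by
  have h : ∀ x : k, quadraticChar k (x * (x + A) * (x + 0)) =
      quadraticChar k (x + A) - if x = 0 then quadraticChar k A else 0 := fun x => by
    split_ifs with hx
    · simp [hx]
    · rw [add_zero, mul_right_comm, ← sq, map_mul, quadraticChar_sq_one' hx]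
      ring
  have h0 : ∑ x : k, quadraticChar k (x + A) = 0 := by
    rw [← quadraticChar_sum_zero hk]
    exact Equiv.sum_comp (Equiv.addRight A) fun x => quadraticChar k x
  rw [ellTrace, Finset.sum_congr rfl fun x _ => h x, Finset.sum_sub_distrib, h0]
  simp

theorem ellTrace_self (hk : ringChar k ≠ 2) : ellTrace k A A = quadraticChar k (-A) := by
  have h : ∀ x : k, quadraticChar k (x * (x + A) * (x + A)) =
      quadraticChar k x - if x = -A then quadraticChar k (-A) else 0 := fun x => by
    split_ifs with hx
    · simp [hx]
    · have hx' : x + A ≠ 0 := fun h => hx (eq_neg_of_add_eq_zero_left h)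
      rw [mul_assoc, ← sq, map_mul, quadraticChar_sq_one' hx']
      ring
  rw [ellTrace, Finset.sum_congr rfl fun x _ => h x, Finset.sum_sub_distrib,
    quadraticChar_sum_zero hk]
  simp

/-- In the degenerate cases, the trace over an extension is a power of the trace. -/
theorem ellTrace_extension_of_eq (hk : ringChar k ≠ 2) (hAB : B = 0 ∨ B = A)
    (K : Type*) [Field K] [Fintype K] [DecidableEq K] [Algebra k K] :
    ellTrace K (algebraMap k K A) (algebraMap k K B) = ellTrace k A B ^ Module.finrank k K := by
  have hK : ringChar K ≠ 2 := by
    rwa [← Algebra.ringChar_eq k K]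
  rcases hAB with rfl | rfl
  · rw [map_zero, ellTrace_zero_right hk, ellTrace_zero_right hK, ← quadraticChar_norm hk,
      Algebra.norm_algebraMap, map_pow]
  · rw [ellTrace_self hk, ellTrace_self hK, ← map_neg, ← quadraticChar_norm hk,
      Algebra.norm_algebraMap, map_pow]

end Elliptic

/-! ### The identity between elliptic and Kloosterman sums. -/

section Identity

variable {k : Type*} [Field k] [Fintype k] [DecidableEq k]

theorem sum_addChar_mul {ψ : AddChar k ℂ} (hψ : ψ ≠ 1) (b : k) :
    ∑ x : k, ψ (x * b) = if b = 0 then (Fintype.card k : ℂ) else 0 := by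
  rw [AddChar.sum_mulShift _ (AddChar.IsPrimitive.of_ne_one hψ)]
  split_ifs <;> simp

theorem sum_quadraticChar_sq_add (hk : ringChar k ≠ 2) (x : k) :
    ∑ z : k, quadraticChar k (z ^ 2 + x) = if x = 0 then (Fintype.card k : ℤ) - 1 else -1 := by
  have h0 : ∑ y : k, quadraticChar k (y + x) = 0 := by
    rw [← quadraticChar_sum_zero hk]
    exact Equiv.sum_comp (Equiv.addRight x) fun x => quadraticChar k x
  have h1 : ∀ y : k, (1 + quadraticChar k y) * quadraticChar k (y + x) =
      quadraticChar k (y + x) + quadraticChar k (y * (y + x)) := fun y => by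
    rw [map_mul]
    ring
  rw [sum_sq hk fun y => quadraticChar k (y + x)]
  simp only [Int.cast_id]
  rw [Finset.sum_congr rfl fun y _ => h1 y, Finset.sum_add_distrib, h0, zero_add]
  split_ifs with hx
  · subst hx
    simp only [add_zero]
    exact sum_quadraticChar_mul_self
  · exact sum_quadraticChar_mul_add hk hx

/-- Summing over `z` first, the inner sum of `χ(z² + x)` is `-1` unless `x = 0`, where the remaining
factor vanishes anyway; what is left is the sum of `χ(x (x + A))`. -/
theorem sum_ellTrace_sq (hk : ringChar k ≠ 2) {A : k} (hA : A ≠ 0) :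
    ∑ z : k, ellTrace k A (z ^ 2) = -1 := by
  have h : ∀ x : k, ∑ z : k, quadraticChar k (x * (x + A) * (x + z ^ 2)) =
      -quadraticChar k (x * (x + A)) := by
    intro x
    have h1 : ∀ z : k, quadraticChar k (x * (x + A) * (x + z ^ 2)) =
        quadraticChar k (x * (x + A)) * quadraticChar k (z ^ 2 + x) := fun z => by
      rw [← map_mul, add_comm x (z ^ 2)]
    rw [Finset.sum_congr rfl fun z _ => h1 z, ← Finset.mul_sum, sum_quadraticChar_sq_add hk]
    split_ifs with hx
    · simp [hx]
    · ring
  simp only [ellTrace]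
  rw [Finset.sum_neg_distrib, Finset.sum_comm, Finset.sum_congr rfl fun x _ => h x,
    Finset.sum_neg_distrib, sum_quadraticChar_mul_add hk hA]
  norm_num

/-- A Kloosterman sum, squared, in terms of the sums and products of pairs of elements. -/
theorem kloostermanSum_sq (hk : ringChar k ≠ 2) {ψ : AddChar k ℂ} (hψ : ψ ≠ 1) {b : k}
    (hb : b ≠ 0) :
    kloostermanSum ψ b ^ 2 = Fintype.card k + ∑ p : k, if p = 0 then 0 else
      ∑ s : k, (quadraticChar k (s ^ 2 - 4 * p) : ℂ) * ψ (s * (1 + b / p)) := by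
  have h2 := Ring.two_ne_zero hk
  have h4 : (4 : k) ≠ 0 := by
    have : (4 : k) = 2 * 2 := by norm_num
    rw [this]
    exact mul_ne_zero h2 h2
  let f : k → k → ℂ := fun s p => if p = 0 then 0 else ψ (s * (1 + b / p))
  have e1 : kloostermanSum ψ b ^ 2 = ∑ x : k, ∑ y : k, f (x + y) (x * y) := by
    rw [kloostermanSum_eq, neg_sq, sq, Finset.sum_mul_sum]
    refine Finset.sum_congr rfl fun x _ => Finset.sum_congr rfl fun y _ => ?_
    by_cases hx : x = 0
    · simp [f, hx]
    by_cases hy : y = 0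
    · simp [f, hy]
    simp only [f, hx, hy, mul_eq_zero, or_self, if_false]
    rw [← AddChar.map_add_eq_mul]
    congr 1
    field_simp
    ring
  -- Sum and difference are coordinates on pairs because `2` is invertible, with `4xy = s² - d²`.
  have e2 : ∑ x : k, ∑ y : k, f (x + y) (x * y) =
      ∑ s : k, ∑ d : k, f s ((s ^ 2 - d ^ 2) / 4) := by
    rw [← Fintype.sum_prod_type', ← Fintype.sum_prod_type']
    refine Fintype.sum_bijective (fun z : k × k => (z.1 + z.2, z.1 - z.2)) ?_ _ _ fun z => ?_
    · rw [Fintype.bijective_iff_injective_and_card]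
      refine ⟨fun z w h => ?_, rfl⟩
      obtain ⟨h1, h3⟩ := Prod.mk.inj h
      refine Prod.ext (mul_left_cancel₀ h2 ?_) (mul_left_cancel₀ h2 ?_)
      · linear_combination h1 + h3
      · linear_combination h1 - h3
    · congr 1
      field_simp
      ring
  have e3 : ∀ s : k, ∑ d : k, f s ((s ^ 2 - d ^ 2) / 4) =
      ∑ p : k, (1 + (quadraticChar k (s ^ 2 - 4 * p) : ℂ)) * f s p := by
    intro s
    rw [sum_sq hk fun y => f s ((s ^ 2 - y) / 4)]
    symm
    refine Fintype.sum_equiv ((Equiv.mulLeft₀ (-4) (neg_ne_zero.2 h4)).trans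
      (Equiv.addLeft (s ^ 2))) _ _ fun p => ?_
    have e : ((Equiv.mulLeft₀ (-4) (neg_ne_zero.2 h4)).trans (Equiv.addLeft (s ^ 2))) p =
        s ^ 2 - 4 * p := by
      simp
      ring
    rw [e]
    congr 2
    field_simp
    ring
  rw [e1, e2, Finset.sum_congr rfl fun s _ => e3 s, Finset.sum_comm]
  -- The summand `1` in the number `1 + χ(s² - 4p)` of square roots gives a full character sum in
  -- `s`, nonzero only at `p = -b`.
  have e4 : ∀ p : k, ∑ s : k, (1 + (quadraticChar k (s ^ 2 - 4 * p) : ℂ)) * f s p =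
      (if p = -b then (Fintype.card k : ℂ) else 0) + if p = 0 then 0 else
      ∑ s : k, (quadraticChar k (s ^ 2 - 4 * p) : ℂ) * ψ (s * (1 + b / p)) := by
    intro p
    by_cases hp : p = 0
    · have : ¬ (0 = -b) := fun h => hb (neg_eq_zero.1 h.symm)
      simp [f, hp, this]
    · simp only [f, hp, if_false, add_mul, one_mul]
      rw [Finset.sum_add_distrib, sum_addChar_mul hψ]
      congr 1
      have : 1 + b / p = 0 ↔ p = -b := by
        constructor
        · intro h
          field_simp at h
          linear_combination h
        · rintro rfl
          rw [div_neg, div_self hb]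
          ring
      simp only [this]
  rw [Finset.sum_congr rfl fun p _ => e4 p, Finset.sum_add_distrib]
  simp

/-- The fibre over `x` of `p ↦ -4 (p + γβ²)² / (β² p)` is the root set of a quadratic in `p` whose
discriminant is a nonzero square times `x (x + 16γ)`, so it has `1 + χ(x (x + 16γ))` elements. -/
theorem sum_quadraticChar_param (hk : ringChar k ≠ 2) {β : k} (hβ : β ≠ 0) {γ : k} (hγ : γ ≠ 0)
    (h : k → ℂ) :
    (∑ p : k, if p = 0 then 0 else h (-4 * (p + γ * β ^ 2) ^ 2 / (β ^ 2 * p))) =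
      ∑ x : k, (1 + (quadraticChar k (x * (x + 16 * γ)) : ℂ)) * h x := by
  have h2 := Ring.two_ne_zero hk
  have h4 : (4 : k) ≠ 0 := by
    have : (4 : k) = 2 * 2 := by norm_num
    rw [this]
    exact mul_ne_zero h2 h2
  have hc : ∀ x : k, (1 + (quadraticChar k (x * (x + 16 * γ)) : ℂ)) =
      ((Finset.univ.filter fun p : k =>
        p ≠ 0 ∧ -4 * (p + γ * β ^ 2) ^ 2 / (β ^ 2 * p) = x).card : ℂ) := by
    intro x
    -- This `c` completes the square: `(2p + c)²` differs from the discriminant term exactly by the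
    -- quadratic defining the fibre.
    set c : k := 2 * (γ * β ^ 2) + β ^ 2 * x / 4 with hcdef
    have h1 := quadraticChar_card_sqrts hk ((β ^ 2 / 4) ^ 2 * (x * (x + 16 * γ)))
    have hβ4 : β ^ 2 / 4 ≠ 0 := div_ne_zero (pow_ne_zero _ hβ) h4
    rw [map_mul, quadraticChar_sq_one' hβ4, one_mul] at h1
    have h3 := congrArg (Int.cast (R := ℂ)) h1
    rw [Int.cast_natCast, Int.cast_add, Int.cast_one, add_comm _ (1 : ℂ)] at h3
    rw [← h3]
    congr 1
    symm
    refine Finset.card_bijective (fun p => 2 * p + c)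
      ((Equiv.mulLeft₀ 2 h2).trans (Equiv.addRight c)).bijective fun p => ?_
    simp only [Finset.mem_filter, Finset.mem_univ, true_and, Set.mem_toFinset, Set.mem_ofPred_eq]
    have hb0 : γ * β ^ 2 ≠ 0 := mul_ne_zero hγ (pow_ne_zero _ hβ)
    have key : (2 * p + c) ^ 2 - (β ^ 2 / 4) ^ 2 * (x * (x + 16 * γ)) =
        4 * (p + γ * β ^ 2) ^ 2 + β ^ 2 * x * p := by
      rw [hcdef]
      field_simp
      ring
    rw [← sub_eq_zero (a := (2 * p + c) ^ 2), key]
    constructor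
    · rintro ⟨hp, rfl⟩
      field_simp
      ring
    · intro hz
      have hp : p ≠ 0 := by
        rintro rfl
        have : 4 * (γ * β ^ 2) ^ 2 = 0 := by linear_combination hz
        exact mul_ne_zero h4 (pow_ne_zero _ hb0) this
      refine ⟨hp, ?_⟩
      rw [div_eq_iff (mul_ne_zero (pow_ne_zero _ hβ) hp)]
      linear_combination -hz
  simp only [hc]
  have e1 : (∑ p : k, if p = 0 then 0 else h (-4 * (p + γ * β ^ 2) ^ 2 / (β ^ 2 * p))) =
      ∑ p ∈ Finset.univ.filter (fun p : k => p ≠ 0),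
        h (-4 * (p + γ * β ^ 2) ^ 2 / (β ^ 2 * p)) := by
    rw [Finset.sum_filter]
    exact Finset.sum_congr rfl fun x _ => by by_cases h : x = 0 <;> simp [h]
  rw [e1, ← Finset.sum_fiberwise_of_maps_to
    (g := fun p : k => -4 * (p + γ * β ^ 2) ^ 2 / (β ^ 2 * p)) (fun _ _ => Finset.mem_univ _)]
  refine Finset.sum_congr rfl fun x _ => ?_
  rw [Finset.sum_congr rfl (g := fun _ => h x)
    (fun z hz => by rw [(Finset.mem_filter.1 hz).2]), Finset.sum_const, nsmul_eq_mul,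
    Finset.filter_filter]

/-- The twisted sum over `z` of the traces of `y ^ 2 = x (x + 16 γ) (x + z ^ 2)`. -/
theorem sum_ellTrace_mul_addChar (hk : ringChar k ≠ 2) {ψ : AddChar k ℂ} (hψ : ψ ≠ 1) {β γ : k}
    (hβ : β ≠ 0) (hγ : γ ≠ 0) :
    ∑ z : k, (ellTrace k (16 * γ) (z ^ 2) : ℂ) * ψ (β * z) =
      Fintype.card k - kloostermanSum ψ (γ * β ^ 2) ^ 2 := by
  have h2 := Ring.two_ne_zero hk
  have hb0 : γ * β ^ 2 ≠ 0 := mul_ne_zero hγ (pow_ne_zero _ hβ)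
  -- The elliptic side is `-∑ x, χ(x (x + 16γ)) h x`. Since `h` sums to zero, `χ` may be replaced by
  -- `1 + χ`, which is the weight of the parametrisation by `p` appearing in the squared Kloosterman
  -- sum.
  let h : k → ℂ := fun x => ∑ z : k, (quadraticChar k (z ^ 2 + x) : ℂ) * ψ (β * z)
  have hsum : ∑ z : k, ψ (β * z) = 0 := by
    rw [Finset.sum_congr rfl fun z _ => by rw [mul_comm β z], sum_addChar_mul hψ, if_neg hβ]
  have e1 : ∑ z : k, (ellTrace k (16 * γ) (z ^ 2) : ℂ) * ψ (β * z) =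
      -∑ x : k, (quadraticChar k (x * (x + 16 * γ)) : ℂ) * h x := by
    simp only [h, Finset.mul_sum, ellTrace, Int.cast_neg, Int.cast_sum, neg_mul, Finset.sum_mul]
    rw [Finset.sum_neg_distrib, Finset.sum_comm]
    congr 1
    refine Finset.sum_congr rfl fun x _ => Finset.sum_congr rfl fun z _ => ?_
    rw [map_mul, Int.cast_mul, add_comm x (z ^ 2)]
    ring
  have e2 : ∑ x : k, h x = 0 := by
    simp only [h]
    rw [Finset.sum_comm]
    refine Finset.sum_eq_zero fun z _ => ?_
    have h0 : ∑ y : k, quadraticChar k (z ^ 2 + y) = 0 := by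
      rw [← quadraticChar_sum_zero hk]
      exact Equiv.sum_comp (Equiv.addLeft (z ^ 2)) fun x => quadraticChar k x
    rw [← Finset.sum_mul, ← Int.cast_sum, h0, Int.cast_zero, zero_mul]
  have e3 : ∑ p : k, (if p = 0 then 0 else
      ∑ s : k, (quadraticChar k (s ^ 2 - 4 * p) : ℂ) * ψ (s * (1 + γ * β ^ 2 / p))) =
      ∑ p : k, if p = 0 then 0 else h (-4 * (p + γ * β ^ 2) ^ 2 / (β ^ 2 * p)) := by
    refine Finset.sum_congr rfl fun p _ => ?_
    split_ifs with hp
    · rfl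
    -- At `p = -γβ²` the rescaling below is undefined; there the additive character is trivial and
    -- both sides equal `-1`.
    · by_cases hpb : p + γ * β ^ 2 = 0
      · have hp' : p = -(γ * β ^ 2) := eq_neg_of_add_eq_zero_left hpb
        have h4 : (4 : k) * (γ * β ^ 2) ≠ 0 := by
          have : (4 : k) = 2 * 2 := by norm_num
          rw [this]
          exact mul_ne_zero (mul_ne_zero h2 h2) hb0
        have a1 : ∑ s : k, (quadraticChar k (s ^ 2 - 4 * p) : ℂ) * ψ (s * (1 + γ * β ^ 2 / p)) =
            ((∑ s : k, quadraticChar k (s ^ 2 + 4 * (γ * β ^ 2)) : ℤ) : ℂ) := by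
          rw [Int.cast_sum]
          refine Finset.sum_congr rfl fun s _ => ?_
          have : 1 + γ * β ^ 2 / p = 0 := by
            rw [hp', div_neg, div_self hb0]
            ring
          rw [this, mul_zero, AddChar.map_zero_eq_one, mul_one, hp']
          congr 3
          ring
        have a2 : h (-4 * (p + γ * β ^ 2) ^ 2 / (β ^ 2 * p)) = -1 := by
          rw [hpb]
          simp only [h, zero_pow two_ne_zero, mul_zero, zero_div, add_zero]
          have : ∀ z : k, (quadraticChar k (z ^ 2) : ℂ) * ψ (β * z) =
              ψ (β * z) - if z = 0 then 1 else 0 := by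
            intro z
            split_ifs with hz
            · simp [hz]
            · rw [quadraticChar_sq_one' hz]
              simp
          rw [Finset.sum_congr rfl fun z _ => this z, Finset.sum_sub_distrib, hsum]
          simp
        rw [a1, a2, sum_quadraticChar_sq_add hk, if_neg h4]
        simp
      · have hr : β * p / (p + γ * β ^ 2) ≠ 0 := div_ne_zero (mul_ne_zero hβ hp) hpb
        symm
        -- The substitution `s = βp / (p + γβ²) · z` makes the additive argument `βz` and extracts a
        -- square from `s² - 4p`.
        refine Fintype.sum_equiv (Equiv.mulLeft₀ _ hr) _ _ fun z => ?_
        have a1 : (Equiv.mulLeft₀ _ hr) z ^ 2 - 4 * p = (β * p / (p + γ * β ^ 2)) ^ 2 *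
            (z ^ 2 + -4 * (p + γ * β ^ 2) ^ 2 / (β ^ 2 * p)) := by
          rw [Equiv.mulLeft₀_apply]
          generalize p + γ * β ^ 2 = D at hpb
          field_simp
          ring
        have a2 : (Equiv.mulLeft₀ _ hr) z * (1 + γ * β ^ 2 / p) = β * z := by
          have : 1 + γ * β ^ 2 / p = (p + γ * β ^ 2) / p := by
            rw [add_div, div_self hp]
          rw [Equiv.mulLeft₀_apply, this]
          generalize p + γ * β ^ 2 = D at hpb
          field_simp
        rw [a1, a2, map_mul _ ((β * p / (p + γ * β ^ 2)) ^ 2), quadraticChar_sq_one' hr, one_mul]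
  rw [e1, kloostermanSum_sq hk hψ hb0, e3, sum_quadraticChar_param hk hβ hγ h]
  simp only [add_mul, one_mul]
  rw [Finset.sum_add_distrib, e2]
  ring

end Identity

/-! ### Summing the fibre traces over an extension. -/

section Fibres

variable {F K : Type*} [Field F] [Field K] [Fintype K] [Algebra F K]

/-- A sum over the values `e τ - τ`, for an automorphism `e`, by Fourier analysis. -/
theorem sum_algEquiv_sub [DecidableEq K] {ψ : AddChar F ℂ} [Fintype F] (hψ : ψ ≠ 1)
    (e : K ≃ₐ[F] K) (f : K → ℂ) :
    ∑ τ : K, f (e τ - τ) = ∑ β : K, if e β = β then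
      ∑ z : K, f z * ψ.compAddMonoidHom (Algebra.trace F K).toAddMonoidHom (β * z) else 0 := by
  set Ψ := ψ.compAddMonoidHom (Algebra.trace F K).toAddMonoidHom with hΨ
  have hΨ1 : Ψ ≠ 1 := compAddMonoidHom_trace_ne_one hψ K
  have hinv : ∀ x : K, Ψ (e x) = Ψ x := fun x => by
    rw [hΨ, AddChar.compAddMonoidHom_apply, AddChar.compAddMonoidHom_apply]
    congr 1
    exact Algebra.trace_eq_of_algEquiv e x
  have hcard : (Fintype.card K : ℂ) ≠ 0 := Nat.cast_ne_zero.2 Fintype.card_ne_zero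
  -- The trace is invariant under `e`, so the character `τ ↦ Ψ(-β (e τ - τ))` is trivial exactly
  -- when `e β = β`: these `β` form the annihilator of the image of `e - 1`.
  have hin : ∀ β : K, ∑ τ : K, Ψ (-β * (e τ - τ)) = if e β = β then (Fintype.card K : ℂ) else 0 := by
    intro β
    obtain ⟨β', rfl⟩ := e.surjective β
    have h1 : ∀ τ : K, Ψ (-(e β') * (e τ - τ)) = Ψ (τ * (e β' - β')) := by
      intro τ
      have : -(e β') * (e τ - τ) = -(e (β' * τ)) + e β' * τ := by
        rw [map_mul]
        ring
      rw [this, AddChar.map_add_eq_mul, ← map_neg, hinv, ← AddChar.map_add_eq_mul]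
      congr 1
      ring
    rw [Finset.sum_congr rfl fun τ _ => h1 τ, sum_addChar_mul hΨ1]
    simp only [sub_eq_zero, e.injective.eq_iff]
  refine mul_left_cancel₀ hcard ?_
  have h2 : ∀ τ : K, (Fintype.card K : ℂ) * f (e τ - τ) =
      ∑ z : K, f z * ∑ β : K, Ψ (β * (z - (e τ - τ))) := by
    intro τ
    rw [Finset.sum_eq_single (e τ - τ)]
    · simp
      ring
    · intro z _ hz
      rw [sum_addChar_mul hΨ1, if_neg (sub_ne_zero.2 hz), mul_zero]
    · simp
  rw [Finset.mul_sum, Finset.sum_congr rfl fun τ _ => h2 τ]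
  simp only [Finset.mul_sum]
  rw [Finset.sum_comm, Finset.sum_congr rfl fun z _ => Finset.sum_comm, Finset.sum_comm]
  refine Finset.sum_congr rfl fun β _ => ?_
  have h3 : ∀ z : K, ∑ τ : K, f z * Ψ (β * (z - (e τ - τ))) =
      f z * Ψ (β * z) * if e β = β then (Fintype.card K : ℂ) else 0 := by
    intro z
    rw [← hin, Finset.mul_sum]
    refine Finset.sum_congr rfl fun τ _ => ?_
    rw [mul_assoc, ← AddChar.map_add_eq_mul]
    congr 2
    ring
  rw [Finset.sum_congr rfl fun z _ => h3 z, ← Finset.sum_mul]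
  split_ifs <;> ring

theorem exists_algEquiv_pow [Fintype F] (a : ℕ) :
    ∃ e : K ≃ₐ[F] K, ∀ x, e x = x ^ Fintype.card F ^ a := by
  refine ⟨FiniteField.frobeniusAlgEquivOfAlgebraic F K ^ a, fun x => ?_⟩
  rw [AlgEquiv.coe_pow, FiniteField.coe_frobeniusAlgEquivOfAlgebraic_iterate]

/-- The sum of the traces of the fibres of the elliptic curve over all points of an extension. -/
theorem sum_ellTrace_fibres [Fintype F] [DecidableEq K] (hF : ringChar F ≠ 2) {ψ : AddChar F ℂ}
    (hψ : ψ ≠ 1) {γ : F} (hγ : γ ≠ 0) (a : ℕ) :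
    ∑ τ : K, (ellTrace K (algebraMap F K (16 * γ)) ((τ ^ Fintype.card F ^ a - τ) ^ 2) : ℂ) =
      -1 + ∑ β : K, if β ^ Fintype.card F ^ a = β ∧ β ≠ 0 then (Fintype.card K : ℂ) -
        kloostermanSum (ψ.compAddMonoidHom (Algebra.trace F K).toAddMonoidHom)
          (algebraMap F K γ * β ^ 2) ^ 2 else 0 := by
  have hK : ringChar K ≠ 2 := by rwa [← Algebra.ringChar_eq F K]
  obtain ⟨e, he⟩ := exists_algEquiv_pow (F := F) (K := K) a
  have hγ' : algebraMap F K γ ≠ 0 := (_root_.map_ne_zero _).2 hγ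
  have h16 : algebraMap F K (16 * γ) = 16 * algebraMap F K γ := by
    rw [map_mul, map_ofNat]
  have h160 : (16 : K) * algebraMap F K γ ≠ 0 := by
    have : (16 : K) = 2 * 2 * 2 * 2 := by norm_num
    have h2 := Ring.two_ne_zero hK
    rw [this]
    exact mul_ne_zero (mul_ne_zero (mul_ne_zero (mul_ne_zero h2 h2) h2) h2) hγ'
  have h := sum_algEquiv_sub hψ e
    fun z : K => (ellTrace K (algebraMap F K (16 * γ)) (z ^ 2) : ℂ)
  simp only [he] at h
  rw [h]
  rw [← Finset.sum_erase_add _ _ (Finset.mem_univ (0 : K)), add_comm]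
  congr 1
  · have hq : Fintype.card F ^ a ≠ 0 := pow_ne_zero _ Fintype.card_ne_zero
    rw [zero_pow hq, if_pos rfl, h16]
    simp only [zero_mul, AddChar.map_zero_eq_one, mul_one]
    rw [← Int.cast_sum, sum_ellTrace_sq hK h160]
    simp
  · rw [← Finset.sum_erase_add Finset.univ (fun β : K => if β ^ Fintype.card F ^ a = β ∧ β ≠ 0 then
      (Fintype.card K : ℂ) - kloostermanSum
        (ψ.compAddMonoidHom (Algebra.trace F K).toAddMonoidHom)
          (algebraMap F K γ * β ^ 2) ^ 2 else 0) (Finset.mem_univ (0 : K)),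
      if_neg (fun h => h.2 rfl), add_zero]
    refine Finset.sum_congr rfl fun β hβ => ?_
    have hβ0 := Finset.ne_of_mem_erase hβ
    simp only [hβ0, ne_eq, not_false_eq_true, and_true]
    rw [h16, sum_ellTrace_mul_addChar hK (compAddMonoidHom_trace_ne_one hψ K) hβ0 hγ']

end Fibres

/-! ### Functions on the curve `x + b/x = y^q - y`. -/

section CurveAlgebra

open QuadraticAlgebra

variable (k : Type*) [Field k] [Fintype k]

/-- The polynomial `y ^ q - y`. -/
def frobSub : k[X] := X ^ Fintype.card k - X

variable {k}

theorem frobSub_monic : (frobSub k).Monic :=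
  monic_X_pow_sub (by rw [degree_X]; exact Nat.one_lt_cast.2 Fintype.one_lt_card)

theorem natDegree_frobSub : (frobSub k).natDegree = Fintype.card k :=
  FiniteField.X_pow_card_sub_X_natDegree_eq k Fintype.one_lt_card

/-- The ring of functions regular away from infinity on the curve `x + b / x = y ^ q - y`. -/
abbrev CurveRing (b : k) : Type _ := QuadraticAlgebra k[X] (-C b) (frobSub k)

/-- The monomial `x ^ i * y ^ j`. -/
def monom (b : k) (i j : ℕ) : CurveRing b := ω ^ i * algebraMap k[X] _ (X ^ j)

variable {b : k}

theorem omega_mul_omega_curve : (ω : CurveRing b) * ω =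
    algebraMap k[X] _ (frobSub k) * ω - algebraMap k[X] _ (C b) := by
  ext <;> simp

theorem re_omega_pow_succ (n : ℕ) :
    ((ω : CurveRing b) ^ (n + 1)).re = -C b * ((ω : CurveRing b) ^ n).im := by
  rw [pow_succ]
  simp

theorem im_omega_pow_succ_succ (n : ℕ) : ((ω : CurveRing b) ^ (n + 2)).im =
    frobSub k * ((ω : CurveRing b) ^ (n + 1)).im - C b * ((ω : CurveRing b) ^ n).im := by
  rw [pow_succ (n := n + 1)]
  simp only [im_mul, omega_re, omega_im, re_omega_pow_succ]
  ring

/-- In the linear recursion for the coefficient of `ω`, the term multiplied by `y^q - y` dominates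
the one multiplied by `b`. -/
theorem im_omega_pow (n : ℕ) : ((ω : CurveRing b) ^ (n + 1)).im.Monic ∧
    ((ω : CurveRing b) ^ (n + 1)).im.natDegree = Fintype.card k * n := by
  induction n using Nat.strong_induction_on with
  | _ n ih =>
    rcases n with _ | _ | n
    · simp
    · rw [im_omega_pow_succ_succ]
      simp [frobSub_monic, natDegree_frobSub]
    · obtain ⟨h1, h2⟩ := ih (n + 1) (by omega)
      obtain ⟨h3, h4⟩ := ih n (by omega)
      rw [im_omega_pow_succ_succ]
      have hm := frobSub_monic.mul h1
      have hd : (frobSub k * ((ω : CurveRing b) ^ (n + 1 + 1)).im).natDegree =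
          Fintype.card k * (n + 1 + 1) := by
        rw [frobSub_monic.natDegree_mul h1, natDegree_frobSub, h2]
        ring
      have hlt : (C b * ((ω : CurveRing b) ^ (n + 1)).im).degree <
          (frobSub k * ((ω : CurveRing b) ^ (n + 1 + 1)).im).degree := by
        refine degree_lt_degree ((natDegree_C_mul_le _ _).trans_lt ?_)
        rw [h4, hd]
        exact Nat.mul_lt_mul_of_pos_left (by omega) Fintype.card_pos
      refine ⟨hm.sub_of_left hlt, ?_⟩
      rw [← hd]
      exact natDegree_eq_of_degree_eq (degree_sub_eq_left_of_degree_lt hlt)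

theorem natDegree_im_omega_pow_le (n : ℕ) :
    ((ω : CurveRing b) ^ n).im.natDegree ≤ Fintype.card k * (n - 1) := by
  rcases n with _ | n
  · simp
  · exact (im_omega_pow n).2.le

theorem natDegree_re_omega_pow_le (n : ℕ) :
    ((ω : CurveRing b) ^ n).re.natDegree ≤ Fintype.card k * n := by
  rcases n with _ | n
  · simp
  · have h : Fintype.card k * (n - 1) ≤ Fintype.card k * (n + 1) :=
      Nat.mul_le_mul_left _ (by omega)
    rw [re_omega_pow_succ, neg_mul, natDegree_neg]
    exact (natDegree_C_mul_le _ _).trans ((natDegree_im_omega_pow_le n).trans h)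

theorem natDegree_re_star_omega_pow_le (n : ℕ) :
    (star ((ω : CurveRing b) ^ n)).re.natDegree ≤ Fintype.card k * n := by
  rw [re_star]
  refine natDegree_add_le_of_degree_le (natDegree_re_omega_pow_le n) ?_
  rcases n with _ | n
  · simp
  · refine natDegree_mul_le.trans ?_
    rw [natDegree_frobSub, (im_omega_pow n).2]
    exact le_of_eq (by ring)

theorem star_algebraMap_curve (r : k[X]) :
    star (algebraMap k[X] (CurveRing b) r) = algebraMap k[X] (CurveRing b) r := by
  ext <;> simp

theorem omega_mul_star_omega :
    (ω : CurveRing b) * star ω = algebraMap k[X] (CurveRing b) (C b) := by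
  ext <;> simp

theorem re_algebraMap_mul (r : k[X]) (z : CurveRing b) :
    (algebraMap k[X] (CurveRing b) r * z).re = r * z.re := by
  simp

theorem im_algebraMap_mul (r : k[X]) (z : CurveRing b) :
    (algebraMap k[X] (CurveRing b) r * z).im = r * z.im := by
  simp

/-- Since `ω * star ω = b`, the product reduces to a constant times `y ^ (j + j')` times a single
power of `ω` or of `star ω`. The conditions `j ≤ q i` express regularity at the point at infinity
where `x` vanishes, so only the weight `q i + j`, the pole order at the other point, enters the
bound. -/
theorem natDegree_re_monom_mul_star {i j i' j' D : ℕ} (h1 : j ≤ Fintype.card k * i)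
    (h1' : j' ≤ Fintype.card k * i') (h2 : Fintype.card k * i + j ≤ D)
    (h2' : Fintype.card k * i' + j' ≤ D) :
    (monom b i j * star (monom b i' j')).re.natDegree ≤ D := by
  have hpow : ∀ (c : k) (n : ℕ), (C c ^ n * X ^ (j + j') : k[X]).natDegree ≤ j + j' := by
    intro c n
    rw [← Polynomial.C_pow]
    exact natDegree_C_mul_X_pow_le _ _
  have key : monom b i j * star (monom b i' j') =
      algebraMap k[X] _ (X ^ (j + j')) * ((ω : CurveRing b) ^ i * star (ω ^ i')) := by
    rw [monom, monom, star_mul, star_algebraMap_curve, pow_add, map_mul]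
    ring
  rcases le_total i' i with h | h
  · obtain ⟨d, rfl⟩ := Nat.exists_eq_add_of_le h
    have : monom b (i' + d) j * star (monom b i' j') =
        algebraMap k[X] _ (C b ^ i' * X ^ (j + j')) * (ω : CurveRing b) ^ d := by
      have e : (ω : CurveRing b) ^ (i' + d) * star (ω ^ i') =
          algebraMap k[X] _ (C b ^ i') * ω ^ d := by
        rw [map_pow, ← omega_mul_star_omega, star_pow, mul_pow, pow_add]
        ring
      rw [key, e, map_mul]
      ring
    rw [this, re_algebraMap_mul]
    refine natDegree_mul_le.trans ((add_le_add (hpow b i') (natDegree_re_omega_pow_le d)).trans ?_)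
    rw [mul_add] at h2
    omega
  · obtain ⟨d, rfl⟩ := Nat.exists_eq_add_of_le h
    have : monom b i j * star (monom b (i + d) j') =
        algebraMap k[X] _ (C b ^ i * X ^ (j + j')) * star ((ω : CurveRing b) ^ d) := by
      have e : (ω : CurveRing b) ^ i * star (ω ^ (i + d)) =
          algebraMap k[X] _ (C b ^ i) * star (ω ^ d) := by
        rw [map_pow, ← omega_mul_star_omega, star_pow, star_pow, mul_pow, pow_add]
        ring
      rw [key, e, map_mul]
      ring
    rw [this, re_algebraMap_mul]
    refine natDegree_mul_le.trans
      ((add_le_add (hpow b i) (natDegree_re_star_omega_pow_le d)).trans ?_)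
    rw [mul_add] at h2'
    omega

/-- The norm of a combination of monomials with zeros at the point `x = 0` over infinity has
degree at most the pole order at the other point at infinity. -/
theorem natDegree_norm_sum_le {ι : Type*} (s : Finset ι) (c : ι → k) (I J : ι → ℕ) {D : ℕ}
    (h1 : ∀ i ∈ s, J i ≤ Fintype.card k * I i) (h2 : ∀ i ∈ s, Fintype.card k * I i + J i ≤ D) :
    (norm (∑ i ∈ s, algebraMap k[X] (CurveRing b) (C (c i)) * monom b (I i) (J i))).natDegree
      ≤ D := by
  set g := ∑ i ∈ s, algebraMap k[X] (CurveRing b) (C (c i)) * monom b (I i) (J i) with hg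
  have h : norm g = (g * star g).re := by
    rw [← algebraMap_norm_eq_mul_star, algebraMap_re]
  have hre : ∀ (t : Finset (ι × ι)) (f : ι × ι → CurveRing b),
      (∑ p ∈ t, f p).re = ∑ p ∈ t, (f p).re := fun t f =>
    map_sum (QuadraticAlgebra.reₗ (R := k[X]) (-C b) (frobSub k)) f t
  rw [h, hg, star_sum, Finset.sum_mul_sum, ← Finset.sum_product', hre]
  refine natDegree_sum_le_of_forall_le _ _ fun p hp => ?_
  rw [Finset.mem_product] at hp
  have e : algebraMap k[X] (CurveRing b) (C (c p.1)) * monom b (I p.1) (J p.1) *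
      star (algebraMap k[X] (CurveRing b) (C (c p.2)) * monom b (I p.2) (J p.2)) =
      algebraMap k[X] (CurveRing b) (C (c p.1 * c p.2)) *
        (monom b (I p.1) (J p.1) * star (monom b (I p.2) (J p.2))) := by
    rw [star_mul, star_algebraMap_curve, Polynomial.C_mul, map_mul]
    ring
  rw [e, re_algebraMap_mul]
  exact (natDegree_C_mul_le _ _).trans (natDegree_re_monom_mul_star (h1 _ hp.1) (h1 _ hp.2)
    (h2 _ hp.1) (h2 _ hp.2))

/-- The coefficient of `ω` in `x ^ i * y ^ j`, for `i ≥ 1`, has degree `j + q (i - 1)`. Distinct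
weights give distinct degrees, so no cancellation of the leading term is possible. -/
theorem sum_monom_ne_zero {ι : Type*} (s : Finset ι) (c : ι → k) (I J : ι → ℕ)
    (hI : ∀ i ∈ s, 1 ≤ I i) (hinj : Set.InjOn (fun i => Fintype.card k * I i + J i) s)
    (hc : ∃ i ∈ s, c i ≠ 0) :
    ∑ i ∈ s, algebraMap k[X] (CurveRing b) (C (c i)) * monom b (I i) (J i) ≠ 0 := by
  classical
  intro h
  have him : (∑ i ∈ s, algebraMap k[X] (CurveRing b) (C (c i)) * monom b (I i) (J i)).im =
      ∑ i ∈ s, C (c i) * (X ^ J i * ((ω : CurveRing b) ^ I i).im) := by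
    rw [← QuadraticAlgebra.imₗ_apply, map_sum]
    refine Finset.sum_congr rfl fun i _ => ?_
    rw [imₗ_apply, im_algebraMap_mul, monom, mul_comm (ω ^ I i), im_algebraMap_mul]
  rw [h] at him
  have hdeg : ∀ i ∈ s, c i ≠ 0 → (C (c i) * (X ^ J i * ((ω : CurveRing b) ^ I i).im)).degree =
      ((J i + Fintype.card k * (I i - 1) : ℕ) : WithBot ℕ) := by
    intro i hi hci
    obtain ⟨n, hn⟩ : ∃ n, I i = n + 1 := ⟨I i - 1, by have := hI i hi; omega⟩
    have hm := (im_omega_pow (b := b) n).1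
    rw [degree_C_mul hci, hn, degree_eq_natDegree ((monic_X_pow (J i)).mul hm).ne_zero,
      (monic_X_pow (J i)).natDegree_mul hm, natDegree_X_pow, (im_omega_pow n).2,
      Nat.add_sub_cancel]
  have hsum := degree_sum_eq_of_disjoint
    (fun i => C (c i) * (X ^ J i * ((ω : CurveRing b) ^ I i).im)) s (by
      rintro i ⟨hi, hi0⟩ j ⟨hj, hj0⟩ hij
      have hci : c i ≠ 0 := fun h => hi0 (by simp [h])
      have hcj : c j ≠ 0 := fun h => hj0 (by simp [h])
      simp only [Function.onFun, Function.comp]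
      rw [hdeg i hi hci, hdeg j hj hcj]
      intro he
      refine hij (hinj hi hj ?_)
      have he' := Nat.cast_injective he
      obtain ⟨n, hn⟩ : ∃ n, I i = n + 1 := ⟨I i - 1, by have := hI i hi; omega⟩
      obtain ⟨m, hm⟩ : ∃ n, I j = n + 1 := ⟨I j - 1, by have := hI j hj; omega⟩
      rw [hn, hm, Nat.add_sub_cancel, Nat.add_sub_cancel] at he'
      show Fintype.card k * I i + J i = Fintype.card k * I j + J j
      rw [hn, hm, mul_add, mul_add]
      omega)
  obtain ⟨i, hi, hci⟩ := hc
  rw [← him, im_zero, degree_zero] at hsum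
  have := Finset.le_sup (f := fun i => (C (c i) * (X ^ J i * ((ω : CurveRing b) ^ I i).im)).degree)
    hi
  rw [← hsum, hdeg i hi hci] at this
  exact WithBot.natCast_ne_bot _ (le_bot_iff.1 this)

/-- A nonzero element of norm zero would make the discriminant `(y^q - y)² - 4b` a square `S²` in
`k[y]`. Then `y^q - y - S` and `y^q - y + S` would multiply to a nonzero constant, hence both be
constant, and so would their sum `2 (y^q - y)`. -/
theorem curve_norm_ne_zero (hk : ringChar k ≠ 2) (hb : b ≠ 0) {g : CurveRing b} (hg : g ≠ 0) :
    norm g ≠ 0 := by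
  intro h
  rw [norm_def] at h
  have h2 : (2 : k) ≠ 0 := Ring.two_ne_zero hk
  by_cases him : g.im = 0
  · rw [him] at h
    have hre : g.re = 0 := by simpa using h
    exact hg (QuadraticAlgebra.ext hre him)
  have hsq : (2 * g.re + frobSub k * g.im) ^ 2 = g.im ^ 2 * (frobSub k ^ 2 - C (4 * b)) := by
    have : (C (4 * b) : k[X]) = 4 * C b := by rw [Polynomial.C_mul]; rfl
    rw [this]
    linear_combination 4 * h
  have hdvd : g.im ∣ 2 * g.re + frobSub k * g.im :=
    (IsIntegrallyClosed.pow_dvd_pow_iff two_ne_zero).1 ⟨_, hsq⟩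
  obtain ⟨S, hS⟩ := hdvd
  rw [hS, mul_pow] at hsq
  have hS2 := mul_left_cancel₀ (pow_ne_zero 2 him) hsq
  have hprod : (frobSub k - S) * (frobSub k + S) = C (4 * b) := by linear_combination -hS2
  have h4 : (4 * b : k) ≠ 0 := by
    have : (4 : k) = 2 * 2 := by norm_num
    rw [this]
    exact mul_ne_zero (mul_ne_zero h2 h2) hb
  have hu : IsUnit ((frobSub k - S) * (frobSub k + S)) := by
    rw [hprod]
    exact isUnit_C.2 (isUnit_iff_ne_zero.2 h4)
  have hd1 := natDegree_eq_zero_of_isUnit (isUnit_of_mul_isUnit_left hu)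
  have hd2 := natDegree_eq_zero_of_isUnit (isUnit_of_mul_isUnit_right hu)
  have h3 : (C 2 * frobSub k).natDegree = 0 := by
    have : C 2 * frobSub k = (frobSub k - S) + (frobSub k + S) := by
      have : (C 2 : k[X]) = 2 := rfl
      rw [this]
      ring
    rw [this]
    refine Nat.le_zero.1 ((natDegree_add_le _ _).trans ?_)
    rw [hd1, hd2]
    exact le_of_eq (max_self 0)
  rw [natDegree_C_mul h2, natDegree_frobSub] at h3
  exact Fintype.card_ne_zero h3

section Eval

variable {Ω : Type*} [Field Ω] [Algebra k Ω]

/-- Evaluation of a function at a point of the curve `x + b / x = y ^ q - y`. -/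
def curveEval (x y : Ω) (h : x * x = aeval y (frobSub k) * x - algebraMap k Ω b) :
    CurveRing b →+* Ω where
  toFun z := aeval y z.re + aeval y z.im * x
  map_one' := by simp
  map_zero' := by simp
  map_add' z w := by
    simp only [re_add, im_add, map_add]
    ring
  map_mul' z w := by
    simp only [re_mul, im_mul, map_add, map_mul, map_neg, aeval_C]
    linear_combination (-(aeval y z.im * aeval y w.im)) * h

theorem curveEval_monom (x y : Ω) (h : x * x = aeval y (frobSub k) * x - algebraMap k Ω b)
    (i j : ℕ) : curveEval x y h (monom b i j) = x ^ i * y ^ j := by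
  rw [monom, map_mul, map_pow]
  congr 2
  · simp [curveEval]
  · simp [curveEval, -map_pow]
    simp

theorem curveEval_algebraMap_C (x y : Ω)
    (h : x * x = aeval y (frobSub k) * x - algebraMap k Ω b) (c : k) :
    curveEval x y h (algebraMap k[X] _ (C c)) = algebraMap k Ω c := by
  simp [curveEval]

/-- A function with nonzero norm has at most as many zeros as the degree of its norm. -/
theorem card_zeros_le {g : CurveRing b} (hg : norm g ≠ 0) (Z : Finset (Ω × Ω))
    (hZ : ∀ p ∈ Z, p.1 * p.1 = aeval p.2 (frobSub k) * p.1 - algebraMap k Ω b ∧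
      aeval p.2 g.re + aeval p.2 g.im * p.1 = 0) : Z.card ≤ (norm g).natDegree := by
  classical
  set N := (norm g).map (algebraMap k Ω) with hN
  have hN0 : N ≠ 0 := (Polynomial.map_ne_zero_iff (algebraMap k Ω).injective).2 hg
  have hfib : ∀ y ∈ Z.image Prod.snd,
      (Z.filter fun p => p.2 = y).card ≤ N.roots.count y := by
    intro y hy
    obtain ⟨p, hp, rfl⟩ := Finset.mem_image.1 hy
    rw [count_roots]
    set y := p.2
    have hroot : N.IsRoot y := by
      obtain ⟨h1, h2⟩ := hZ p hp
      rw [IsRoot, hN, eval_map_algebraMap, norm_def]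
      simp only [map_add, map_sub, map_mul, map_neg, aeval_C]
      linear_combination (aeval p.2 g.re + aeval p.2 (frobSub k) * aeval p.2 g.im -
        aeval p.2 g.im * p.1) * h2 + (aeval p.2 g.im) ^ 2 * h1
    -- The points over a given `y` are at most two, being roots of a quadratic in `x`. One zero
    -- forces a root of the norm; two force both components of `g` to vanish at `y`, and hence a
    -- double root of the norm.
    by_cases hone : (Z.filter fun p => p.2 = y).card ≤ 1
    · exact hone.trans ((rootMultiplicity_pos hN0).2 hroot)
    · have hle2 : (Z.filter fun p => p.2 = y).card ≤ 2 := by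
        have hsub : (Z.filter fun p => p.2 = y).card ≤
            (X ^ 2 - C (aeval y (frobSub k)) * X + C (algebraMap k Ω b)).roots.toFinset.card := by
          refine Finset.card_le_card_of_injOn Prod.fst (fun r hr => ?_) fun r hr t ht h => ?_
          · simp only [Finset.coe_filter, Set.mem_ofPred_eq] at hr
            have := (hZ r hr.1).1
            rw [hr.2] at this
            simp only [Finset.mem_coe, Multiset.mem_toFinset]
            rw [mem_roots', IsRoot]
            refine ⟨?_, ?_⟩
            · refine Monic.ne_zero (R := Ω) ?_
              monicity!
            · simp
              linear_combination this
          · simp only [Finset.coe_filter, Set.mem_ofPred_eq] at hr ht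
            exact Prod.ext h (hr.2.trans ht.2.symm)
        refine hsub.trans ((Multiset.toFinset_card_le _).trans ((card_roots' _).trans ?_))
        compute_degree
      refine hle2.trans ((le_rootMultiplicity_iff hN0).2 ?_)
      obtain ⟨r, hr, t, ht, hrt⟩ := Finset.one_lt_card.1 (not_le.1 hone)
      rw [Finset.mem_filter] at hr ht
      obtain ⟨-, hr2⟩ := hZ r hr.1
      obtain ⟨-, ht2⟩ := hZ t ht.1
      rw [hr.2] at hr2
      rw [ht.2] at ht2
      have hne : r.1 - t.1 ≠ 0 := fun h => hrt (Prod.ext (sub_eq_zero.1 h) (hr.2.trans ht.2.symm))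
      have him : aeval y g.im = 0 := by
        refine (mul_eq_zero.1 ?_).resolve_right hne
        linear_combination hr2 - ht2
      have hre : aeval y g.re = 0 := by
        rw [him] at hr2
        simpa using hr2
      rw [← eval_map_algebraMap, ← IsRoot, ← dvd_iff_isRoot] at him hre
      obtain ⟨u, hu⟩ := him
      obtain ⟨w, hw⟩ := hre
      rw [hN, norm_def]
      simp only [Polynomial.map_add, Polynomial.map_sub, Polynomial.map_mul, hu, hw]
      exact ⟨w * w + (frobSub k).map (algebraMap k Ω) * w * u -
        (-C b : k[X]).map (algebraMap k Ω) * u * u, by ring⟩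
  calc Z.card = ∑ y ∈ Z.image Prod.snd, (Z.filter fun p => p.2 = y).card :=
        Finset.card_eq_sum_card_image _ _
    _ ≤ ∑ y ∈ Z.image Prod.snd, N.roots.count y := Finset.sum_le_sum hfib
    _ ≤ Multiset.card N.roots := by
        rw [← Multiset.toFinset_sum_count_eq]
        refine Finset.sum_le_sum_of_ne_zero fun y _ hy => ?_
        exact Multiset.mem_toFinset.2 (Multiset.count_ne_zero.1 hy)
    _ ≤ N.natDegree := card_roots' _
    _ = (norm g).natDegree := natDegree_map _

end Eval

theorem algebraMap_C_mul_eq_smul (c : k) (z : CurveRing b) :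
    algebraMap k[X] (CurveRing b) (C c) * z = c • z := by
  ext <;> simp [smul_eq_C_mul]

/-- The span of the monomials `x ^ i * y ^ j` with `j < q` and weight at most `W`. -/
def monomSpan (b : k) (W : ℕ) : Submodule k (CurveRing b) :=
  Submodule.span k (Set.range fun n : Fin (W + 1) =>
    monom b (n / Fintype.card k) (n % Fintype.card k))

/-- The relation `y^q = y + x + b/x` lowers the exponent of `y` without raising the weight `q i +
j`. The strict inequality `j < q i`, vanishing at the point at infinity where `x = 0`, is what keeps
negative powers of `x` from appearing. -/
theorem monom_mem_monomSpan {W : ℕ} (j : ℕ) : ∀ i : ℕ, 1 ≤ i → j < Fintype.card k * i →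
    Fintype.card k * i + j ≤ W → monom b i j ∈ monomSpan b W := by
  have hq : 1 < Fintype.card k := Fintype.one_lt_card
  induction j using Nat.strong_induction_on with
  | _ j ih =>
    intro i hi hji hW
    by_cases hj : j < Fintype.card k
    · refine Submodule.subset_span ?_
      refine ⟨⟨Fintype.card k * i + j, by omega⟩, ?_⟩
      dsimp only
      rw [Nat.mul_add_div (by omega), Nat.mul_add_mod, Nat.div_eq_of_lt hj, Nat.mod_eq_of_lt hj,
        add_zero]
    · obtain ⟨l, rfl⟩ := Nat.exists_eq_add_of_le (not_lt.1 hj)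
      obtain ⟨i, rfl⟩ : ∃ i', i = i' + 1 := ⟨i - 1, by omega⟩
      have hi1 : 1 ≤ i := by
        by_contra h
        have : i = 0 := by omega
        subst this
        omega
      have e : monom b (i + 1) (Fintype.card k + l) =
          monom b (i + 1) (l + 1) + monom b (i + 2) l + b • monom b i l := by
        have hb : b • monom b i l = algebraMap k[X] (CurveRing b) (C b) * monom b i l := by
          rw [algebraMap_C_mul_eq_smul]
        have hω : (ω : CurveRing b) * ω = (algebraMap k[X] (CurveRing b) X ^ Fintype.card k -
            algebraMap k[X] (CurveRing b) X) * ω - algebraMap k[X] (CurveRing b) (C b) := by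
          rw [omega_mul_omega_curve, ← map_pow, ← map_sub]
          rfl
        rw [hb, monom, monom, monom, monom]
        simp only [map_pow]
        linear_combination (-(ω : CurveRing b) ^ i * algebraMap k[X] (CurveRing b) X ^ l) * hω
      rw [e]
      have m1 : Fintype.card k * (i + 1) = Fintype.card k * i + Fintype.card k := by ring
      have m2 : Fintype.card k * (i + 2) = Fintype.card k * i + 2 * Fintype.card k := by ring
      refine Submodule.add_mem _ (Submodule.add_mem _ ?_ ?_) (Submodule.smul_mem _ _ ?_)
      · exact ih (l + 1) (by omega) _ (by omega) (by omega) (by omega)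
      · exact ih l (by omega) _ (by omega) (by omega) (by omega)
      · exact ih l (by omega) _ hi1 (by omega) (by omega)

theorem finrank_monomSpan_le (W : ℕ) : Module.finrank k (monomSpan b W) ≤ W + 1 := by
  refine (finrank_range_le_card _).trans ?_
  rw [Fintype.card_fin]

end CurveAlgebra

/-! ### Stepanov's auxiliary function. -/

section Stepanov

open QuadraticAlgebra

variable {k : Type*} [Field k] [Fintype k] {b : k}

instance (W : ℕ) : Module.Finite k (monomSpan b W) :=
  Module.Finite.span_of_finite k (Set.finite_range _)

theorem monom_mul_algebraMap_mem {W i l : ℕ} (j : ℕ) (c : k) (hi : 1 ≤ i)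
    (hj : j + l < Fintype.card k * i) (hW : Fintype.card k * i + (j + l) ≤ W) :
    monom b i j * algebraMap k[X] _ ((X + C c) ^ l) ∈ monomSpan b W := by
  rw [add_pow, map_sum, Finset.mul_sum]
  refine Submodule.sum_mem _ fun n hn => ?_
  have hn' : n ≤ l := Nat.lt_succ_iff.1 (Finset.mem_range.1 hn)
  have : monom b i j * algebraMap k[X] (CurveRing b) (X ^ n * C c ^ (l - n) * (l.choose n : k[X])) =
      (c ^ (l - n) * (l.choose n : k)) • monom b i (j + n) := by
    rw [← algebraMap_C_mul_eq_smul, monom, monom, pow_add, ← Polynomial.C_eq_natCast,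
      Polynomial.C_mul, Polynomial.C_pow]
    simp only [map_mul]
    ring
  rw [this]
  exact Submodule.smul_mem _ _ (monom_mem_monomSpan _ _ hi (by omega) (by omega))

theorem exists_sum_smul_eq_zero_of_finrank_lt {k ι M : Type*} [Field k] [Fintype ι] [AddCommGroup M]
    [Module k M] (S : Submodule k M) [Module.Finite k S] (v : ι → M) (hv : ∀ i, v i ∈ S)
    (h : Module.finrank k S < Fintype.card ι) : ∃ c : ι → k, ∑ i, c i • v i = 0 ∧ ∃ i, c i ≠ 0 := by
  refine Fintype.not_linearIndependent_iff.1 fun hli => ?_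
  have : LinearIndependent k fun i => (⟨v i, hv i⟩ : S) :=
    LinearIndependent.of_comp S.subtype (by simpa [Function.comp_def] using hli)
  exact absurd this.fintype_card_le_finrank (not_le.2 h)

/-- With `σ = q ^ m`, a combination `g` of monomials `x^(i+1) φ(x)^(i'+1) y^j φ(y)^l`, where `φ` is
the `σ`-power map, is sought. At the points in question `φ²(x) = x` and `φ²(y) = y + c₀`, so `φ(g)`
takes the values of a function of smaller pole order, in a space of dimension at most `σ² + 4q`.
There are more monomials than that, so the coefficients can be chosen to make this function zero
while `g` itself is not. -/
theorem exists_auxiliary_function (hk : ringChar k ≠ 2) (hb : b ≠ 0) (c₀ : k) {m : ℕ}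
    (hm : 2 ≤ m) : ∃ g : CurveRing b, norm g ≠ 0 ∧
      (norm g).natDegree ≤ (Fintype.card k ^ m) ^ 2 + 4 * Fintype.card k * Fintype.card k ^ m ∧
      ∀ {Ω : Type*} [Field Ω] [Algebra k Ω] (x y : Ω)
        (h : x * x = aeval y (frobSub k) * x - algebraMap k Ω b),
        x ^ (Fintype.card k ^ m) ^ 2 = x → y ^ (Fintype.card k ^ m) ^ 2 = y + algebraMap k Ω c₀ →
        curveEval x y h g = 0 := by
  set q := Fintype.card k with hq
  obtain ⟨m, rfl⟩ : ∃ n, m = n + 1 := ⟨m - 1, by omega⟩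
  set s := q ^ m with hs
  have hσ : q ^ (m + 1) = q * s := pow_succ' _ _
  have hq3 : 3 ≤ q := by
    have h1 : 1 < q := Fintype.one_lt_card
    have h2 : q ≠ 2 := by
      intro h
      have := FiniteField.even_card_iff_char_two.2.mt hk
      omega
    omega
  have hsq : q ≤ s := Nat.le_self_pow (by omega) _
  set σ := q ^ (m + 1) with hσd
  -- Only `i < s - 1` is allowed, so that `q (i + 1) + j < σ`; the range `s + 3` for `i'` is large
  -- enough to win the dimension count.
  obtain ⟨a, ha⟩ : ∃ a, s = a + 1 := ⟨s - 1, by omega⟩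
  let ι := (Fin a × Fin q) × (Fin (s + 3) × Fin q)
  let I : ι → ℕ := fun t => (t.1.1 + 1) + (t.2.1 + 1) * σ
  let J : ι → ℕ := fun t => t.1.2 + t.2.2 * σ
  -- The `φ`-image of the monomial indexed by `t`, with `φ²(x)` and `φ²(y)` replaced by `x` and `y +
  -- c₀`.
  let v : ι → CurveRing b := fun t => monom b ((t.1.1 + 1) * σ + (t.2.1 + 1)) (t.1.2 * σ) *
    algebraMap k[X] _ ((X + C c₀) ^ (t.2.2 : ℕ))
  have hσpos : 0 < σ := by positivity
  have hσa : σ = q * a + q := by rw [hσ, ha, mul_add, mul_one]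
  have hv : ∀ t, v t ∈ monomSpan b (σ ^ 2 + 4 * q - 1) := by
    rintro ⟨⟨⟨i, hi⟩, ⟨j, hj⟩⟩, ⟨⟨i', hi'⟩, ⟨l, hl⟩⟩⟩
    have e1 : j * σ ≤ (q - 1) * σ := Nat.mul_le_mul_right _ (by omega)
    have e2 : q * ((i + 1) * σ + (i' + 1)) = q * (i + 1) * σ + q * (i' + 1) := by ring
    have e3 : q * (i + 1) ≤ q * a := Nat.mul_le_mul_left _ (by omega)
    have e4 : q * (i' + 1) ≤ q * (s + 3) := Nat.mul_le_mul_left _ (by omega)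
    have e5 : q * 1 ≤ q * (i' + 1) := Nat.mul_le_mul_left _ (by omega)
    have e6 : q * (i + 1) + j ≤ σ - 1 := by omega
    have e7 : (q * (i + 1) + j) * σ ≤ (σ - 1) * σ := Nat.mul_le_mul_right _ e6
    have e8 : q * 1 * σ ≤ q * (i + 1) * σ := Nat.mul_le_mul_right _ (Nat.mul_le_mul_left _ (by omega))
    have e9 : (σ - 1) * σ + σ = σ ^ 2 := by
      obtain ⟨τ, hτ⟩ : ∃ τ, σ = τ + 1 := ⟨σ - 1, by omega⟩
      rw [hτ, Nat.add_sub_cancel]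
      ring
    have e10 : (q * (i + 1) + j) * σ = q * (i + 1) * σ + j * σ := by ring
    have e11 : (q - 1) * σ + σ = q * σ := by
      obtain ⟨τ, hτ⟩ : ∃ τ, q = τ + 1 := ⟨q - 1, by omega⟩
      rw [hτ, Nat.add_sub_cancel]
      ring
    have e12 : q * (s + 3) = σ + 3 * q := by rw [hσ]; ring
    refine monom_mul_algebraMap_mem _ _ (by omega) ?_ ?_
    · rw [← hq, e2]
      dsimp only
      rw [mul_one] at e8 e5
      omega
    · rw [← hq, e2]
      dsimp only
      omega
  -- There are `(s - 1)(s + 3) q² = σ² + (2s - 3) q²` unknowns, which exceeds `σ² + 4q` because `s ≥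
  -- q ≥ 3`.
  have hcard : Module.finrank k (monomSpan b (σ ^ 2 + 4 * q - 1)) < Fintype.card ι := by
    refine (finrank_monomSpan_le _).trans_lt ?_
    have h1 : Fintype.card ι = (a * q) * ((s + 3) * q) := by simp [ι]
    have h2 : σ ^ 2 + 4 * q - 1 + 1 = σ ^ 2 + 4 * q := by omega
    rw [h1, h2, hσ, ha]
    rw [ha] at hsq
    obtain ⟨r, hr⟩ := Nat.exists_eq_add_of_le hsq
    nlinarith [mul_pos (show 0 < q by omega) (show 0 < q by omega), mul_le_mul hsq hq3,
      Nat.mul_le_mul_left q hsq, Nat.mul_le_mul_left (q * q) hsq]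
  obtain ⟨c, hc0, t₀, ht₀⟩ := exists_sum_smul_eq_zero_of_finrank_lt _ v hv hcard
  refine ⟨∑ t, algebraMap k[X] (CurveRing b) (C (c t)) * monom b (I t) (J t), ?_, ?_, ?_⟩
  · refine curve_norm_ne_zero hk hb (sum_monom_ne_zero _ _ _ _ ?_ ?_ ⟨t₀, Finset.mem_univ _, ht₀⟩)
    · intro t _
      show 1 ≤ ((t.1.1 : ℕ) + 1) + ((t.2.1 : ℕ) + 1) * σ
      omega
    · rintro ⟨⟨⟨i, hi⟩, ⟨j, hj⟩⟩, ⟨⟨i', hi'⟩, ⟨l, hl⟩⟩⟩ - ⟨⟨⟨u, hu⟩, ⟨w, hw⟩⟩, ⟨⟨u', hu'⟩, ⟨z, hz⟩⟩⟩ - h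
      simp only [I, J, ← hq] at h
      -- Remainder and quotient of the weight by `σ` recover `q (i + 1) + j` and `q (i' + 1) + l`,
      -- and division by `q` then recovers all four indices.
      have h1 : ∀ i j i' l : ℕ, q * (i + 1 + (i' + 1) * σ) + (j + l * σ) =
          (q * (i + 1) + j) + σ * (q * (i' + 1) + l) := fun i j i' l => by ring
      have h2 : ∀ i j, i < a → j < q → q * (i + 1) + j < σ := by
        intro i j hi hj
        have : q * (i + 1) ≤ q * a := Nat.mul_le_mul_left _ (by omega)
        omega
      rw [h1, h1] at h
      have h3 := congrArg (· % σ) h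
      have h4 := congrArg (· / σ) h
      simp only [Nat.add_mul_mod_self_left, Nat.mod_eq_of_lt (h2 _ _ hi hj),
        Nat.mod_eq_of_lt (h2 _ _ hu hw), Nat.add_mul_div_left _ _ hσpos,
        Nat.div_eq_of_lt (h2 _ _ hi hj), Nat.div_eq_of_lt (h2 _ _ hu hw), zero_add] at h3 h4
      have hdm : ∀ i j u w : ℕ, j < q → w < q → q * (i + 1) + j = q * (u + 1) + w →
          i = u ∧ j = w := by
        intro i j u w hj hw h
        have h5 := congrArg (· % q) h
        have h6 := congrArg (· / q) h
        simp only [Nat.mul_add_mod, Nat.mod_eq_of_lt hj, Nat.mod_eq_of_lt hw] at h5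
        simp only [Nat.mul_add_div (show 0 < q by omega), Nat.div_eq_of_lt hj,
          Nat.div_eq_of_lt hw] at h6
        omega
      obtain ⟨rfl, rfl⟩ := hdm _ _ _ _ hj hw h3
      obtain ⟨rfl, rfl⟩ := hdm _ _ _ _ hl hz h4
      rfl
  · refine natDegree_norm_sum_le _ _ _ _ ?_ ?_
    · rintro ⟨⟨⟨i, hi⟩, ⟨j, hj⟩⟩, ⟨⟨i', hi'⟩, ⟨l, hl⟩⟩⟩ -
      show j + l * σ ≤ q * (i + 1 + (i' + 1) * σ)
      have e1 : l * σ ≤ q * ((i' + 1) * σ) := by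
        rw [← mul_assoc]
        refine Nat.mul_le_mul_right _ ?_
        nlinarith
      have e2 : q * 1 ≤ q * (i + 1) := Nat.mul_le_mul_left _ (by omega)
      rw [mul_add]
      omega
    · rintro ⟨⟨⟨i, hi⟩, ⟨j, hj⟩⟩, ⟨⟨i', hi'⟩, ⟨l, hl⟩⟩⟩ -
      show q * (i + 1 + (i' + 1) * σ) + (j + l * σ) ≤ σ ^ 2 + 4 * q * σ
      have e1 : q * (i + 1) ≤ q * a := Nat.mul_le_mul_left _ (by omega)
      have e2 : q * (i + 1) + j ≤ σ := by
                omega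
      have e3 : (q * (i' + 1) + l + 1) * σ ≤ (σ + 4 * q) * σ := by
        refine Nat.mul_le_mul_right _ ?_
        have : q * (i' + 1) ≤ q * (s + 3) := Nat.mul_le_mul_left _ (by omega)
        have e12 : q * (s + 3) = σ + 3 * q := by rw [hσ]; ring
        omega
      nlinarith
  · intro Ω _ _ x y h hx hy
    have hφ : ∀ z : Ω, (FiniteField.frobeniusAlgHom k Ω ^ (m + 1)) z = z ^ σ := fun z => by
      rw [AlgHom.coe_pow, FiniteField.coe_frobeniusAlgHom, pow_iterate]
    set φ := FiniteField.frobeniusAlgHom k Ω ^ (m + 1)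
    have hx' : φ (φ x) = x := by rw [hφ, hφ, ← pow_mul, ← sq, hx]
    have hy' : φ (φ y) = y + algebraMap k Ω c₀ := by rw [hφ, hφ, ← pow_mul, ← sq, hy]
    have hp : ∀ (z : Ω) (n : ℕ), z ^ (n * σ) = φ z ^ n := fun z n => by
      rw [hφ, ← pow_mul, mul_comm]
    -- The coefficients lie in `k` and are fixed by `φ`, so `φ` acts on monomials only.
    have h1 : φ (curveEval x y h (∑ t, algebraMap k[X] (CurveRing b) (C (c t)) *
        monom b (I t) (J t))) = curveEval x y h (∑ t, c t • v t) := by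
      rw [map_sum, map_sum, map_sum]
      refine Finset.sum_congr rfl fun t _ => ?_
      have e : curveEval x y h (algebraMap k[X] (CurveRing b) ((X + C c₀) ^ (t.2.2 : ℕ))) =
          (y + algebraMap k Ω c₀) ^ (t.2.2 : ℕ) := by
        rw [map_pow, map_pow]
        simp [curveEval]
      rw [← algebraMap_C_mul_eq_smul, map_mul, map_mul, map_mul, curveEval_algebraMap_C,
        AlgHom.commutes, curveEval_monom, map_mul]
      congr 1
      simp only [I, J, v]
      rw [map_mul, e, curveEval_monom]
      simp only [pow_add, hp, map_mul, map_pow, hx', hy', pow_one]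
      ring
    rw [hc0, map_zero] at h1
    exact (map_eq_zero_iff φ φ.injective).1 h1

end Stepanov

/-! ### Counting elements of given trace. -/

section StepanovBound

variable {k : Type*} [Field k] [Fintype k] {b : k}

theorem exists_pow_card_sub_eq {Ω : Type*} [Field Ω] [IsAlgClosed Ω] (r : Ω) :
    ∃ y : Ω, y ^ Fintype.card k - y = r := by
  have hq : 1 < Fintype.card k := Fintype.one_lt_card
  have hd : (X ^ Fintype.card k - X - C r : Polynomial Ω).natDegree = Fintype.card k := by
    rw [sub_sub]
    refine (natDegree_sub_eq_left_of_natDegree_lt ?_).trans (natDegree_X_pow _)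
    rw [natDegree_X_add_C, natDegree_X_pow]
    exact hq
  obtain ⟨y, hy⟩ := IsAlgClosed.exists_root (X ^ Fintype.card k - X - C r : Polynomial Ω)
    (degree_ne_of_natDegree_ne (n := 0) (by rw [hd]; omega))
  refine ⟨y, ?_⟩
  simpa [IsRoot, sub_eq_zero] using hy

theorem sum_range_pow_card_sub {Ω : Type*} [Field Ω] [Algebra k Ω] (y : Ω) (n : ℕ) :
    ∑ i ∈ Finset.range n, (y ^ Fintype.card k - y) ^ Fintype.card k ^ i =
      y ^ Fintype.card k ^ n - y := by
  have hφ : ∀ i (z : Ω), (FiniteField.frobeniusAlgHom k Ω ^ i) z = z ^ Fintype.card k ^ i :=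
    fun i z => by rw [AlgHom.coe_pow, FiniteField.coe_frobeniusAlgHom, pow_iterate]
  have h : ∀ i, (y ^ Fintype.card k - y) ^ Fintype.card k ^ i =
      y ^ Fintype.card k ^ (i + 1) - y ^ Fintype.card k ^ i := fun i => by
    rw [← hφ, map_sub, map_pow, hφ, ← pow_mul, pow_succ]
  rw [Finset.sum_congr rfl fun i _ => h i, Finset.sum_range_sub fun i => y ^ Fintype.card k ^ i,
    pow_zero, pow_one]

open Classical in
/-- Stepanov's bound for the number of points with given trace on `x + b / x = y ^ q - y`. -/
theorem card_trace_eq_le (hk : ringChar k ≠ 2) (hb : b ≠ 0) (c₀ : k) {m : ℕ} (hm : 2 ≤ m)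
    (K : Type*) [Field K] [Fintype K] [Algebra k K] (hK : Module.finrank k K = 2 * m) :
    Fintype.card k * (Finset.univ.filter fun x : K => x ≠ 0 ∧
        Algebra.trace k K (x + algebraMap k K b / x) = c₀).card ≤
      (Fintype.card k ^ m) ^ 2 + 4 * Fintype.card k * Fintype.card k ^ m := by
  obtain ⟨g, hg0, hgd, hg⟩ := exists_auxiliary_function hk hb c₀ hm
  set q := Fintype.card k with hq
  let Ω := AlgebraicClosure K
  -- Each `x` is lifted to `q` points of the curve over an algebraic closure: the solutions of `y^q
  -- - y = x + b/x` are the translates of one of them by `k`. Telescoping gives `y ^ (q ^ (2m)) - y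
  -- = Tr(x + b/x) = c₀`.
  choose y hy using fun x : K => exists_pow_card_sub_eq (k := k) (Ω := Ω)
    (algebraMap K Ω (x + algebraMap k K b / x))
  set S := Finset.univ.filter fun x : K => x ≠ 0 ∧
    Algebra.trace k K (x + algebraMap k K b / x) = c₀ with hS
  set Z : Finset (Ω × Ω) := (S ×ˢ (Finset.univ : Finset k)).image fun p =>
    (algebraMap K Ω p.1, y p.1 + algebraMap k Ω p.2) with hZ
  have hZc : Z.card = q * S.card := by
    rw [hZ, Finset.card_image_of_injective, Finset.card_product, Finset.card_univ, mul_comm]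
    rintro ⟨x, c⟩ ⟨x', c'⟩ h
    simp only [Prod.mk.injEq] at h
    obtain rfl := (algebraMap K Ω).injective h.1
    obtain rfl := (algebraMap k Ω).injective (add_left_cancel h.2)
    rfl
  have hcard : Fintype.card K = q ^ (2 * m) := by rw [Module.card_eq_pow_finrank (K := k), hK]
  rw [← hZc]
  refine (card_zeros_le hg0 Z fun p hp => ?_).trans hgd
  obtain ⟨⟨x, c⟩, hx, rfl⟩ := Finset.mem_image.1 hp
  rw [Finset.mem_product, hS, Finset.mem_filter] at hx
  obtain ⟨⟨-, hx0, htr⟩, -⟩ := hx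
  have hx0' : algebraMap K Ω x ≠ 0 := (_root_.map_ne_zero _).2 hx0
  have hc : algebraMap k Ω c ^ q = algebraMap k Ω c := by
    rw [← map_pow, FiniteField.pow_card]
  have hφ : ∀ z : Ω, (FiniteField.frobeniusAlgHom k Ω) z = z ^ q := fun z => rfl
  have hfrob : (y x + algebraMap k Ω c) ^ q - (y x + algebraMap k Ω c) =
      algebraMap K Ω (x + algebraMap k K b / x) := by
    rw [← hφ, map_add, hφ, hφ, hc, ← hy]
    ring
  have hcurve : algebraMap K Ω x * algebraMap K Ω x =
      aeval (y x + algebraMap k Ω c) (frobSub k) * algebraMap K Ω x - algebraMap k Ω b := by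
    have : aeval (y x + algebraMap k Ω c) (frobSub k) =
        (y x + algebraMap k Ω c) ^ q - (y x + algebraMap k Ω c) := by simp [frobSub, hq]
    rw [this, hfrob, IsScalarTower.algebraMap_apply k K Ω, map_add, map_div₀]
    rw [add_mul, div_mul_cancel₀ _ hx0']
    ring
  refine ⟨hcurve, hg _ _ hcurve ?_ ?_⟩
  · rw [← map_pow, ← pow_mul, mul_comm m, ← hcard, FiniteField.pow_card]
  · have h1 := sum_range_pow_card_sub (k := k) (y x + algebraMap k Ω c) (2 * m)
    rw [← hq, hfrob] at h1
    simp only [← map_pow] at h1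
    rw [← map_sum] at h1
    have h2 := FiniteField.algebraMap_trace_eq_sum_pow k K (x + algebraMap k K b / x)
    rw [hK, htr, Nat.card_eq_fintype_card, ← hq] at h2
    rw [← h2, ← IsScalarTower.algebraMap_apply k K Ω] at h1
    rw [← pow_mul, mul_comm m]
    linear_combination -h1

end StepanovBound

/-! ### Weil's bound and an exact non-equality for Kloosterman sums. -/

section WeilBound

variable {k : Type*} [Field k] [Fintype k] {ψ : AddChar k ℂ} {b : k}

/-- Upper bounds suffice. The numbers `N_c` of `x` with trace `c` are all at most `M`, and `∑ c, ψ c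
= 0` lets `-N_c` be replaced by `M - N_c ≥ 0`; the total of these is `q M` minus the known total `q
^ (2m) - 1`. -/
theorem norm_kloostermanSum_extension_le (hk : ringChar k ≠ 2) (hψ : ψ ≠ 1) (hb : b ≠ 0) {m : ℕ}
    (hm : 2 ≤ m) (K : Type*) [Field K] [Fintype K] [Algebra k K]
    (hK : Module.finrank k K = 2 * m) :
    ‖kloostermanSum (ψ.compAddMonoidHom (Algebra.trace k K).toAddMonoidHom) (algebraMap k K b)‖ ≤
      4 * Fintype.card k * Fintype.card k ^ m + 1 := by
  classical
  set q := Fintype.card k with hq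
  set S := fun c : k => Finset.univ.filter fun x : K => x ≠ 0 ∧
    Algebra.trace k K (x + algebraMap k K b / x) = c with hS
  have hq0 : (0 : ℝ) < q := by exact_mod_cast Fintype.card_pos
  set M : ℝ := ((q ^ m) ^ 2 + 4 * q * q ^ m) / q with hM
  have hN : ∀ c, ((S c).card : ℝ) ≤ M := fun c => by
    rw [hM, le_div_iff₀ hq0, mul_comm]
    exact_mod_cast card_trace_eq_le hk hb c hm K hK
  have hcard : Fintype.card K = q ^ (2 * m) := by rw [Module.card_eq_pow_finrank (K := k), hK]
  have htot : ∑ c, ((S c).card : ℝ) = q ^ (2 * m) - 1 := by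
    have h1 : ∑ c, (S c).card = (Finset.univ.filter fun x : K => x ≠ 0).card := by
      rw [Finset.card_eq_sum_card_fiberwise (f := fun x : K =>
        Algebra.trace k K (x + algebraMap k K b / x)) (t := Finset.univ)
        fun _ _ => Finset.mem_coe.2 (Finset.mem_univ _)]
      refine Finset.sum_congr rfl fun c _ => ?_
      rw [Finset.filter_filter]
    have h2 : (Finset.univ.filter fun x : K => x ≠ 0).card + 1 = q ^ (2 * m) := by
      rw [Finset.filter_ne', Finset.card_erase_of_mem (Finset.mem_univ _), Finset.card_univ, ← hcard]
      exact Nat.sub_add_cancel Fintype.card_pos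
    have h3 : ((∑ c, (S c).card : ℕ) : ℝ) + 1 = q ^ (2 * m) := by rw [h1]; exact_mod_cast h2
    push_cast at h3
    linarith
  have hkl : kloostermanSum (ψ.compAddMonoidHom (Algebra.trace k K).toAddMonoidHom)
      (algebraMap k K b) = ∑ c, ((M - (S c).card : ℝ) : ℂ) * ψ c := by
    have h1 : ∑ c, (M : ℂ) * ψ c = 0 := by
      rw [← Finset.mul_sum, AddChar.sum_eq_zero_of_ne_one hψ, mul_zero]
    have h2 : ∑ c, ((S c).card : ℂ) * ψ c = ∑ x : K, if x = 0 then 0 else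
        ψ (Algebra.trace k K (x + algebraMap k K b / x)) := by
      have h3 : ∀ x : K, (if x = 0 then 0 else
          ψ (Algebra.trace k K (x + algebraMap k K b / x))) = ∑ c, if x ≠ 0 ∧
            Algebra.trace k K (x + algebraMap k K b / x) = c then ψ c else 0 := by
        intro x
        by_cases hx : x = 0 <;> simp [hx]
      rw [Finset.sum_congr rfl fun x _ => h3 x, Finset.sum_comm]
      refine Finset.sum_congr rfl fun c _ => ?_
      rw [← Finset.sum_filter, Finset.sum_const, nsmul_eq_mul]
    rw [kloostermanSum_eq]
    have h4 : ∑ c, ((M - (S c).card : ℝ) : ℂ) * ψ c =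
        ∑ c, (M : ℂ) * ψ c - ∑ c, ((S c).card : ℂ) * ψ c := by
      rw [← Finset.sum_sub_distrib]
      refine Finset.sum_congr rfl fun c _ => ?_
      push_cast
      ring
    rw [h4, h1, h2, zero_sub]
    rfl
  rw [hkl]
  calc ‖∑ c, ((M - (S c).card : ℝ) : ℂ) * ψ c‖ ≤ ∑ c, ‖((M - (S c).card : ℝ) : ℂ) * ψ c‖ :=
        norm_sum_le _ _
    _ = ∑ c, (M - (S c).card) := by
        refine Finset.sum_congr rfl fun c _ => ?_
        rw [norm_mul, AddChar.norm_apply, mul_one, Complex.norm_real, Real.norm_of_nonneg]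
        exact sub_nonneg.2 (hN c)
    _ = 4 * q * q ^ m + 1 := by
        rw [Finset.sum_sub_distrib, htot, Finset.sum_const, Finset.card_univ, nsmul_eq_mul, ← hq,
          hM, mul_div_cancel₀ _ hq0.ne']
        ring

theorem conj_kloostermanSum (ψ : AddChar k ℂ) (b : k) :
    starRingEnd ℂ (kloostermanSum ψ b) = kloostermanSum ψ b := by
  classical
  rw [kloostermanSum_eq, map_neg, map_sum, ← Equiv.sum_comp (Equiv.neg k)]
  congr 1
  refine Finset.sum_congr rfl fun x _ => ?_
  by_cases hx : x = 0
  · simp [hx]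
  · simp only [Equiv.neg_apply, neg_eq_zero, hx, if_false]
    rw [← AddChar.map_neg_eq_conj]
    congr 1
    field_simp
    ring

theorem kloostermanSum_eq_re (ψ : AddChar k ℂ) (b : k) :
    kloostermanSum ψ b = ((kloostermanSum ψ b).re : ℂ) :=
  (Complex.conj_eq_iff_re.1 (conj_kloostermanSum ψ b)).symm

/-- Weil's bound for Kloosterman sums. -/
theorem re_kloostermanSum_sq_le (hk : ringChar k ≠ 2) (hψ : ψ ≠ 1) (hb : b ≠ 0) :
    (kloostermanSum ψ b).re ^ 2 ≤ 4 * Fintype.card k := by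
  by_contra! hlt
  set r := (kloostermanSum ψ b).re with hr
  set q : ℝ := (Fintype.card k : ℝ) with hq
  have hq0 : 1 ≤ q := by
    have : 1 ≤ Fintype.card k := Fintype.card_pos
    rw [hq]
    exact_mod_cast this
  set s := √(r ^ 2 - 4 * q) with hs
  have hs2 : s ^ 2 = r ^ 2 - 4 * q := Real.sq_sqrt (by linarith)
  have hs0 : 0 < s := Real.sqrt_pos.2 (by linarith)
  set α := (r + s) / 2 with hα
  set β := (r - s) / 2 with hβ
  have hsum : α + β = r := by rw [hα, hβ]; ring
  have hprod : α * β = q := by rw [hα, hβ]; linear_combination (-1 / 4 : ℝ) * hs2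
  have hr0 : r ≠ 0 := fun h => by rw [h] at hlt; linarith
  have hne : α ^ 2 ≠ β ^ 2 := by
    intro h
    have : r * s = 0 := by rw [hα, hβ] at h; linear_combination h
    exact (mul_ne_zero hr0 hs0.ne') this
  have hprod2 : α ^ 2 * β ^ 2 = q ^ 2 := by rw [← mul_pow, hprod]
  -- If the bound fails, `α` and `β` are real, and the Kloosterman sum over the extension of degree
  -- `2m` is `α ^ (2m) + β ^ (2m)`, to which the weak bound with an extra constant applies.
  have hbound : ∀ m : ℕ, 2 ≤ m → (α ^ 2) ^ m + (β ^ 2) ^ m ≤ (4 * q + 1) * q ^ m := by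
    intro m hm
    have : NeZero (2 * m) := ⟨by omega⟩
    have : Fact (ringChar k).Prime := ⟨CharP.char_is_prime k (ringChar k)⟩
    let K := FiniteField.Extension k (ringChar k) (2 * m)
    have : Fintype K := Fintype.ofFinite K
    have hK : Module.finrank k K = 2 * m := FiniteField.finrank_extension _ _ _
    have h1 := kloostermanSum_extension hψ hb (α := α) (β := β)
      (by rw [← Complex.ofReal_add, hsum, kloostermanSum_eq_re])
      (by rw [← Complex.ofReal_mul, hprod, hq, Complex.ofReal_natCast]) K
    have h2 := norm_kloostermanSum_extension_le hk hψ hb hm K hK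
    rw [h1, hK, pow_mul, pow_mul, ← Complex.ofReal_pow, ← Complex.ofReal_pow, ← Complex.ofReal_pow,
      ← Complex.ofReal_pow, ← Complex.ofReal_add, Complex.norm_real, ← hq] at h2
    refine (le_abs_self _).trans (h2.trans ?_)
    have := one_le_pow₀ hq0 (n := m)
    linarith
  -- The squares `α²` and `β²` are distinct with product `q²`, so one of them exceeds `q`. Its
  -- powers outgrow any constant multiple of `q ^ m`.
  obtain ⟨A, B, hA, hB, hAB⟩ : ∃ A B : ℝ, q < A ∧ 0 ≤ B ∧
      ∀ m : ℕ, 2 ≤ m → A ^ m + B ^ m ≤ (4 * q + 1) * q ^ m := by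
    by_cases h : q < α ^ 2
    · exact ⟨α ^ 2, β ^ 2, h, sq_nonneg _, hbound⟩
    · refine ⟨β ^ 2, α ^ 2, ?_, sq_nonneg _, fun m hm => by rw [add_comm]; exact hbound m hm⟩
      by_contra h'
      rw [not_lt] at h h'
      have : α ^ 2 = q := by nlinarith [sq_nonneg α, sq_nonneg β]
      have : β ^ 2 = q := by nlinarith [sq_nonneg α, sq_nonneg β]
      exact hne (by linarith)
  have hu : 1 < A / q := (one_lt_div (by linarith)).2 hA
  obtain ⟨m, hm⟩ := pow_unbounded_of_one_lt (4 * q + 1) hu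
  have h1 : (A / q) ^ (m + 2) ≤ 4 * q + 1 := by
    rw [div_pow, div_le_iff₀ (by positivity)]
    exact le_trans (le_add_of_nonneg_right (pow_nonneg hB _)) (hAB (m + 2) (by omega))
  have h2 : (A / q) ^ m ≤ (A / q) ^ (m + 2) := pow_le_pow_right₀ hu.le (by omega)
  linarith

/-- Modulo a maximal ideal above `p` in the ring of algebraic integers, every `p`-th root of unity
is `1`. So the Kloosterman sum is congruent to `-(|k| - 1)`, that is to `1`, whereas `4 |k|` is
congruent to `0`. -/
theorem kloostermanSum_sq_ne (ψ : AddChar k ℂ) (b : k) :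
    kloostermanSum ψ b ^ 2 ≠ 4 * Fintype.card k := by
  classical
  intro h
  set p := ringChar k with hp
  have hpp : Fact p.Prime := ⟨CharP.char_is_prime k p⟩
  let R := integralClosure ℤ ℂ
  have hmax : (Ideal.span {(p : ℤ)}).IsMaximal :=
    PrincipalIdealRing.isMaximal_of_irreducible (Nat.prime_iff_prime_int.1 hpp.out).irreducible
  obtain ⟨𝔪, h𝔪, hcomap⟩ := Ideal.exists_ideal_over_maximal_of_isIntegral (S := R)
    (Ideal.span {(p : ℤ)}) (by
      rw [(RingHom.injective_iff_ker_eq_bot _).1 (FaithfulSMul.algebraMap_injective ℤ R)]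
      exact bot_le)
  let _ : Field (R ⧸ 𝔪) := Ideal.Quotient.field 𝔪
  have hp0 : (p : R ⧸ 𝔪) = 0 := by
    have : (algebraMap ℤ R p) ∈ 𝔪 := by
      rw [← Ideal.mem_comap, hcomap]
      exact Ideal.mem_span_singleton_self _
    rw [← map_natCast (Ideal.Quotient.mk 𝔪), Ideal.Quotient.eq_zero_iff_mem]
    simpa using this
  have : CharP (R ⧸ 𝔪) p := (CharP.charP_iff_prime_eq_zero hpp.out).2 hp0
  have hψp : ∀ x, ψ x ^ p = 1 := fun x => by
    rw [← AddChar.map_nsmul_eq_pow, nsmul_eq_mul, CharP.cast_eq_zero, zero_mul,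
      AddChar.map_zero_eq_one]
  let ψR : k → R := fun x => ⟨ψ x, IsIntegral.of_pow hpp.out.pos (by rw [hψp]; exact isIntegral_one)⟩
  -- The values of `ψ` are `p`-th roots of unity, and Frobenius is injective on a field of
  -- characteristic `p`.
  have hψR : ∀ x, Ideal.Quotient.mk 𝔪 (ψR x) = 1 := fun x => by
    have h1 : ψR x ^ p = 1 := Subtype.ext (hψp x)
    refine frobenius_inj (R ⧸ 𝔪) p ?_
    rw [frobenius_def, ← map_pow, h1, map_one, map_one]
  have hcard : (Fintype.card k : R ⧸ 𝔪) = 0 := by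
    obtain ⟨n, -, hn⟩ := FiniteField.card k p
    rw [hn, Nat.cast_pow, hp0, zero_pow n.ne_zero]
  let z : R := -∑ x : k, if x = 0 then 0 else ψR (x + b / x)
  have hz : (z : ℂ) = kloostermanSum ψ b := by
    rw [kloostermanSum_eq]
    simp only [z, NegMemClass.coe_neg, AddSubmonoidClass.coe_finsetSum]
    congr 1
    refine Finset.sum_congr rfl fun x _ => ?_
    split_ifs <;> rfl
  have hzsq : z ^ 2 = 4 * (Fintype.card k : R) := by
    refine Subtype.ext ?_
    push_cast
    rw [hz, h]
    rfl
  have hz1 : Ideal.Quotient.mk 𝔪 z = 1 := by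
    have h1 : ∀ x : k, Ideal.Quotient.mk 𝔪 (if x = 0 then 0 else ψR (x + b / x)) =
        1 - if x = 0 then 1 else 0 := fun x => by
      split_ifs <;> simp [hψR]
    rw [map_neg, map_sum, Finset.sum_congr rfl fun x _ => h1 x, Finset.sum_sub_distrib,
      Finset.sum_const, Finset.card_univ, nsmul_eq_mul, hcard]
    simp
  have := congrArg (Ideal.Quotient.mk 𝔪) hzsq
  rw [map_pow, hz1, map_mul, map_natCast, hcard, mul_zero, one_pow] at this
  exact one_ne_zero this

end WeilBound

/-! ### Counting points on a Weierstrass curve. -/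

section PointCount

variable {κ : Type*} [Field κ] [Fintype κ] [DecidableEq κ]

/-- Completing the square by `z = 2y + a₁x + a₃` reduces the count to square roots; nonvanishing of
`Δ` makes every affine solution nonsingular. -/
theorem card_point_eq (hκ : ringChar κ ≠ 2) (W : WeierstrassCurve κ) (hΔ : W.Δ ≠ 0) :
    (Nat.card W.toAffine.Point : ℤ) = 1 + Fintype.card κ +
      ∑ x : κ, quadraticChar κ (4 * x ^ 3 + W.b₂ * x ^ 2 + 2 * W.b₄ * x + W.b₆) := by
  have h2 : (2 : κ) ≠ 0 := Ring.two_ne_zero hκ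
  let e : W.toAffine.Point ≃
      Option (Σ x : κ, {z : κ | z ^ 2 = 4 * x ^ 3 + W.b₂ * x ^ 2 + 2 * W.b₄ * x + W.b₆}) :=
    { toFun := fun P => match P with
        | .zero => none
        | .some x y h => some ⟨x, 2 * y + W.a₁ * x + W.a₃, by
            have := (WeierstrassCurve.Affine.equation_iff _ _).1 h.1
            simp only [Set.mem_ofPred_eq, WeierstrassCurve.b₂, WeierstrassCurve.b₄,
              WeierstrassCurve.b₆]
            linear_combination 4 * this⟩
      invFun := fun P => match P with
        | none => .zero
        | some ⟨x, z, h⟩ => .some x ((z - W.a₁ * x - W.a₃) / 2) (by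
            rw [← WeierstrassCurve.Affine.equation_iff_nonsingular_of_Δ_ne_zero hΔ,
              WeierstrassCurve.Affine.equation_iff]
            simp only [Set.mem_ofPred_eq, WeierstrassCurve.b₂, WeierstrassCurve.b₄,
              WeierstrassCurve.b₆] at h
            field_simp
            linear_combination h)
      left_inv := fun P => by
        rcases P with _ | ⟨x, y, h⟩
        · rfl
        · simp only
          congr 1
          field_simp
          ring
      right_inv := fun P => by
        rcases P with _ | ⟨x, z, h⟩
        · rfl
        · simp only [Option.some.injEq]
          congr 2
          field_simp
          ring }
  classical
  rw [Nat.card_congr e, Nat.card_eq_fintype_card, Fintype.card_option, Fintype.card_sigma]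
  push_cast
  have : ∀ x : κ, (Fintype.card {z : κ | z ^ 2 = 4 * x ^ 3 + W.b₂ * x ^ 2 + 2 * W.b₄ * x + W.b₆} : ℤ)
      = quadraticChar κ (4 * x ^ 3 + W.b₂ * x ^ 2 + 2 * W.b₄ * x + W.b₆) + 1 := fun x => by
    rw [← quadraticChar_card_sqrts hκ, Set.toFinset_card]
  rw [Finset.sum_congr rfl fun x _ => this x, Finset.sum_add_distrib]
  simp
  ring

end PointCount

/-! ### Quadratic polynomials and their discriminants. -/

section Splitting

variable {κ : Type*} [Field κ]

theorem splits_quadratic_iff (hκ : ringChar κ ≠ 2) {a b c : κ} (ha : a ≠ 0) :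
    (C a * X ^ 2 + C b * X + C c).Splits ↔ IsSquare (b ^ 2 - 4 * a * c) := by
  have h2 : (2 : κ) ≠ 0 := Ring.two_ne_zero hκ
  have : NeZero (2 : κ) := ⟨h2⟩
  have hdeg : (C a * X ^ 2 + C b * X + C c).natDegree = 2 := natDegree_quadratic ha
  constructor
  · intro h
    obtain ⟨x, hx⟩ := h.exists_eval_eq_zero (degree_ne_of_natDegree_ne (n := 0) (by rw [hdeg]; omega))
    refine ⟨2 * a * x + b, ?_⟩
    simp only [eval_add, eval_mul, eval_C, eval_pow, eval_X] at hx
    linear_combination -4 * a * hx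
  · rintro ⟨s, hs⟩
    refine Splits.of_natDegree_eq_two hdeg (x := (s - b) / (2 * a)) ?_
    simp only [eval_add, eval_mul, eval_C, eval_pow, eval_X]
    field_simp
    linear_combination -hs

end Splitting

/-! ### Invariants of Legendre curves. -/

section Legendre

variable {R : Type*} [CommRing R]

/-- The curve `y ^ 2 = x (x + a) (x + b)`. -/
def legendre (a b : R) : WeierstrassCurve R := ⟨0, a + b, 0, a * b, 0⟩

theorem legendre_Δ (a b : R) : (legendre a b).Δ = 16 * (a * b * (a - b)) ^ 2 := by
  simp only [legendre, WeierstrassCurve.Δ, WeierstrassCurve.b₂, WeierstrassCurve.b₄,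
    WeierstrassCurve.b₆, WeierstrassCurve.b₈]
  ring

theorem legendre_b₂ (a b : R) : (legendre a b).b₂ = 4 * (a + b) := by
  simp only [legendre, WeierstrassCurve.b₂]
  ring

theorem legendre_b₄ (a b : R) : (legendre a b).b₄ = 2 * (a * b) := by
  simp only [legendre, WeierstrassCurve.b₄]
  ring

theorem legendre_b₆ (a b : R) : (legendre a b).b₆ = 0 := by
  simp only [legendre, WeierstrassCurve.b₆]
  ring

theorem legendre_c₄ (a b : R) : (legendre a b).c₄ = 16 * (a ^ 2 - a * b + b ^ 2) := by
  simp only [legendre, WeierstrassCurve.c₄, WeierstrassCurve.b₂, WeierstrassCurve.b₄]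
  ring

theorem legendre_c₆ (a b : R) :
    (legendre a b).c₆ = -32 * (a + b) * (2 * a - b) * (a - 2 * b) := by
  simp only [legendre, WeierstrassCurve.c₆, WeierstrassCurve.b₂, WeierstrassCurve.b₄,
    WeierstrassCurve.b₆]
  ring

theorem legendre_map {S : Type*} [CommRing S] (f : R →+* S) (a b : R) :
    (legendre a b).map f = legendre (f a) (f b) := by
  simp [legendre, WeierstrassCurve.map]

end Legendre

/-! ### Minimal models and local polynomials of Legendre curves. -/

section Minimal

open WeierstrassCurve IsDedekindDomain.HeightOneSpectrum IsDiscreteValuationRing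

variable {R : Type*} [CommRing R] [IsDomain R] [IsDiscreteValuationRing R] {K : Type*}
  [Field K] [Algebra R K] [IsFractionRing R K]

/-- An integral model with `c₄` or `Δ` a unit is already minimal. The transformation laws `u⁻⁴ c₄`
and `u⁻¹² Δ` show that `u⁻¹` is integral, and minimality of the transformed model forbids it from
having positive valuation. -/
theorem exists_unit_of_isMinimal (W : WeierstrassCurve R) (C : VariableChange K)
    [hM : IsMinimal R (C • W⁄K)] (hΔ : W.Δ ≠ 0) (h : IsUnit W.c₄ ∨ IsUnit W.Δ) :
    ∃ e : Rˣ, algebraMap R K e = (C.u⁻¹ : Kˣ) := by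
  have hW : IsIntegral R (W⁄K) := ⟨⟨W, rfl⟩⟩
  have hlift : ∃ e : R, algebraMap R K e = (C.u⁻¹ : Kˣ) := by
    have key : ∀ (n : ℕ) (c d : R), 0 < n → IsUnit c → ((C.u⁻¹ : Kˣ) : K) ^ n * algebraMap R K c =
        algebraMap R K d → ∃ e : R, algebraMap R K e = (C.u⁻¹ : Kˣ) := by
      intro n c d hn hc hcd
      obtain ⟨c, rfl⟩ := hc
      refine IsIntegrallyClosed.isIntegral_iff.1 (IsIntegral.of_pow hn ?_)
      have : ((C.u⁻¹ : Kˣ) : K) ^ n = algebraMap R K (d * ↑c⁻¹) := by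
        rw [map_mul, ← hcd, mul_assoc, ← map_mul, Units.mul_inv, map_one, mul_one]
      rw [this]
      exact isIntegral_algebraMap
    rcases h with h | h
    · refine key 4 _ (integralModel R (C • W⁄K)).c₄ (by norm_num) h ?_
      rw [integralModel_c₄_eq, variableChange_c₄, baseChange, map_c₄]
    · refine key 12 _ (integralModel R (C • W⁄K)).Δ (by norm_num) h ?_
      rw [integralModel_Δ_eq, variableChange_Δ, baseChange, map_Δ]
  obtain ⟨e, he⟩ := hlift
  have hmin := hM.val_Δ_maximal.2 (j := C⁻¹) (by simpa using hW)
  simp only [one_smul, inv_smul_smul] at hmin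
  have hle : valuation_Δ_aux R (W⁄K) ≤ valuation_Δ_aux R (C • W⁄K) := by
    rcases le_total (valuation_Δ_aux R (C • W⁄K)) (valuation_Δ_aux R (W⁄K)) with h | h
    · exact hmin h
    · exact h
  have hle' : valuation K (maximalIdeal R) (W⁄K).Δ ≤ valuation K (maximalIdeal R) (C • W⁄K).Δ := by
    rw [← valuation_Δ_aux_eq_of_isIntegral, ← valuation_Δ_aux_eq_of_isIntegral]
    exact hle
  rw [variableChange_Δ, map_mul, map_pow, ← he] at hle'
  have hpos : 0 < valuation K (maximalIdeal R) (W⁄K).Δ := by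
    rw [zero_lt_iff, Valuation.ne_zero_iff, baseChange, map_Δ]
    simpa using hΔ
  have h1 : 1 ≤ valuation K (maximalIdeal R) (algebraMap R K e) ^ 12 :=
    le_of_mul_le_mul_right (by rwa [one_mul]) hpos
  have h2 : ¬ valuation K (maximalIdeal R) (algebraMap R K e) < 1 := fun hlt =>
    absurd h1 (not_le.2 (pow_lt_one₀ zero_le hlt (by norm_num)))
  rw [valuation_lt_one_iff_mem] at h2
  have hu : IsUnit e := by
    by_contra hne
    exact h2 ((IsLocalRing.mem_maximalIdeal e).2 hne)
  exact ⟨hu.unit, he⟩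

/-- The transformation law of `b₆` exhibits the translation as a root of a cubic with leading
coefficient `4`, a unit, and integral coefficients. -/
theorem exists_integral_translation (h2 : IsUnit (2 : R)) (W : WeierstrassCurve R)
    (C : VariableChange K) [IsIntegral R (C • W⁄K)] {e : Rˣ}
    (he : algebraMap R K e = (C.u⁻¹ : Kˣ)) : ∃ r : R, algebraMap R K r = C.r := by
  have h4 : IsUnit (4 : R) := by
    have : (4 : R) = 2 * 2 := by norm_num
    rw [this]
    exact h2.mul h2
  obtain ⟨w, hw⟩ := h4
  refine IsIntegrallyClosed.isIntegral_iff.1 ?_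
  set I := integralModel R (C • W⁄K)
  refine ⟨X ^ 3 + Polynomial.C (↑w⁻¹ * W.b₂) * X ^ 2 + Polynomial.C (↑w⁻¹ * (2 * W.b₄)) * X +
    Polynomial.C (↑w⁻¹ * (W.b₆ - (e⁻¹ : Rˣ) ^ 6 * I.b₆)), by monicity!, ?_⟩
  have hb : algebraMap R K I.b₆ = algebraMap R K e ^ 6 * (algebraMap R K W.b₆ +
      2 * C.r * algebraMap R K W.b₄ + C.r ^ 2 * algebraMap R K W.b₂ + 4 * C.r ^ 3) := by
    rw [integralModel_b₆_eq, variableChange_b₆, ← he, baseChange, map_b₂, map_b₄, map_b₆]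
  have he' : algebraMap R K ↑(e⁻¹) * algebraMap R K e = 1 := by
    rw [← map_mul, Units.inv_mul, map_one]
  have hw' : algebraMap R K ↑(w⁻¹) * 4 = 1 := by
    have : (4 : K) = algebraMap R K w := by rw [hw, map_ofNat]
    rw [this, ← map_mul, Units.inv_mul, map_one]
  simp only [eval₂_add, eval₂_mul, eval₂_pow, eval₂_X, eval₂_C]
  simp only [map_mul, map_sub, map_pow, map_ofNat]
  have hb' : algebraMap R K ↑(e⁻¹) ^ 6 * algebraMap R K I.b₆ = algebraMap R K W.b₆ +
      2 * C.r * algebraMap R K W.b₄ + C.r ^ 2 * algebraMap R K W.b₂ + 4 * C.r ^ 3 := by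
    rw [hb, ← mul_assoc, ← mul_pow, he']
    ring
  rw [hb']
  linear_combination (-C.r ^ 3) * hw'

/-- Since `a` is a unit and residue characteristic two is excluded, the Legendre model is minimal up
to a change of coordinates with unit `u` and integral `r`, and the character sum `ellTrace` of its
reduction is insensitive to such changes. In the bad case a node appears, at which `ellTrace` is `1`
or `-1` according to splitting. -/
theorem localPolynomial_legendre [Fintype (IsLocalRing.ResidueField R)]
    [DecidableEq (IsLocalRing.ResidueField R)] (h2 : IsUnit (2 : R)) {a b : R} (ha : IsUnit a)
    (hb : b ≠ 0) (hab : a ≠ b) (W : WeierstrassCurve K) (C₀ : VariableChange K)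
    (hW : C₀ • W = (legendre a b)⁄K) :
    (IsUnit (b * (a - b)) → W.localPolynomial R =
        1 - Polynomial.C (ellTrace _ (IsLocalRing.residue R a) (IsLocalRing.residue R b)) * X +
          Polynomial.C (Fintype.card (IsLocalRing.ResidueField R) : ℤ) * X ^ 2) ∧
      (¬ IsUnit (b * (a - b)) → W.localPolynomial R =
        1 - Polynomial.C (ellTrace _ (IsLocalRing.residue R a) (IsLocalRing.residue R b)) * X) := by
  classical
  have h16 : IsUnit (16 : R) := by
    have : (16 : R) = 2 ^ 4 := by norm_num
    rw [this]
    exact h2.pow 4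
  have h2κ : (2 : IsLocalRing.ResidueField R) ≠ 0 := by
    have := (h2.map (IsLocalRing.residue R)).ne_zero
    rwa [map_ofNat] at this
  have hκ : ringChar (IsLocalRing.ResidueField R) ≠ 2 := fun h => h2κ (by
    have := CharP.cast_eq_zero (IsLocalRing.ResidueField R) (ringChar (IsLocalRing.ResidueField R))
    rw [h] at this
    exact_mod_cast this)
  have haκ : IsLocalRing.residue R a ≠ 0 := (ha.map _).ne_zero
  have hΔ : (legendre a b).Δ ≠ 0 := by
    rw [legendre_Δ]
    exact mul_ne_zero h16.ne_zero (pow_ne_zero 2 (mul_ne_zero (mul_ne_zero ha.ne_zero hb)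
      (sub_ne_zero.2 hab)))
  have hΔu : IsUnit (legendre a b).Δ ↔ IsUnit (b * (a - b)) := by
    rw [legendre_Δ, IsUnit.mul_iff, and_iff_right h16, isUnit_pow_iff two_ne_zero, mul_assoc,
      IsUnit.mul_iff, and_iff_right ha]
  have hnu : ∀ x : R, IsUnit x ↔ IsLocalRing.residue R x ≠ 0 := fun x => by
    rw [Ne, IsLocalRing.residue_eq_zero_iff, IsLocalRing.mem_maximalIdeal, mem_nonunits_iff, not_not]
  have hbad : ¬ IsUnit (b * (a - b)) → IsLocalRing.residue R b = 0 ∨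
      IsLocalRing.residue R b = IsLocalRing.residue R a := fun h => by
    rw [hnu, not_not, map_mul, map_sub, mul_eq_zero, sub_eq_zero] at h
    exact h.imp_right Eq.symm
  -- When `b` reduces to `0` or to `a`, `c₄` reduces to `16 a²`.
  have hcΔ : IsUnit (legendre a b).c₄ ∨ IsUnit (legendre a b).Δ := by
    by_cases h : IsUnit (b * (a - b))
    · exact Or.inr (hΔu.2 h)
    · left
      rw [legendre_c₄, IsUnit.mul_iff, and_iff_right h16, hnu, map_add, map_sub, map_pow, map_pow,
        map_mul]
      rcases hbad h with h | h <;> rw [h]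
      · simpa using haκ
      · rw [sq, sub_self, zero_add]
        exact mul_ne_zero haκ haκ
  obtain ⟨C, hC⟩ : ∃ C : VariableChange K, W.minimal R = C • (legendre a b)⁄K := by
    refine ⟨(W.exists_isMinimal R).choose * C₀⁻¹, ?_⟩
    rw [mul_smul, ← hW, inv_smul_smul]
    rfl
  have hmin : IsMinimal R (C • (legendre a b)⁄K) := hC ▸ inferInstance
  obtain ⟨e, he⟩ := exists_unit_of_isMinimal (legendre a b) C hΔ hcΔ
  obtain ⟨r, hr⟩ := exists_integral_translation h2 (legendre a b) C he
  set M := W.minimal R with hM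
  set I := integralModel R M with hI
  have hinj := IsFractionRing.injective R K
  have hIM : I⁄K = C • (legendre a b)⁄K := by rw [hI, baseChange_integralModel_eq, hC]
  have hb₂ : I.b₂ = (e : R) ^ 2 * ((legendre a b).b₂ + 12 * r) := hinj (by
    rw [← map_b₂, ← baseChange, hIM, variableChange_b₂, ← he, ← hr, baseChange, map_b₂]
    simp only [map_mul, map_add, map_pow, map_ofNat])
  have hb₄ : I.b₄ = (e : R) ^ 4 * ((legendre a b).b₄ + r * (legendre a b).b₂ + 6 * r ^ 2) :=
    hinj (by
      rw [← map_b₄, ← baseChange, hIM, variableChange_b₄, ← he, ← hr, baseChange, map_b₂, map_b₄]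
      simp only [map_mul, map_add, map_pow, map_ofNat])
  have hb₆ : I.b₆ = (e : R) ^ 6 * ((legendre a b).b₆ + 2 * r * (legendre a b).b₄ +
      r ^ 2 * (legendre a b).b₂ + 4 * r ^ 3) := hinj (by
    rw [← map_b₆, ← baseChange, hIM, variableChange_b₆, ← he, ← hr, baseChange, map_b₂, map_b₄,
      map_b₆]
    simp only [map_mul, map_add, map_pow, map_ofNat])
  have hc₄ : I.c₄ = (e : R) ^ 4 * (legendre a b).c₄ := hinj (by
    rw [← map_c₄, ← baseChange, hIM, variableChange_c₄, ← he, baseChange, map_c₄]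
    simp only [map_mul, map_pow])
  have hc₆ : I.c₆ = (e : R) ^ 6 * (legendre a b).c₆ := hinj (by
    rw [← map_c₆, ← baseChange, hIM, variableChange_c₆, ← he, baseChange, map_c₆]
    simp only [map_mul, map_pow])
  have hΔ' : I.Δ = (e : R) ^ 12 * (legendre a b).Δ := hinj (by
    rw [← map_Δ, ← baseChange, hIM, variableChange_Δ, ← he, baseChange, map_Δ]
    simp only [map_mul, map_pow])
  have hgood : M.HasGoodReduction R ↔ IsUnit (b * (a - b)) := by
    rw [hasGoodReduction_iff_isElliptic_reduction, isElliptic_iff, reduction, map_Δ, ← hI, hΔ',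
      isUnit_iff_ne_zero, ← hnu, IsUnit.mul_iff, and_iff_right (e.isUnit.pow _), hΔu]
  constructor
  · intro hu
    have hg := hgood.2 hu
    have hΔI : (M.reduction R).Δ ≠ 0 := by
      rw [reduction, map_Δ, ← hI, ← hnu, hΔ']
      exact (e.isUnit.pow _).mul (hΔu.2 hu)
    rw [localPolynomial, if_pos hg]
    change 1 - Polynomial.C ((Nat.card (IsLocalRing.ResidueField R) : ℤ) + 1 -
      Nat.card (M.reduction R).toAffine.Point) * X + _ = _
    rw [card_point_eq hκ _ hΔI, Nat.card_eq_fintype_card]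
    have he0 : IsLocalRing.residue R e ≠ 0 := (e.isUnit.map _).ne_zero
    have hsum : ∑ x : IsLocalRing.ResidueField R, quadraticChar _ (4 * x ^ 3 + (M.reduction R).b₂ * x ^ 2 +
        2 * (M.reduction R).b₄ * x + (M.reduction R).b₆) =
        ∑ x : IsLocalRing.ResidueField R, quadraticChar _ (x * (x + IsLocalRing.residue R a) *
          (x + IsLocalRing.residue R b)) := by
      rw [← Equiv.sum_comp ((Equiv.subRight (IsLocalRing.residue R r)).trans
        (Equiv.mulLeft₀ (IsLocalRing.residue R e ^ 2) (pow_ne_zero 2 he0)))]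
      refine Finset.sum_congr rfl fun x _ => ?_
      have h4e : 2 * IsLocalRing.residue R e ^ 3 ≠ 0 := mul_ne_zero h2κ (pow_ne_zero 3 he0)
      rw [← one_mul (quadraticChar _ (_ * _)), ← quadraticChar_sq_one' h4e, ← map_mul, reduction,
        map_b₂, map_b₄, map_b₆, ← hI, hb₂, hb₄, hb₆]
      congr 1
      simp only [legendre_b₂, legendre_b₄, legendre_b₆, map_mul, map_add, map_pow, map_ofNat,
        map_zero, Equiv.trans_apply, Equiv.mulLeft₀_apply, Equiv.subRight_apply]
      ring
    rw [hsum, ellTrace]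
    congr 4
    ring
  · intro hu
    have hg : ¬ M.HasGoodReduction R := fun h => hu (hgood.1 h)
    have hc₄u : IsUnit I.c₄ := by
      rw [hc₄]
      exact (e.isUnit.pow _).mul (hcΔ.resolve_right fun h => hu (hΔu.1 h))
    have hmult : M.HasMultiplicativeReduction R := by
      rcases hasGoodReduction_or_hasMultiplicativeReduction_or_hasAdditiveReduction R (W := M)
        with h | h | h
      · exact absurd h hg
      · exact h
      · have := h.additiveReduction
        rw [← integralModel_c₄_eq R M, valuation_lt_one_iff_mem] at this
        exact absurd hc₄u ((IsLocalRing.mem_maximalIdeal _).1 this)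
    -- Splitting at the node is governed by the square class of `-c₄ c₆`, which is that of `a` when
    -- `b` reduces to `0` and that of `-a` when `b` reduces to `a`.
    have hdisc : ∃ s t : IsLocalRing.ResidueField R, s ≠ 0 ∧ t ≠ 0 ∧ -(IsLocalRing.residue R I.c₄ * IsLocalRing.residue R I.c₆) =
        s ^ 2 * t ∧ ellTrace _ (IsLocalRing.residue R a) (IsLocalRing.residue R b) =
          quadraticChar _ t := by
      have h32 : (32 : IsLocalRing.ResidueField R) ≠ 0 := by
        have : (32 : IsLocalRing.ResidueField R) = 2 ^ 5 := by norm_num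
        rw [this]
        exact pow_ne_zero 5 h2κ
      have he0 : IsLocalRing.residue R e ≠ 0 := (e.isUnit.map _).ne_zero
      have hs := mul_ne_zero (mul_ne_zero h32 (pow_ne_zero 5 he0)) (pow_ne_zero 2 haκ)
      rcases hbad hu with h | h
      · refine ⟨_, IsLocalRing.residue R a, hs, haκ, ?_, by rw [h, ellTrace_zero_right hκ]⟩
        rw [hc₄, hc₆, legendre_c₄, legendre_c₆]
        simp only [map_mul, map_add, map_sub, map_neg, map_pow, map_ofNat, h]
        ring
      · refine ⟨_, -IsLocalRing.residue R a, hs, neg_ne_zero.2 haκ, ?_, by rw [h, ellTrace_self hκ]⟩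
        rw [hc₄, hc₆, legendre_c₄, legendre_c₆]
        simp only [map_mul, map_add, map_sub, map_neg, map_pow, map_ofNat, h]
        ring
    obtain ⟨s, t, hs, ht, hst, htr⟩ := hdisc
    have hsplit : M.HasSplitMultiplicativeReduction R ↔
        ellTrace _ (IsLocalRing.residue R a) (IsLocalRing.residue R b) = 1 := by
      rw [hasSplitMultiplicativeReduction_iff, exists_prop_of_true hmult, ← hI, htr,
        quadraticChar_one_iff_isSquare ht]
      have hpoly : Polynomial.map (algebraMap R (IsLocalRing.ResidueField R)) (Polynomial.C I.c₄ * X ^ 2 +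
          Polynomial.C (I.a₁ * I.c₄) * X -
            Polynomial.C (54 * I.b₆ - 3 * I.b₂ * I.b₄ + I.a₂ * I.c₄)) =
          Polynomial.C (IsLocalRing.residue R I.c₄) * X ^ 2 +
            Polynomial.C (IsLocalRing.residue R (I.a₁ * I.c₄)) * X +
            Polynomial.C (-IsLocalRing.residue R (54 * I.b₆ - 3 * I.b₂ * I.b₄ + I.a₂ * I.c₄)) := by
        rw [Polynomial.map_sub, Polynomial.map_add, Polynomial.map_mul, Polynomial.map_mul,
          Polynomial.map_pow, map_X, map_C, map_C, map_C, Polynomial.C_neg, sub_eq_add_neg]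
        rfl
      rw [hpoly, splits_quadratic_iff hκ (hc₄u.map _).ne_zero]
      -- The discriminant of the polynomial defining the tangent directions is `-c₄ c₆`.
      have hd : IsLocalRing.residue R (I.a₁ * I.c₄) ^ 2 - 4 * IsLocalRing.residue R I.c₄ *
          -IsLocalRing.residue R (54 * I.b₆ - 3 * I.b₂ * I.b₄ + I.a₂ * I.c₄) = s ^ 2 * t := by
        rw [← hst, ← map_mul, ← map_neg, ← map_neg, ← map_pow, ← map_ofNat (IsLocalRing.residue R),
          ← map_mul, ← map_mul, ← map_sub]
        congr 1
        simp only [WeierstrassCurve.c₄, WeierstrassCurve.c₆, WeierstrassCurve.b₂]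
        ring
      rw [hd]
      constructor
      · rintro ⟨w, hw⟩
        refine ⟨w / s, ?_⟩
        field_simp
        linear_combination hw
      · rintro ⟨w, rfl⟩
        exact ⟨s * w, by ring⟩
    rw [localPolynomial, if_neg hg, ← hM]
    by_cases h1 : ellTrace _ (IsLocalRing.residue R a) (IsLocalRing.residue R b) = 1
    · rw [if_pos (hsplit.2 h1), h1, Polynomial.C_1, one_mul]
    · rw [if_neg (hsplit.not.2 h1), if_pos hmult]
      have : ellTrace _ (IsLocalRing.residue R a) (IsLocalRing.residue R b) = -1 := by
        rw [htr] at h1 ⊢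
        exact (quadraticChar_dichotomy ht).resolve_left h1
      rw [this, Polynomial.C_neg, Polynomial.C_1]
      ring

end Minimal

/-! ### Residue fields of finite places. -/

section Places

variable {F : Type*} [Field F]

theorem mem_maximalIdeal_ring_iff (v : Place F) (x : v.ring) :
    x ∈ IsLocalRing.maximalIdeal v.ring ↔ v.valuation (x : RatFunc F) < 1 := by
  rw [IsLocalRing.mem_maximalIdeal, mem_nonunits_iff,
    (Valuation.valuationSubring.integers v.valuation).isUnit_iff_valuation_eq_one]
  exact ⟨fun h => lt_of_le_of_ne x.2 h, fun h => h.ne⟩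

theorem residue_eq_zero_iff_valuation (v : Place F) (x : v.ring) :
    IsLocalRing.residue v.ring x = 0 ↔ v.valuation (x : RatFunc F) < 1 := by
  rw [IsLocalRing.residue_eq_zero_iff, mem_maximalIdeal_ring_iff]

/-- The inclusion of the polynomial ring in the valuation ring of a finite place. -/
def FinitePlace.toRing (v : FinitePlace F) : F[X] →+* (Place.finite v).ring :=
  (algebraMap F[X] (RatFunc F)).codRestrict (Place.finite v).ring.toSubring
    fun p => v.prime.valuation_le_one p

theorem FinitePlace.coe_toRing (v : FinitePlace F) (p : F[X]) :
    (v.toRing p : RatFunc F) = algebraMap F[X] (RatFunc F) p := rfl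

/-- The reduction map from the polynomial ring to the residue field of a finite place. -/
def FinitePlace.reduce (v : FinitePlace F) :
    F[X] →+* IsLocalRing.ResidueField (Place.finite v).ring :=
  (IsLocalRing.residue _).comp v.toRing

theorem FinitePlace.reduce_eq_zero_iff (v : FinitePlace F) (p : F[X]) :
    v.reduce p = 0 ↔ v.poly ∣ p := by
  rw [reduce, RingHom.comp_apply, residue_eq_zero_iff_valuation, coe_toRing]
  change v.prime.valuation (RatFunc F) (algebraMap F[X] (RatFunc F) p) < 1 ↔ _
  rw [IsDedekindDomain.HeightOneSpectrum.valuation_lt_one_iff_mem]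
  exact Ideal.mem_span_singleton

theorem FinitePlace.reduce_surjective (v : FinitePlace F) : Function.Surjective v.reduce := by
  intro y
  obtain ⟨x, rfl⟩ := IsLocalRing.residue_surjective y
  obtain ⟨p, hp⟩ := v.prime.exists_valuation_sub_lt_of_integer (K := RatFunc F) (x := x) x.2
    (γ := 1)
  refine ⟨p, ?_⟩
  rw [reduce, RingHom.comp_apply, ← sub_eq_zero, ← map_sub, residue_eq_zero_iff_valuation]
  change v.prime.valuation (RatFunc F) (algebraMap F[X] (RatFunc F) p - x) < 1
  simpa using hp

/-- The residue field of a finite place. -/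
def FinitePlace.residueEquiv (v : FinitePlace F) :
    v.residueField ≃+* IsLocalRing.ResidueField (Place.finite v).ring :=
  RingEquiv.ofBijective (Ideal.Quotient.lift (Ideal.span {v.poly}) v.reduce fun p hp =>
      (v.reduce_eq_zero_iff p).2 (Ideal.mem_span_singleton.1 hp))
    ⟨RingHom.injective (R := v.residueField) _, Ideal.Quotient.lift_surjective_of_surjective _ _
      v.reduce_surjective⟩

theorem FinitePlace.residueEquiv_mk (v : FinitePlace F) (p : F[X]) :
    v.residueEquiv (AdjoinRoot.mk v.poly p) = v.reduce p := rfl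

end Places

/-! ### Local polynomials at finite places. -/

section LocalFactors

variable {F : Type*} [Field F]

theorem quadraticChar_ringEquiv {k k' : Type*} [Field k] [Fintype k] [DecidableEq k] [Field k']
    [Fintype k'] [DecidableEq k'] (e : k ≃+* k') (x : k) :
    quadraticChar k' (e x) = quadraticChar k x := by
  by_cases hx : x = 0
  · simp [hx]
  · have hs : IsSquare (e x) ↔ IsSquare x :=
      ⟨fun h => by simpa using h.map e.symm, fun h => h.map e⟩
    rcases quadraticChar_dichotomy hx with h | h
    · rw [h, quadraticChar_one_iff_isSquare (e.map_ne_zero_iff.2 hx), hs,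
        ← quadraticChar_one_iff_isSquare hx, h]
    · rw [h, quadraticChar_neg_one_iff_not_isSquare, hs, ← quadraticChar_neg_one_iff_not_isSquare, h]

theorem ellTrace_ringEquiv {k k' : Type*} [Field k] [Fintype k] [DecidableEq k] [Field k']
    [Fintype k'] [DecidableEq k'] (e : k ≃+* k') (A B : k) :
    ellTrace k' (e A) (e B) = ellTrace k A B := by
  rw [ellTrace, ellTrace, ← Equiv.sum_comp e.toEquiv]
  congr 1
  refine Finset.sum_congr rfl fun x _ => ?_
  rw [← quadraticChar_ringEquiv e]
  simp

theorem exists_add_eq_mul_eq (s p : ℂ) : ∃ α β : ℂ, α + β = s ∧ α * β = p := by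
  obtain ⟨r, hr⟩ := IsAlgClosed.exists_pow_nat_eq (s ^ 2 - 4 * p) two_pos
  exact ⟨(s + r) / 2, (s - r) / 2, by ring, by linear_combination (-1 / 4 : ℂ) * hr⟩

variable [Fintype F]

theorem natDegree_X_pow_card_pow_sub_X {a : ℕ} (ha : 1 ≤ a) :
    (X ^ Fintype.card F ^ a - X : F[X]).natDegree = Fintype.card F ^ a :=
  FiniteField.X_pow_card_pow_sub_X_natDegree_eq F (by omega) Fintype.one_lt_card

theorem curve_eq_legendre_map (a : ℕ) (γ : F) (v : FinitePlace F) :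
    curve a γ = (legendre (v.toRing (C (16 * γ))) (v.toRing ((X ^ Fintype.card F ^ a - X) ^ 2))).map
      (algebraMap (Place.finite v).ring (RatFunc F)) := by
  have h1 : algebraMap (Place.finite v).ring (RatFunc F) (v.toRing (C (16 * γ))) =
      16 * RatFunc.C γ := by
    change algebraMap F[X] (RatFunc F) (C (16 * γ)) = _
    rw [Polynomial.C_mul, map_mul, RatFunc.algebraMap_C, RatFunc.algebraMap_C, map_ofNat]
  have h2 : algebraMap (Place.finite v).ring (RatFunc F)
      (v.toRing ((X ^ Fintype.card F ^ a - X) ^ 2)) = wp F a ^ 2 := by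
    change algebraMap F[X] (RatFunc F) ((X ^ Fintype.card F ^ a - X) ^ 2) = _
    rw [map_pow, map_sub, map_pow, RatFunc.algebraMap_X, wp]
  rw [legendre_map, h1, h2]
  rfl

theorem localPolynomial_finite (hF : ringChar F ≠ 2) {γ : F} (hγ : γ ≠ 0) {a : ℕ} (ha : 1 ≤ a)
    (v : FinitePlace F) [Fintype v.residueField] [DecidableEq v.residueField] {A B : v.residueField}
    (hA : A = algebraMap F _ (16 * γ))
    (hB : B = (AdjoinRoot.root v.poly ^ Fintype.card F ^ a - AdjoinRoot.root v.poly) ^ 2) :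
    (B * (A - B) ≠ 0 → (curve a γ).localPolynomial (Place.finite v).ring =
      1 - C (ellTrace _ A B) * X + C (Fintype.card v.residueField : ℤ) * X ^ 2) ∧
    (B * (A - B) = 0 → (curve a γ).localPolynomial (Place.finite v).ring =
      1 - C (ellTrace _ A B) * X) := by
  classical
  let _ : Fintype (IsLocalRing.ResidueField (Place.finite v).ring) :=
    Fintype.ofEquiv _ v.residueEquiv.toEquiv
  have h2 : (2 : F) ≠ 0 := Ring.two_ne_zero hF
  have h16 : (16 * γ : F) ≠ 0 := by
    have : (16 : F) = 2 ^ 4 := by norm_num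
    rw [this]
    exact mul_ne_zero (pow_ne_zero 4 h2) hγ
  have hunit : ∀ c : F, c ≠ 0 → IsUnit (v.toRing (C c)) := fun c hc =>
    (isUnit_C.2 (isUnit_iff_ne_zero.2 hc)).map _
  have h2u : IsUnit (2 : (Place.finite v).ring) := by
    have := hunit 2 h2
    rwa [show (C 2 : F[X]) = 2 from rfl, map_ofNat] at this
  have hinj : Function.Injective v.toRing := fun p q h =>
    RatFunc.algebraMap_injective F (congrArg Subtype.val h)
  have hd := natDegree_X_pow_card_pow_sub_X (F := F) ha
  have hq : 0 < Fintype.card F ^ a := pow_pos Fintype.card_pos _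
  have hP0 : (X ^ Fintype.card F ^ a - X : F[X]) ≠ 0 := fun h => by
    rw [h, natDegree_zero] at hd
    omega
  have hb : v.toRing ((X ^ Fintype.card F ^ a - X) ^ 2) ≠ 0 := fun h =>
    pow_ne_zero 2 hP0 (hinj (h.trans (map_zero _).symm))
  have hab : v.toRing (C (16 * γ)) ≠ v.toRing ((X ^ Fintype.card F ^ a - X) ^ 2) := fun h => by
    have := congrArg natDegree (hinj h)
    rw [natDegree_C, natDegree_pow, hd] at this
    omega
  have hA' : IsLocalRing.residue _ (v.toRing (C (16 * γ))) = v.residueEquiv A := by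
    rw [hA]
    rfl
  have hB' : IsLocalRing.residue _ (v.toRing ((X ^ Fintype.card F ^ a - X) ^ 2)) =
      v.residueEquiv B := by
    rw [hB, ← AdjoinRoot.mk_X, ← map_pow, ← map_sub, ← map_pow, v.residueEquiv_mk]
    rfl
  have hu : IsUnit (v.toRing ((X ^ Fintype.card F ^ a - X) ^ 2) * (v.toRing (C (16 * γ)) -
      v.toRing ((X ^ Fintype.card F ^ a - X) ^ 2))) ↔ B * (A - B) ≠ 0 := by
    rw [← not_iff_not, not_not, ← mem_nonunits_iff, ← IsLocalRing.mem_maximalIdeal,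
      ← IsLocalRing.residue_eq_zero_iff, map_mul, map_sub, hA', hB', ← map_sub, ← map_mul,
      map_eq_zero_iff _ v.residueEquiv.injective]
  have key := localPolynomial_legendre (K := RatFunc F) h2u (hunit _ h16) hb hab (curve a γ) 1
    (by rw [one_smul, curve_eq_legendre_map a γ v]; rfl)
  rw [hA', hB', ellTrace_ringEquiv, hu, not_not, ← Fintype.card_congr v.residueEquiv.toEquiv] at key
  exact key

end LocalFactors

/-! ### Frobenius eigenvalues of the fibres, and the place at infinity. -/

section LocalFactors

variable {F : Type*} [Field F] [Fintype F]

theorem FinitePlace.finrank_residueField {F : Type*} [Field F] (v : FinitePlace F) :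
    Module.finrank F v.residueField = v.degree := by
  rw [(AdjoinRoot.powerBasis v.irreducible.ne_zero).finrank, AdjoinRoot.powerBasis_dim]
  rfl

/-- Sending the class of `t` to a root `τ` makes `K` an extension of the residue field, so the fibre
at `τ` is the base change of the reduction at `v`. -/
theorem FinitePlace.exists_algebra_residueField {F : Type*} [Field F] (v : FinitePlace F)
    {K : Type*} [Field K] [Finite K] [Algebra F K] {τ : K} (hτ : minpoly F τ = v.poly) :
    ∃ _ : Algebra v.residueField K, IsScalarTower F v.residueField K ∧
      algebraMap v.residueField K (AdjoinRoot.root v.poly) = τ ∧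
      Module.finrank v.residueField K = Module.finrank F K / v.degree := by
  have hev : eval₂ (Algebra.ofId F K).toRingHom τ v.poly = 0 := by
    rw [← hτ]
    exact minpoly.aeval F τ
  let f : v.residueField →ₐ[F] K := AdjoinRoot.liftAlgHom v.poly (Algebra.ofId F K) τ hev
  let _ : Algebra v.residueField K := f.toRingHom.toAlgebra
  have : IsScalarTower F v.residueField K := IsScalarTower.of_algebraMap_eq fun x =>
    (f.commutes x).symm
  refine ⟨inferInstance, inferInstance, AdjoinRoot.lift_root hev, ?_⟩
  rw [← Module.finrank_mul_finrank F v.residueField K, v.finrank_residueField,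
    Nat.mul_div_cancel_left _ v.degree_pos]

theorem exists_localPolynomial_finite_eq_mul (hF : ringChar F ≠ 2) {γ : F} (hγ : γ ≠ 0) {a : ℕ}
    (ha : 1 ≤ a) (v : FinitePlace F) : ∃ α β : ℂ,
      ((curve a γ).localPolynomial (Place.finite v).ring).map (Int.castRingHom ℂ) =
        (1 - C α * X) * (1 - C β * X) ∧
      ∀ (K : Type) [Field K] [Fintype K] [DecidableEq K] [Algebra F K] (τ : K),
        minpoly F τ = v.poly →
        (ellTrace K (algebraMap F K (16 * γ)) ((τ ^ Fintype.card F ^ a - τ) ^ 2) : ℂ) =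
          α ^ (Module.finrank F K / v.degree) + β ^ (Module.finrank F K / v.degree) := by
  classical
  let _ : Fintype v.residueField := Fintype.ofFinite _
  set A : v.residueField := algebraMap F _ (16 * γ) with hA
  set B : v.residueField :=
    (AdjoinRoot.root v.poly ^ Fintype.card F ^ a - AdjoinRoot.root v.poly) ^ 2 with hB
  obtain ⟨hgood, hbad⟩ := localPolynomial_finite hF hγ ha v hA hB
  have hκ : ringChar v.residueField ≠ 2 := by rwa [← Algebra.ringChar_eq F v.residueField]
  have hA0 : A ≠ 0 := by
    refine (_root_.map_ne_zero _).2 (mul_ne_zero ?_ hγ)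
    have : (16 : F) = 2 ^ 4 := by norm_num
    rw [this]
    exact pow_ne_zero 4 (Ring.two_ne_zero hF)
  suffices h : ∃ α β : ℂ,
      ((curve a γ).localPolynomial (Place.finite v).ring).map (Int.castRingHom ℂ) =
        (1 - C α * X) * (1 - C β * X) ∧
      ∀ (K : Type) [Field K] [Fintype K] [DecidableEq K] [Algebra v.residueField K],
        (ellTrace K (algebraMap _ K A) (algebraMap _ K B) : ℂ) =
          α ^ Module.finrank v.residueField K + β ^ Module.finrank v.residueField K by
    obtain ⟨α, β, h1, h2⟩ := h
    refine ⟨α, β, h1, fun K _ _ _ _ τ hτ => ?_⟩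
    obtain ⟨_, _, hroot, hn⟩ := v.exists_algebra_residueField hτ
    rw [← hn, ← h2 K, hA, ← IsScalarTower.algebraMap_apply F v.residueField K]
    have hBτ : algebraMap v.residueField K B = (τ ^ Fintype.card F ^ a - τ) ^ 2 := by
      rw [hB, map_pow, map_sub, map_pow, hroot]
    rw [hBτ]
  by_cases hz : B * (A - B) = 0
  -- Bad reduction has one eigenvalue; the second is set to `0`, whose positive powers vanish.
  · refine ⟨ellTrace _ A B, 0, ?_, fun K _ _ _ _ => ?_⟩
    · rw [hbad hz]
      simp
    · rw [mul_eq_zero, sub_eq_zero] at hz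
      rw [ellTrace_extension_of_eq hκ (hz.imp_right Eq.symm) K, zero_pow Module.finrank_pos.ne',
        add_zero, Int.cast_pow]
  · obtain ⟨α, β, h1, h2⟩ := exists_add_eq_mul_eq (ellTrace _ A B) (Fintype.card v.residueField)
    rw [mul_eq_zero, not_or, sub_eq_zero] at hz
    refine ⟨α, β, ?_, fun K _ _ _ _ => ellTrace_extension hκ hA0 hz.1 hz.2 h1 h2 K⟩
    rw [hgood (mul_ne_zero hz.1 (sub_ne_zero.2 hz.2))]
    simp only [Polynomial.map_add, Polynomial.map_sub, Polynomial.map_one, Polynomial.map_mul,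
      Polynomial.map_C, map_X, Polynomial.map_pow]
    simp only [eq_intCast, Int.cast_natCast, ← h1, ← h2, C_add, C_mul]
    ring

theorem residue_infinity_surjective (F : Type*) [Field F]
    (y : IsLocalRing.ResidueField (Place.infinity (F := F)).ring) :
    ∃ (c : F) (x : (Place.infinity (F := F)).ring), (x : RatFunc F) = RatFunc.C c ∧
      IsLocalRing.residue _ x = y := by
  classical
  have hC : ∀ c : F, (Place.infinity (F := F)).valuation (RatFunc.C c) ≤ 1 := fun c => by
    by_cases hc : c = 0
    · rw [hc, map_zero, map_zero]
      exact zero_le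
    · exact (RatFunc.inftyValuation.C F hc).le
  obtain ⟨x, rfl⟩ := IsLocalRing.residue_surjective y
  suffices h : ∃ c : F, Place.infinity.valuation ((x : RatFunc F) - RatFunc.C c) < 1 by
    obtain ⟨c, hc⟩ := h
    refine ⟨c, ⟨RatFunc.C c, hC c⟩, rfl, ?_⟩
    rw [← sub_eq_zero, ← map_sub, residue_eq_zero_iff_valuation, ← Valuation.map_neg]
    simpa using hc
  set n := (x : RatFunc F).num
  set d := (x : RatFunc F).denom
  have hd : d.Monic := RatFunc.monic_denom _
  have hxnd : (x : RatFunc F) = algebraMap F[X] _ n / algebraMap F[X] _ d :=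
    (RatFunc.num_div_denom _).symm
  have hw : ∀ p : F[X], p ≠ 0 → Place.infinity.valuation (algebraMap F[X] (RatFunc F) p) =
      WithZero.exp (p.natDegree : ℤ) := fun p hp => RatFunc.inftyValuation.polynomial F hp
  have hd0 : algebraMap F[X] (RatFunc F) d ≠ 0 := (_root_.map_ne_zero_iff _
    (RatFunc.algebraMap_injective F)).2 hd.ne_zero
  have hle : n.natDegree ≤ d.natDegree := by
    by_cases hn : n = 0
    · rw [hn, natDegree_zero]
      exact Nat.zero_le _
    · have hx : Place.infinity.valuation (x : RatFunc F) ≤ 1 := x.2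
      rw [hxnd, map_div₀, hw _ hn, hw _ hd.ne_zero, ← WithZero.exp_sub, ← WithZero.exp_zero,
        WithZero.exp_le_exp] at hx
      omega
  -- The value of `n / d` at infinity, `d` being monic and `deg n ≤ deg d`.
  refine ⟨n.coeff d.natDegree, ?_⟩
  set c := n.coeff d.natDegree with hc
  have e : (x : RatFunc F) - RatFunc.C c = algebraMap F[X] _ (n - C c * d) / algebraMap F[X] _ d := by
    rw [hxnd, map_sub, map_mul, RatFunc.algebraMap_C, sub_div, mul_div_cancel_right₀ _ hd0]
  rw [e, map_div₀, hw _ hd.ne_zero]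
  by_cases hp : n - C c * d = 0
  · rw [hp, map_zero, map_zero, zero_div]
    exact zero_lt_one
  · have hlt : (n - C c * d).natDegree < d.natDegree := by
      refine lt_of_le_of_ne ((natDegree_sub_le _ _).trans (max_le hle (natDegree_C_mul_le _ _))) ?_
      intro h
      refine hp (leadingCoeff_eq_zero.1 ?_)
      rw [leadingCoeff, h, coeff_sub, coeff_C_mul, ← leadingCoeff, hd.leadingCoeff, mul_one, hc,
        sub_self]
    rw [hw _ hp, ← WithZero.exp_sub, ← WithZero.exp_zero, WithZero.exp_lt_exp]
    omega

/-- Scaling by `u = t ^ (q ^ a) - t` gives `y² = x (x + 1) (x + B)` with `B = 16γ / u²` of positive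
valuation at infinity. The reduction `y² = x² (x + 1)` has a split node. -/
theorem localPolynomial_infinity (hF : ringChar F ≠ 2) {γ : F} (hγ : γ ≠ 0) {a : ℕ} (ha : 1 ≤ a) :
    (curve a γ).localPolynomial (Place.infinity (F := F)).ring = 1 - X := by
  classical
  have : Finite (IsLocalRing.ResidueField (Place.infinity (F := F)).ring) := by
    choose c x hx hy using residue_infinity_surjective F
    refine Finite.of_injective c fun y z h => ?_
    rw [← hy y, ← hy z]
    congr 1
    exact Subtype.ext (by rw [hx, hx, h])
  let _ := Fintype.ofFinite (IsLocalRing.ResidueField (Place.infinity (F := F)).ring)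
  have h2 : (2 : F) ≠ 0 := Ring.two_ne_zero hF
  have h16 : (16 * γ : F) ≠ 0 := by
    have : (16 : F) = 2 ^ 4 := by norm_num
    rw [this]
    exact mul_ne_zero (pow_ne_zero 4 h2) hγ
  have hC : ∀ c : F, c ≠ 0 → (Place.infinity (F := F)).valuation (RatFunc.C c) = 1 := fun c hc =>
    RatFunc.inftyValuation.C F hc
  have h2u : IsUnit (2 : (Place.infinity (F := F)).ring) := by
    rw [(Valuation.valuationSubring.integers _).isUnit_iff_valuation_eq_one]
    have := hC 2 h2
    rwa [map_ofNat] at this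
  have hd := natDegree_X_pow_card_pow_sub_X (F := F) ha
  have hq : 0 < Fintype.card F ^ a := pow_pos Fintype.card_pos _
  have hP0 : (X ^ Fintype.card F ^ a - X : F[X]) ≠ 0 := fun h => by
    rw [h, natDegree_zero] at hd
    omega
  have hwp : wp F a = algebraMap F[X] _ (X ^ Fintype.card F ^ a - X) := by
    rw [map_sub, map_pow, RatFunc.algebraMap_X, wp]
  have hwp0 : wp F a ≠ 0 := by
    rw [hwp]
    exact (_root_.map_ne_zero_iff _ (RatFunc.algebraMap_injective F)).2 hP0
  have hwpv : 1 < (Place.infinity (F := F)).valuation (wp F a) := by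
    have : (Place.infinity (F := F)).valuation (wp F a) =
        WithZero.exp ((Fintype.card F ^ a : ℕ) : ℤ) := by
      rw [hwp]
      exact (RatFunc.inftyValuation.polynomial F hP0).trans (by rw [hd])
    rw [this, ← WithZero.exp_zero, WithZero.exp_lt_exp]
    exact_mod_cast hq
  set B : RatFunc F := RatFunc.C (16 * γ) / wp F a ^ 2 with hB
  have hBv : (Place.infinity (F := F)).valuation B < 1 := by
    rw [hB, map_div₀, hC _ h16, map_pow, one_div]
    exact inv_lt_one_of_one_lt₀ (one_lt_pow₀ hwpv two_ne_zero)
  let b : (Place.infinity (F := F)).ring := ⟨B, hBv.le⟩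
  have hbres : IsLocalRing.residue _ b = 0 := (residue_eq_zero_iff_valuation _ _).2 hBv
  have hB0 : B ≠ 0 := div_ne_zero ((_root_.map_ne_zero _).2 h16) (pow_ne_zero 2 hwp0)
  have hb0 : b ≠ 0 := fun h => hB0 (congrArg Subtype.val h)
  have hb1 : 1 ≠ b := fun h => by
    rw [← h, map_one] at hbres
    exact one_ne_zero hbres
  have hnu : ¬ IsUnit (b * (1 - b)) := fun h => by
    have := (h.map (IsLocalRing.residue _)).ne_zero
    rw [map_mul, hbres, zero_mul] at this
    exact this rfl
  have key := (localPolynomial_legendre (K := RatFunc F) h2u isUnit_one hb0 hb1 (curve a γ)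
    ⟨Units.mk0 (wp F a) hwp0, 0, 0, 0⟩ (by
      have hb : algebraMap (Place.infinity (F := F)).ring (RatFunc F) b = B := rfl
      rw [WeierstrassCurve.baseChange, legendre_map, map_one, hb, hB, map_mul, map_ofNat]
      ext <;> simp [curve, legendre, WeierstrassCurve.variableChange_def]
      all_goals
        field_simp
        try ring)).2 hnu
  have hκ : ringChar (IsLocalRing.ResidueField (Place.infinity (F := F)).ring) ≠ 2 := fun h => by
    have h0 := CharP.cast_eq_zero (IsLocalRing.ResidueField (Place.infinity (F := F)).ring)
      (ringChar (IsLocalRing.ResidueField (Place.infinity (F := F)).ring))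
    rw [h] at h0
    refine (h2u.map (IsLocalRing.residue _)).ne_zero ?_
    rw [map_ofNat]
    exact_mod_cast h0
  rw [key, hbres, ellTrace_zero_right hκ, map_one, map_one, C_1, one_mul]

end LocalFactors

/-! ### The trace identity over all extensions. -/

section TraceIdentity

variable {F : Type*} [Field F] [Fintype F]

theorem FinitePlace.card_residueField (v : FinitePlace F) [Fintype v.residueField] :
    Fintype.card v.residueField = Fintype.card F ^ v.degree := by
  rw [Module.card_eq_pow_finrank (K := F), v.finrank_residueField]

theorem FinitePlace.root_ne_zero {F : Type*} [Field F] {v : FinitePlace F} (hv : v.poly ≠ X) :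
    AdjoinRoot.root v.poly ≠ 0 := by
  intro h
  rw [← AdjoinRoot.mk_X, AdjoinRoot.mk_eq_zero] at h
  exact hv (eq_of_monic_of_associated v.monic monic_X
    ((v.irreducible.dvd_irreducible_iff_associated irreducible_X).1 h))

/-- The eigenvalues over the residue field serve every larger field, by transitivity of the trace.
The condition `v.poly ≠ X`, which makes the parameter `γβ²` nonzero, sits inside the existential so
that eigenvalues can be chosen for all places at once. -/
theorem exists_kl_eq_add {ψ : AddChar F ℂ} (hψ : ψ ≠ 1) {γ : F} (hγ : γ ≠ 0) (v : FinitePlace F) :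
    ∃ α β : ℂ, v.poly ≠ X → α + β = kl ψ γ v ∧ α * β = (Fintype.card F : ℂ) ^ v.degree ∧
      ∀ (K : Type) [Field K] [Fintype K] [Algebra F K] (τ : K), minpoly F τ = v.poly →
        kloostermanSum (ψ.compAddMonoidHom (Algebra.trace F K).toAddMonoidHom)
          (algebraMap F K γ * τ ^ 2) =
          α ^ (Module.finrank F K / v.degree) + β ^ (Module.finrank F K / v.degree) := by
  let _ : Fintype v.residueField := Fintype.ofFinite _
  obtain ⟨α, β, h1, h2⟩ := exists_add_eq_mul_eq (kl ψ γ v) (Fintype.card v.residueField)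
  refine ⟨α, β, fun hv => ⟨h1, ?_, fun K _ _ _ τ hτ => ?_⟩⟩
  · rw [h2, v.card_residueField, Nat.cast_pow]
  · obtain ⟨_, _, hroot, hn⟩ := v.exists_algebra_residueField hτ
    have hb : algebraMap F v.residueField γ * AdjoinRoot.root v.poly ^ 2 ≠ 0 :=
      mul_ne_zero ((_root_.map_ne_zero _).2 hγ) (pow_ne_zero 2 (FinitePlace.root_ne_zero hv))
    have := kloostermanSum_extension (compAddMonoidHom_trace_ne_one hψ v.residueField) hb h1 h2 K
    rw [hn, map_mul, map_pow, hroot, ← IsScalarTower.algebraMap_apply F v.residueField K] at this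
    rw [← this]
    congr 1
    ext x
    exact congrArg ψ (Algebra.trace_trace (R := F) (S := v.residueField) x).symm

theorem minpoly_eq_X_iff {F K : Type*} [Field F] [Field K] [Finite K] [Algebra F K] (x : K) :
    minpoly F x = X ↔ x = 0 := by
  refine ⟨fun h => ?_, fun h => by rw [h, minpoly.zero]⟩
  have := minpoly.aeval F x
  rwa [h, aeval_X] at this

theorem natDegree_minpoly_dvd_iff {K : Type*} [Field K] [Finite K] [Algebra F K] (x : K) (a : ℕ) :
    (minpoly F x).natDegree ∣ a ↔ x ^ Fintype.card F ^ a = x := by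
  rw [(minpoly.irreducible (.of_finite F x)).natDegree_dvd_iff_dvd_X_pow_card_pow_sub_X,
    minpoly.dvd_iff, map_sub, map_pow, aeval_X, sub_eq_zero, Nat.card_eq_fintype_card]

theorem sum_place (K : Type*) [Field K] [Fintype K] [Algebra F K] (f : FinitePlace F → ℂ)
    (g : K → ℂ) (h : ∀ x v, minpoly F x = v.poly → g x = f v) :
    ∑ x, g x = ∑ v ∈ placesLE F (Module.finrank F K),
      if v.degree ∣ Module.finrank F K then (v.degree : ℂ) * f v else 0 := by
  classical
  let φ : F[X] → ℂ := fun p => if hp : p.Monic ∧ Irreducible p then f ⟨p, hp.1, hp.2⟩ else 0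
  have h1 : ∀ v : FinitePlace F, φ v.poly = f v := fun v => dif_pos ⟨v.monic, v.irreducible⟩
  have h2 : ∀ x, g x = φ (minpoly F x) := fun x => by
    have hx : (minpoly F x).Monic ∧ Irreducible (minpoly F x) :=
      ⟨minpoly.monic (.of_finite F x), minpoly.irreducible (.of_finite F x)⟩
    rw [h x ⟨_, hx.1, hx.2⟩ rfl]
    exact (h1 ⟨_, hx.1, hx.2⟩).symm
  rw [Finset.sum_congr rfl fun x _ => h2 x, sum_minpoly]
  refine Finset.sum_congr rfl fun v _ => ?_
  rw [h1]

/-- The trace formula: comparison of elliptic and Kloosterman Frobenius eigenvalues. -/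
theorem sum_eigenvalues (hF : ringChar F ≠ 2) {ψ : AddChar F ℂ} (hψ : ψ ≠ 1) {γ : F} (hγ : γ ≠ 0)
    {a : ℕ} (ha : 1 ≤ a) {α β α' β' : FinitePlace F → ℂ}
    (h : ∀ (v : FinitePlace F) (K : Type) [Field K] [Fintype K] [DecidableEq K] [Algebra F K]
      (τ : K), minpoly F τ = v.poly →
        (ellTrace K (algebraMap F K (16 * γ)) ((τ ^ Fintype.card F ^ a - τ) ^ 2) : ℂ) =
          α v ^ (Module.finrank F K / v.degree) + β v ^ (Module.finrank F K / v.degree))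
    (h₁ : ∀ v : FinitePlace F, v.poly ≠ X → α' v * β' v = (Fintype.card F : ℂ) ^ v.degree)
    (h₂ : ∀ (v : FinitePlace F), v.poly ≠ X → ∀ (K : Type) [Field K] [Fintype K] [Algebra F K]
      (τ : K), minpoly F τ = v.poly →
        kloostermanSum (ψ.compAddMonoidHom (Algebra.trace F K).toAddMonoidHom)
          (algebraMap F K γ * τ ^ 2) =
          α' v ^ (Module.finrank F K / v.degree) + β' v ^ (Module.finrank F K / v.degree))
    {n : ℕ} (hn : 0 < n) :
    1 + ∑ v ∈ placesLE F n, (if v.degree ∣ n then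
        (v.degree : ℂ) * (α v ^ (n / v.degree) + β v ^ (n / v.degree)) else 0) =
      -∑ v ∈ placesDividing F a ha, if v.degree ∣ n then (v.degree : ℂ) *
        (((Fintype.card F : ℂ) ^ v.degree) ^ (n / v.degree) + (α' v ^ 2) ^ (n / v.degree) +
          (β' v ^ 2) ^ (n / v.degree)) else 0 := by
  classical
  have : NeZero n := ⟨hn.ne'⟩
  have : Fact (ringChar F).Prime := ⟨CharP.char_is_prime F (ringChar F)⟩
  let K := FiniteField.Extension F (ringChar F) n
  have : Fintype K := Fintype.ofFinite K
  have hK : Module.finrank F K = n := FiniteField.finrank_extension _ _ _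
  have hcard : (Fintype.card K : ℂ) = (Fintype.card F : ℂ) ^ n := by
    rw [Module.card_eq_pow_finrank (K := F), hK, Nat.cast_pow]
  have e1 := sum_place K (fun v => α v ^ (n / v.degree) + β v ^ (n / v.degree)) _
    fun τ v hτ => (h v K τ hτ).trans (by rw [hK])
  let f : FinitePlace F → ℂ := fun v => if v.degree ∣ a ∧ v.poly ≠ X then
    -(((Fintype.card F : ℂ) ^ v.degree) ^ (n / v.degree) + (α' v ^ 2) ^ (n / v.degree) +
      (β' v ^ 2) ^ (n / v.degree)) else 0
  have e2 := sum_place K f (fun x => if x ^ Fintype.card F ^ a = x ∧ x ≠ 0 then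
    (Fintype.card K : ℂ) - kloostermanSum
      (ψ.compAddMonoidHom (Algebra.trace F K).toAddMonoidHom) (algebraMap F K γ * x ^ 2) ^ 2
      else 0) fun τ v hτ => by
    have hc : (τ ^ Fintype.card F ^ a = τ ∧ τ ≠ 0) ↔ (v.degree ∣ a ∧ v.poly ≠ X) := by
      rw [← natDegree_minpoly_dvd_iff (F := F), Ne, ← minpoly_eq_X_iff (F := F), hτ]
      rfl
    simp only [hc, f]
    split_ifs with hv
    · have hdvd : v.degree ∣ n := by
        rw [← hK]
        change v.poly.natDegree ∣ _
        rw [← hτ]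
        exact minpoly.degree_dvd (.of_finite F τ)
      rw [h₂ v hv.2 K τ hτ, hK, hcard]
      -- With `|K| = x y` for `x, y` the powers of the two eigenvalues, `|K| - (x + y)² = -(x y + x²
      -- + y²)`: the symmetric square appears.
      have hp : (Fintype.card F : ℂ) ^ n = α' v ^ (n / v.degree) * β' v ^ (n / v.degree) := by
        rw [← mul_pow, h₁ v hv.2, ← pow_mul, Nat.mul_div_cancel' hdvd]
      have hp' : ((Fintype.card F : ℂ) ^ v.degree) ^ (n / v.degree) =
          α' v ^ (n / v.degree) * β' v ^ (n / v.degree) := by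
        rw [← mul_pow, h₁ v hv.2]
      rw [hp, hp']
      ring
    · rfl
  have key := sum_ellTrace_fibres (K := K) hF hψ hγ a
  rw [e1, e2, hK] at key
  rw [key, add_neg_cancel_left, ← Finset.sum_neg_distrib]
  have hPD : ∀ v : FinitePlace F, v ∈ placesDividing F a ha ↔ v.poly ≠ X ∧ v.degree ∣ a := fun v => by
    simp [placesDividing]
  let g : FinitePlace F → ℂ := fun v => -((v.degree : ℂ) *
    (((Fintype.card F : ℂ) ^ v.degree) ^ (n / v.degree) + (α' v ^ 2) ^ (n / v.degree) +
      (β' v ^ 2) ^ (n / v.degree)))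
  have hL : ∀ v : FinitePlace F, (v.degree : ℂ) * f v =
      if v.degree ∣ a ∧ v.poly ≠ X then g v else 0 := fun v => by
    simp only [f, g]
    split_ifs <;> ring
  have hR : ∀ v : FinitePlace F, -(if v.degree ∣ n then (v.degree : ℂ) *
      (((Fintype.card F : ℂ) ^ v.degree) ^ (n / v.degree) + (α' v ^ 2) ^ (n / v.degree) +
        (β' v ^ 2) ^ (n / v.degree)) else 0) = if v.degree ∣ n then g v else 0 := fun v => by
    simp only [g]
    split_ifs <;> ring
  rw [← Finset.sum_filter, Finset.sum_congr rfl fun v _ => hL v, ← Finset.sum_filter,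
    Finset.filter_filter, Finset.sum_congr rfl fun v _ => hR v, ← Finset.sum_filter]
  refine Finset.sum_congr ?_ fun _ _ => rfl
  ext v
  simp only [Finset.mem_filter, mem_placesLE, hPD]
  exact ⟨fun hv => ⟨⟨hv.2.2.2, hv.2.2.1⟩, hv.2.1⟩,
    fun hv => ⟨Nat.le_of_dvd hn hv.2, hv.2, hv.1.2, hv.1.1⟩⟩

end TraceIdentity

/-! ### The Euler product and its evaluation as a polynomial. -/

section EulerProduct

variable {F : Type*} [Field F]

theorem Place.degree_pos (v : Place F) : 0 < v.degree := by
  cases v with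
  | finite v => exact v.degree_pos
  | infinity => exact one_pos

theorem eulerFactor_mul_eq_one (W : WeierstrassCurve (RatFunc F)) (v : Place F) {α β : ℂ}
    (h : (W.localPolynomial v.ring).map (Int.castRingHom ℂ) = (1 - C α * X) * (1 - C β * X)) :
    ((1 - PowerSeries.C α * PowerSeries.X ^ v.degree) *
      (1 - PowerSeries.C β * PowerSeries.X ^ v.degree)) *
        PowerSeries.map (Int.castRingHom ℂ) (eulerFactor W v) = 1 := by
  have h0 : (W.localPolynomial v.ring).coeff 0 = 1 := by
    have := congrArg (fun p => coeff p 0) h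
    simp only [coeff_map, mul_coeff_zero, coeff_sub, coeff_one_zero, coeff_X_zero,
      mul_zero, sub_zero, mul_one, eq_intCast] at this
    exact_mod_cast this
  have h1 : ((expand ℤ v.degree (W.localPolynomial v.ring) : ℤ[X]) : PowerSeries ℤ) *
      eulerFactor W v = 1 := by
    refine PowerSeries.mul_invOfUnit _ _ ?_
    rw [← PowerSeries.coeff_zero_eq_constantCoeff_apply, coeff_coe, coeff_expand v.degree_pos,
      if_pos (dvd_zero _), Nat.zero_div, h0, Units.val_one]
  have h2 := congrArg (PowerSeries.map (Int.castRingHom ℂ)) h1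
  rw [map_mul, map_one, ← polynomial_map_coe, map_expand, h] at h2
  refine Eq.trans ?_ h2
  congr 1
  simp only [map_mul, map_sub, map_one, expand_C, expand_X]
  rw [coe_mul, coe_sub, coe_sub, coe_mul, coe_mul, coe_pow, coe_one, coe_C, coe_C, coe_X]

theorem isLogDeriv_eulerFactor (W : WeierstrassCurve (RatFunc F)) (v : Place F) {α β : ℂ}
    (h : (W.localPolynomial v.ring).map (Int.castRingHom ℂ) = (1 - C α * X) * (1 - C β * X)) :
    IsLogDeriv (PowerSeries.map (Int.castRingHom ℂ) (eulerFactor W v))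
      (PowerSeries.mk fun n => if v.degree ∣ n ∧ 0 < n then
        (v.degree : ℂ) * (α ^ (n / v.degree) + β ^ (n / v.degree)) else 0) := by
  have h1 := ((isLogDeriv_one_sub α v.degree_pos).mul (isLogDeriv_one_sub β v.degree_pos)).of_mul_eq_one
      (eulerFactor_mul_eq_one W v h)
  convert h1 using 1
  ext n
  simp only [map_neg, map_add, PowerSeries.coeff_mk]
  split_ifs <;> ring

theorem coeff_zero_prod_eq_one {ι : Type*} (s : Finset ι) (f : ι → PowerSeries ℂ)
    (h : ∀ i ∈ s, PowerSeries.coeff 0 (f i) = 1) : PowerSeries.coeff 0 (∏ i ∈ s, f i) = 1 := by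
  rw [PowerSeries.coeff_zero_eq_constantCoeff_apply, map_prod]
  refine Finset.prod_eq_one fun i hi => ?_
  rw [← PowerSeries.coeff_zero_eq_constantCoeff_apply, h i hi]

theorem coeff_zero_one_sub (α : ℂ) {d : ℕ} (hd : 0 < d) :
    PowerSeries.coeff 0 (1 - PowerSeries.C α * PowerSeries.X ^ d) = 1 := by
  rw [PowerSeries.coeff_zero_eq_constantCoeff_apply]
  simp [hd.ne']

variable [Fintype F]

/-- The polynomial with the eigenvalues of Frobenius as inverse roots. -/
def lPolynomial (a : ℕ) (ha : 1 ≤ a) (α' β' : FinitePlace F → ℂ) : ℂ[X] :=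
  ∏ v ∈ placesDividing F a ha, (1 - C ((Fintype.card F : ℂ) ^ v.degree) * X ^ v.degree) *
    ((1 - C (α' v ^ 2) * X ^ v.degree) * (1 - C (β' v ^ 2) * X ^ v.degree))

theorem coe_lPolynomial {a : ℕ} (ha : 1 ≤ a) (α' β' : FinitePlace F → ℂ) :
    (lPolynomial a ha α' β' : PowerSeries ℂ) = ∏ v ∈ placesDividing F a ha,
      (1 - PowerSeries.C ((Fintype.card F : ℂ) ^ v.degree) * PowerSeries.X ^ v.degree) *
        ((1 - PowerSeries.C (α' v ^ 2) * PowerSeries.X ^ v.degree) *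
          (1 - PowerSeries.C (β' v ^ 2) * PowerSeries.X ^ v.degree)) := by
  have h := map_prod (coeToPowerSeries.ringHom (R := ℂ)) (fun v : FinitePlace F =>
    (1 - C ((Fintype.card F : ℂ) ^ v.degree) * X ^ v.degree) *
    ((1 - C (α' v ^ 2) * X ^ v.degree) * (1 - C (β' v ^ 2) * X ^ v.degree)))
    (placesDividing F a ha)
  refine h.trans (Finset.prod_congr rfl fun v _ => ?_)
  simp only [coeToPowerSeries.ringHom_apply]
  simp only [coe_mul, coe_sub, coe_pow, coe_one, coe_C, coe_X]

theorem isLogDeriv_lPolynomial {a : ℕ} (ha : 1 ≤ a) (α' β' : FinitePlace F → ℂ) :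
    IsLogDeriv (lPolynomial a ha α' β' : PowerSeries ℂ)
      (∑ v ∈ placesDividing F a ha, PowerSeries.mk fun n => if v.degree ∣ n ∧ 0 < n then
        -((v.degree : ℂ) * (((Fintype.card F : ℂ) ^ v.degree) ^ (n / v.degree) +
          (α' v ^ 2) ^ (n / v.degree) + (β' v ^ 2) ^ (n / v.degree))) else 0) := by
  rw [coe_lPolynomial]
  refine IsLogDeriv.prod _ fun v _ => ?_
  have h1 := (isLogDeriv_one_sub ((Fintype.card F : ℂ) ^ v.degree) v.degree_pos).mul
    ((isLogDeriv_one_sub (α' v ^ 2) v.degree_pos).mul (isLogDeriv_one_sub (β' v ^ 2) v.degree_pos))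
  convert h1 using 1
  ext n
  simp only [map_add, PowerSeries.coeff_mk]
  split_ifs <;> ring

theorem coeff_zero_lPolynomial {a : ℕ} (ha : 1 ≤ a) (α' β' : FinitePlace F → ℂ) :
    PowerSeries.coeff 0 (lPolynomial a ha α' β' : PowerSeries ℂ) = 1 := by
  rw [coe_lPolynomial]
  refine coeff_zero_prod_eq_one _ _ fun v _ => ?_
  have h := fun α : ℂ => coeff_zero_one_sub α v.degree_pos
  simp only [PowerSeries.coeff_zero_eq_constantCoeff_apply] at h ⊢
  rw [map_mul, map_mul, h, h, h, one_mul, one_mul]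

/-- The logarithmic derivatives agree up to degree `N`: by the trace identity on one side, and
because places of degree larger than `N` do not contribute on the other. Constant terms being `1`,
the coefficients agree too. -/
theorem coeff_prod_eulerFactor (hF : ringChar F ≠ 2) {ψ : AddChar F ℂ} (hψ : ψ ≠ 1) {γ : F}
    (hγ : γ ≠ 0) {a : ℕ} (ha : 1 ≤ a) {α' β' : FinitePlace F → ℂ}
    (h₁ : ∀ v : FinitePlace F, v.poly ≠ X → α' v * β' v = (Fintype.card F : ℂ) ^ v.degree)
    (h₂ : ∀ (v : FinitePlace F), v.poly ≠ X → ∀ (K : Type) [Field K] [Fintype K] [Algebra F K]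
      (τ : K), minpoly F τ = v.poly →
        kloostermanSum (ψ.compAddMonoidHom (Algebra.trace F K).toAddMonoidHom)
          (algebraMap F K γ * τ ^ 2) =
          α' v ^ (Module.finrank F K / v.degree) + β' v ^ (Module.finrank F K / v.degree))
    (N : ℕ) (s : Finset (Place F)) (hinf : Place.infinity ∈ s)
    (hs : ∀ v : FinitePlace F, v.degree ≤ N → Place.finite v ∈ s) :
    ((PowerSeries.coeff N (∏ v ∈ s, eulerFactor (curve a γ) v) : ℤ) : ℂ) =
      (lPolynomial a ha α' β').coeff N := by
  classical
  choose α β hαβ h using exists_localPolynomial_finite_eq_mul hF hγ ha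
  -- At infinity the factor `1 - T` has eigenvalues `1` and `0`; its contribution is the leading `1`
  -- in `sum_eigenvalues`.
  let α₀ : Place F → ℂ := fun v => match v with | .finite v => α v | .infinity => 1
  let β₀ : Place F → ℂ := fun v => match v with | .finite v => β v | .infinity => 0
  have hloc : ∀ v : Place F, ((curve a γ).localPolynomial v.ring).map (Int.castRingHom ℂ) =
      (1 - C (α₀ v) * X) * (1 - C (β₀ v) * X) := fun v => by
    cases v with
    | finite v => exact hαβ v
    | infinity =>
      rw [localPolynomial_infinity hF hγ ha]
      simp [α₀, β₀]
  have hcast : ((PowerSeries.coeff N (∏ v ∈ s, eulerFactor (curve a γ) v) : ℤ) : ℂ) =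
      PowerSeries.coeff N (∏ v ∈ s, PowerSeries.map (Int.castRingHom ℂ)
        (eulerFactor (curve a γ) v)) := by
    rw [← map_prod, PowerSeries.coeff_map, eq_intCast]
  have hlog := IsLogDeriv.prod s fun v _ => isLogDeriv_eulerFactor (curve a γ) v (hloc v)
  have hE0 : ∀ v : Place F, PowerSeries.coeff 0 (PowerSeries.map (Int.castRingHom ℂ)
      (eulerFactor (curve a γ) v)) = 1 := fun v => by
    have h3 := congrArg (PowerSeries.coeff 0) (eulerFactor_mul_eq_one _ v (hloc v))
    have h4 := fun α : ℂ => coeff_zero_one_sub α v.degree_pos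
    simp only [PowerSeries.coeff_zero_eq_constantCoeff_apply] at h3 h4 ⊢
    rwa [map_mul, map_mul, h4, h4, one_mul, one_mul, map_one] at h3
  rw [hcast, ← coeff_coe]
  refine hlog.coeff_eq (isLogDeriv_lPolynomial ha α' β')
    (coeff_zero_prod_eq_one _ _ fun v _ => hE0 v) (coeff_zero_lPolynomial ha α' β') N
    (fun n hn hnN => ?_) N le_rfl
  rw [map_sum, map_sum]
  simp only [PowerSeries.coeff_mk, hn, and_true]
  have key := sum_eigenvalues hF hψ hγ ha (α := α) (β := β) (fun v K _ _ _ _ τ hτ => h v K τ hτ)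
    h₁ h₂ hn
  have hR : ∑ v ∈ placesDividing F a ha, (if v.degree ∣ n then
      -((v.degree : ℂ) * (((Fintype.card F : ℂ) ^ v.degree) ^ (n / v.degree) +
        (α' v ^ 2) ^ (n / v.degree) + (β' v ^ 2) ^ (n / v.degree))) else 0) =
      -∑ v ∈ placesDividing F a ha, if v.degree ∣ n then (v.degree : ℂ) *
        (((Fintype.card F : ℂ) ^ v.degree) ^ (n / v.degree) + (α' v ^ 2) ^ (n / v.degree) +
          (β' v ^ 2) ^ (n / v.degree)) else 0 := by
    rw [← Finset.sum_neg_distrib]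
    refine Finset.sum_congr rfl fun v _ => ?_
    split_ifs <;> ring
  rw [hR, ← key]
  have hsub : insert Place.infinity ((placesLE F n).image Place.finite) ⊆ s := by
    intro v hv
    rw [Finset.mem_insert, Finset.mem_image] at hv
    rcases hv with rfl | ⟨v, hv, rfl⟩
    · exact hinf
    · exact hs v ((mem_placesLE.1 hv).trans hnN)
  rw [← Finset.sum_subset hsub, Finset.sum_insert, Finset.sum_image]
  · congr 1
    simp [Place.degree, α₀, β₀, hn.ne']
  · intro v _ w _ hvw
    exact Place.finite.inj hvw
  · simp
  · intro v _ hv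
    refine if_neg fun hdvd => hv ?_
    cases v with
    | infinity => exact Finset.mem_insert_self _ _
    | finite v =>
      exact Finset.mem_insert_of_mem (Finset.mem_image_of_mem _
        (mem_placesLE.2 (Nat.le_of_dvd hn hdvd)))

/-- Each coefficient of the partial products is eventually constant, which gives convergence; being
an integer, it also shows that the complex polynomial has integral coefficients. -/
theorem exists_isLFunction (hF : ringChar F ≠ 2) {ψ : AddChar F ℂ} (hψ : ψ ≠ 1) {γ : F}
    (hγ : γ ≠ 0) {a : ℕ} (ha : 1 ≤ a) {α' β' : FinitePlace F → ℂ}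
    (h₁ : ∀ v : FinitePlace F, v.poly ≠ X → α' v * β' v = (Fintype.card F : ℂ) ^ v.degree)
    (h₂ : ∀ (v : FinitePlace F), v.poly ≠ X → ∀ (K : Type) [Field K] [Fintype K] [Algebra F K]
      (τ : K), minpoly F τ = v.poly →
        kloostermanSum (ψ.compAddMonoidHom (Algebra.trace F K).toAddMonoidHom)
          (algebraMap F K γ * τ ^ 2) =
          α' v ^ (Module.finrank F K / v.degree) + β' v ^ (Module.finrank F K / v.degree)) :
    ∃ L : ℤ[X], IsLFunction (curve a γ) (L : PowerSeries ℤ) ∧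
      L.map (Int.castRingHom ℂ) = lPolynomial a ha α' β' := by
  classical
  have key := coeff_prod_eulerFactor hF hψ hγ ha h₁ h₂
  let s₀ : ℕ → Finset (Place F) := fun N =>
    insert Place.infinity ((placesLE F N).image Place.finite)
  have hs₀ : ∀ N (s : Finset (Place F)), s₀ N ⊆ s → Place.infinity ∈ s ∧
      ∀ v : FinitePlace F, v.degree ≤ N → Place.finite v ∈ s := fun N s hs =>
    ⟨hs (Finset.mem_insert_self _ _), fun v hv => hs (Finset.mem_insert_of_mem
      (Finset.mem_image_of_mem _ (mem_placesLE.2 hv)))⟩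
  obtain ⟨L, hL⟩ := (mem_lifts (f := Int.castRingHom ℂ) _).1
    ((lifts_iff_coeff_lifts (lPolynomial a ha α' β')).2 fun N =>
      ⟨_, key N (s₀ N) (hs₀ N _ subset_rfl).1 (hs₀ N _ subset_rfl).2⟩)
  refine ⟨L, ?_, hL⟩
  unfold IsLFunction HasProd
  rw [PowerSeries.WithPiTopology.tendsto_iff_coeff_tendsto]
  intro N
  refine tendsto_nhds_of_eventually_eq ?_
  rw [SummationFilter.unconditional_filter, Filter.eventually_atTop]
  refine ⟨s₀ N, fun s hs => ?_⟩
  have h3 := key N s (hs₀ N s hs).1 (hs₀ N s hs).2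
  rw [← hL, coeff_map, eq_intCast, Int.cast_inj] at h3
  rw [h3, coeff_coe]

end EulerProduct

/-! ### Order of vanishing and special value. -/

section SpecialValue

variable {F : Type*} [Field F] [Fintype F]

/-- The cofactor of `(1 - q T) ^ ρ` in `lPolynomial`. -/
def lCofactor (a : ℕ) (ha : 1 ≤ a) (α' β' : FinitePlace F → ℂ) : ℂ[X] :=
  ∏ v ∈ placesDividing F a ha,
    (∑ i ∈ Finset.range v.degree, (C (Fintype.card F : ℂ) * X) ^ i) *
      ((1 - C (α' v ^ 2) * X ^ v.degree) * (1 - C (β' v ^ 2) * X ^ v.degree))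

theorem lPolynomial_eq {a : ℕ} (ha : 1 ≤ a) (α' β' : FinitePlace F → ℂ) :
    lPolynomial a ha α' β' = (1 - C (Fintype.card F : ℂ) * X) ^ (placesDividing F a ha).card *
      lCofactor a ha α' β' := by
  rw [lPolynomial, lCofactor, ← Finset.prod_const, ← Finset.prod_mul_distrib]
  refine Finset.prod_congr rfl fun v _ => ?_
  rw [← mul_assoc _ (∑ i ∈ _, _), mul_neg_geom_sum, mul_pow, ← C_pow]

/-- The geometric sum contributes `deg v`. With `Q = q ^ deg v = α' β'`, the rest is `(1 - α'²/Q)(1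
- β'²/Q) = 4 - (α' + β')²/Q`. -/
theorem eval_lCofactor {a : ℕ} (ha : 1 ≤ a) {α' β' κ : FinitePlace F → ℂ}
    (h : ∀ v ∈ placesDividing F a ha, α' v + β' v = κ v ∧
      α' v * β' v = (Fintype.card F : ℂ) ^ v.degree) :
    (lCofactor a ha α' β').eval (Fintype.card F : ℂ)⁻¹ =
      (∏ v ∈ placesDividing F a ha, 4 * (v.degree : ℂ)) * ∏ v ∈ placesDividing F a ha,
        (1 - κ v ^ 2 / (4 * (Fintype.card F : ℂ) ^ v.degree)) := by
  have hq : (Fintype.card F : ℂ) ≠ 0 := Nat.cast_ne_zero.2 Fintype.card_ne_zero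
  rw [lCofactor, eval_prod, ← Finset.prod_mul_distrib]
  refine Finset.prod_congr rfl fun v hv => ?_
  obtain ⟨h1, h2⟩ := h v hv
  have hQ := pow_ne_zero v.degree hq
  have e1 : (∑ i ∈ Finset.range v.degree, (C (Fintype.card F : ℂ) * X) ^ i).eval
      (Fintype.card F : ℂ)⁻¹ = (v.degree : ℂ) := by
    rw [eval_finsetSum]
    simp [hq]
  rw [eval_mul, e1]
  simp only [eval_mul, eval_sub, eval_one, eval_C, eval_pow, eval_X, inv_pow]
  rw [← h1]
  set Q := (Fintype.card F : ℂ) ^ v.degree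
  field_simp
  linear_combination (v.degree : ℂ) * (α' v * β' v + 3 * Q) * h2

theorem rootMultiplicity_lPolynomial {a : ℕ} (ha : 1 ≤ a) {α' β' : FinitePlace F → ℂ}
    (h : (lCofactor a ha α' β').eval (Fintype.card F : ℂ)⁻¹ ≠ 0) :
    (lPolynomial a ha α' β').rootMultiplicity (Fintype.card F : ℂ)⁻¹ =
      (placesDividing F a ha).card := by
  have hq : (Fintype.card F : ℂ) ≠ 0 := Nat.cast_ne_zero.2 Fintype.card_ne_zero
  set n := (placesDividing F a ha).card
  have e : lPolynomial a ha α' β' = (C ((-(Fintype.card F : ℂ)) ^ n) * lCofactor a ha α' β') *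
      (X - C (Fintype.card F : ℂ)⁻¹) ^ n := by
    have : (1 - C (Fintype.card F : ℂ) * X : ℂ[X]) =
        C (-(Fintype.card F : ℂ)) * (X - C (Fintype.card F : ℂ)⁻¹) := by
      rw [mul_sub, ← C_mul, neg_mul, mul_inv_cancel₀ hq, C_neg, C_neg, C_1]
      ring
    rw [lPolynomial_eq, this, mul_pow, C_pow]
    ring
  have hne : (C ((-(Fintype.card F : ℂ)) ^ n) * lCofactor a ha α' β').eval
      (Fintype.card F : ℂ)⁻¹ ≠ 0 := by
    rw [eval_mul, eval_C]
    exact mul_ne_zero (pow_ne_zero _ (neg_ne_zero.2 hq)) h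
  rw [e, rootMultiplicity_mul_X_sub_C_pow (fun h0 => hne (by rw [h0, eval_zero])),
    rootMultiplicity_eq_zero hne, zero_add]

theorem map_map_cast (L : ℤ[X]) : (L.map (Int.castRingHom ℚ)).map (algebraMap ℚ ℂ) =
    L.map (Int.castRingHom ℂ) := by
  rw [Polynomial.map_map]
  congr 1

theorem analyticRank_eq {q : ℕ} (L : ℤ[X]) :
    analyticRank q L = (L.map (Int.castRingHom ℂ)).rootMultiplicity (q : ℂ)⁻¹ := by
  rw [analyticRank, eq_rootMultiplicity_map (algebraMap ℚ ℂ).injective, map_map_cast, map_inv₀,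
    map_natCast]

theorem specialValue_eq {q n : ℕ} {L : ℤ[X]} {G : ℂ[X]} (hn : analyticRank q L = n)
    (hL : L.map (Int.castRingHom ℂ) = (1 - C (q : ℂ) * X) ^ n * G) :
    ((specialValue q L : ℚ) : ℂ) = G.eval (q : ℂ)⁻¹ := by
  have hne : (1 - C (q : ℂ) * X) ^ n ≠ 0 := pow_ne_zero n fun h => by
    have := congrArg (eval 0) h
    simp at this
  have h1 : (L.map (Int.castRingHom ℚ) / (1 - C (q : ℚ) * X) ^ n).map (algebraMap ℚ ℂ) = G := by
    have h2 : ((1 - C (q : ℚ) * X) ^ n).map (algebraMap ℚ ℂ) = (1 - C (q : ℂ) * X) ^ n := by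
      rw [Polynomial.map_pow, Polynomial.map_sub, Polynomial.map_one, Polynomial.map_mul,
        Polynomial.map_C, map_X, map_natCast]
    rw [Polynomial.map_div, map_map_cast, hL, h2]
    exact mul_div_cancel_left₀ G hne
  rw [specialValue, hn, ← h1, eval_map, ← map_natCast (algebraMap ℚ ℂ), ← map_inv₀, eval₂_at_apply]
  rfl

end SpecialValue

/-! ### Kloosterman angles. -/

section Angle

variable {F : Type*} [Field F] [Fintype F]

theorem kl_eq_re (ψ : AddChar F ℂ) (γ : F) (v : FinitePlace F) :
    kl ψ γ v = ((kl ψ γ v).re : ℂ) := by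
  let _ : Fintype v.residueField := Fintype.ofFinite _
  exact kloostermanSum_eq_re _ _

theorem kl_re_sq_le (hF : ringChar F ≠ 2) {ψ : AddChar F ℂ} (hψ : ψ ≠ 1) {γ : F} (hγ : γ ≠ 0)
    {v : FinitePlace F} (hv : v.poly ≠ X) :
    (kl ψ γ v).re ^ 2 ≤ 4 * (Fintype.card F : ℝ) ^ v.degree := by
  let _ : Fintype v.residueField := Fintype.ofFinite _
  have := re_kloostermanSum_sq_le (by rwa [← Algebra.ringChar_eq F v.residueField])
    (compAddMonoidHom_trace_ne_one hψ v.residueField) (mul_ne_zero ((_root_.map_ne_zero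
      (algebraMap F v.residueField)).2 hγ) (pow_ne_zero 2 (FinitePlace.root_ne_zero hv)))
  rwa [v.card_residueField, Nat.cast_pow] at this

theorem kl_sq_ne (ψ : AddChar F ℂ) (γ : F) (v : FinitePlace F) :
    kl ψ γ v ^ 2 ≠ 4 * (Fintype.card F : ℂ) ^ v.degree := by
  let _ : Fintype v.residueField := Fintype.ofFinite _
  have := kloostermanSum_sq_ne (ψ.compAddMonoidHom (Algebra.trace F v.residueField).toAddMonoidHom)
    (algebraMap F v.residueField γ * AdjoinRoot.root v.poly ^ 2)
  rwa [v.card_residueField, Nat.cast_pow] at this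

/-- Weil's bound places the quotient in `[-1, 1]`, where `arccos` is a genuine inverse of the
cosine. -/
theorem cos_angle (hF : ringChar F ≠ 2) {ψ : AddChar F ℂ} (hψ : ψ ≠ 1) {γ : F} (hγ : γ ≠ 0)
    {v : FinitePlace F} (hv : v.poly ≠ X) :
    Real.cos (angle ψ γ v) = (kl ψ γ v).re / (2 * √((Fintype.card F : ℝ) ^ v.degree)) := by
  have hQ : 0 < (Fintype.card F : ℝ) ^ v.degree := pow_pos (Nat.cast_pos.2 Fintype.card_pos) _
  have hs : 0 < 2 * √((Fintype.card F : ℝ) ^ v.degree) := mul_pos two_pos (Real.sqrt_pos.2 hQ)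
  have habs : |(kl ψ γ v).re| ≤ 2 * √((Fintype.card F : ℝ) ^ v.degree) := by
    refine abs_le_of_sq_le_sq ?_ hs.le
    rw [mul_pow, Real.sq_sqrt hQ.le]
    exact (kl_re_sq_le hF hψ hγ hv).trans (le_of_eq (by norm_num))
  rw [abs_le] at habs
  refine Real.cos_arccos ?_ ?_
  · rw [le_div_iff₀ hs]
    linarith
  · rw [div_le_iff₀ hs]
    linarith

theorem sin_angle_sq (hF : ringChar F ≠ 2) {ψ : AddChar F ℂ} (hψ : ψ ≠ 1) {γ : F} (hγ : γ ≠ 0)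
    {v : FinitePlace F} (hv : v.poly ≠ X) : Real.sin (angle ψ γ v) ^ 2 =
      1 - (kl ψ γ v).re ^ 2 / (4 * (Fintype.card F : ℝ) ^ v.degree) := by
  have hQ : 0 < (Fintype.card F : ℝ) ^ v.degree := pow_pos (Nat.cast_pos.2 Fintype.card_pos) _
  rw [Real.sin_sq, cos_angle hF hψ hγ hv, div_pow, mul_pow, Real.sq_sqrt hQ.le]
  norm_num

end Angle

end

end ArtinSchreierCurve

/-! ### Assembly of the theorem. -/

theorem mainTheorem9 {F : Type*} [Field F] [Fintype F] (hF : ringChar F ≠ 2)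
    (ψ : AddChar F ℂ) (hψ : ψ ≠ 1) (γ : F) (hγ : γ ≠ 0) (a : ℕ) (ha : 1 ≤ a) :
    ∃ L : ℤ[X], IsLFunction (curve a γ) (L : PowerSeries ℤ) ∧
      analyticRank (Fintype.card F) L = (placesDividing F a ha).card ∧
      ((specialValue (Fintype.card F) L : ℚ) : ℂ) =
        (∏ v ∈ placesDividing F a ha, 4 * (v.degree : ℂ)) *
          ∏ v ∈ placesDividing F a ha,
            (1 - kl ψ γ v ^ 2 / (4 * (Fintype.card F : ℂ) ^ v.degree)) ∧
      (∀ v ∈ placesDividing F a ha,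
        kl ψ γ v =
          ((2 * √((Fintype.card F : ℝ) ^ v.degree) * Real.cos (angle ψ γ v) : ℝ) : ℂ)) ∧
      ((specialValue (Fintype.card F) L : ℚ) : ℝ) =
        (∏ v ∈ placesDividing F a ha, 4 * (v.degree : ℝ)) *
          ∏ v ∈ placesDividing F a ha, Real.sin (angle ψ γ v) ^ 2 := by
  choose α' β' hK using exists_kl_eq_add hψ hγ
  have hmem : ∀ v ∈ placesDividing F a ha, v.poly ≠ X := fun v hv => by
    have : v.poly ≠ X ∧ v.degree ∣ a := by simpa [placesDividing] using hv
    exact this.1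
  obtain ⟨L, hL, hLmap⟩ := exists_isLFunction hF hψ hγ ha (fun v hv => (hK v hv).2.1)
    fun v hv => (hK v hv).2.2
  have heval := eval_lCofactor ha (κ := kl ψ γ) fun v hv =>
    ⟨(hK v (hmem v hv)).1, (hK v (hmem v hv)).2.1⟩
  have hq : (Fintype.card F : ℂ) ≠ 0 := Nat.cast_ne_zero.2 Fintype.card_ne_zero
  -- Nonvanishing of the cofactor makes the order of vanishing exactly the number of places; it uses
  -- the congruence modulo `p`, not Weil's bound.
  have hne : (lCofactor a ha α' β').eval (Fintype.card F : ℂ)⁻¹ ≠ 0 := by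
    rw [heval]
    refine mul_ne_zero (Finset.prod_ne_zero_iff.2 fun v _ => ?_)
      (Finset.prod_ne_zero_iff.2 fun v _ => ?_)
    · exact mul_ne_zero (by norm_num) (Nat.cast_ne_zero.2 v.degree_pos.ne')
    · rw [sub_ne_zero, ne_comm, Ne, div_eq_one_iff_eq (mul_ne_zero (by norm_num) (pow_ne_zero _ hq))]
      exact kl_sq_ne ψ γ v
  have hrank : analyticRank (Fintype.card F) L = (placesDividing F a ha).card := by
    rw [analyticRank_eq, hLmap, rootMultiplicity_lPolynomial ha hne]
  have hval := specialValue_eq hrank (hLmap.trans (lPolynomial_eq ha α' β'))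
  rw [heval] at hval
  refine ⟨L, hL, hrank, hval, fun v hv => ?_, ?_⟩
  · have hs : 2 * √((Fintype.card F : ℝ) ^ v.degree) ≠ 0 := mul_ne_zero two_ne_zero
      (Real.sqrt_pos.2 (pow_pos (Nat.cast_pos.2 Fintype.card_pos) _)).ne'
    rw [cos_angle hF hψ hγ (hmem v hv), mul_div_cancel₀ _ hs]
    exact kl_eq_re ψ γ v
  · rw [Finset.prod_congr rfl fun v hv => sin_angle_sq hF hψ hγ (hmem v hv)]
    refine Complex.ofReal_injective ?_
    rw [Complex.ofReal_ratCast, hval, Complex.ofReal_mul, Complex.ofReal_prod, Complex.ofReal_prod]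
    congr 1
    · refine Finset.prod_congr rfl fun v _ => ?_
      push_cast
      rfl
    · refine Finset.prod_congr rfl fun v _ => ?_
      push_cast
      rw [← kl_eq_re]
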